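/- Let $I=[0,2\pi)$, let $\omega(x)=|\sin\frac x2|$ and let $\omega'$ be its derivative, so that $\omega'(x)=\frac12\cos\frac x2$ for $0<x<2\pi$ (and $\omega'(0)=0$). For $x,y\in I$ put $$F_\pm(x,y)=\Bigl(\cos\tfrac x2+\cos\tfrac y2\Bigr)^2\pm4\sin\tfrac x2\sin\tfrac y2,\qquad K_1(x,y)=4\,\frac{\mathbf 1(F_-(x,y)>0)}{\sqrt{F_-(x,y)}},\qquad K_2(x,y)=\frac{2}{\sqrt{F_+(x,y)}},$$ and $V(x)=\int_I K_2(x,y)\,dy$, $W=\omega^2V$. The linearized collision operator of the FPU-$\beta$ chain is $$(Lf)(x)=V(x)f(x)+\int_I K_1(x,y)f(y)\,dy-2\int_I K_2(x,y)f(y)\,dy .$$ Then $\tilde L=\omega L\omega$, where $\omega$ acts by multiplication, and multiplication by $W$ define bounded operators on the complex Hilbert space $L^2(I)$ (the integrals in $\tilde Lf$ converge absolutely for almost every $x$, for every $f\in L^2(I)$). For every $\lambda>0$ the operators $\lambda+\tilde L$ and $\lambda+W$ have bounded inverses, and $$R(\lambda)=\Bigl\langle\omega',\frac{1}{\lambda+\tilde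 L}\,\omega'\Bigr\rangle_{L^2(I)}$$ is real and strictly positive. Moreover $$\lim_{\lambda\to0^+}\lambda^{2/5}R(\lambda)=c_0,\qquad c_0=\int_0^\infty\frac{ds}{1+w_0\,s^{5/3}},\qquad w_0=4\int_0^\infty\frac{ds}{\sqrt{2s+s^4}},$$ where $w_0,c_0\in(0,\infty)$. Furthermore, with $A=W-\tilde L$, for every $\varepsilon>0$ each of the three quantities $$R(\lambda)-\Bigl\langle\omega',\frac1{\lambda+W}\omega'\Bigr\rangle,\qquad \Bigl\langle\omega',\frac1{\lambda+W}A\frac1{\lambda+W}\omega'\Bigr\rangle,\qquad \Bigl\langle\omega',\frac1{\lambda+W}A\frac1{\lambda+\tilde L}A\frac1{\lambda+W}\omega'\Bigr\rangle$$ is $O(\lambda^{-1/5-\varepsilon})$ as $\lambda\to0^+$. -/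

import Mathlib

open MeasureTheory Filter Topology Asymptotics

noncomputable section

namespace FPU

/-- The basic periodic cell `I = [0, 2π)`. -/
def cell : Set ℝ := Set.Ico 0 (2 * Real.pi)

/-- Lebesgue measure on the cell. -/
def cellMeasure : Measure ℝ := volume.restrict cell

/-- The complex Hilbert space `L²(I)`. -/
abbrev L2 : Type := Lp ℂ 2 cellMeasure

/-- The dispersion relation `ω(x) = |sin(x/2)| = √((1 - cos x)/2)`. -/
def dispersion (x : ℝ) : ℝ := |Real.sin (x / 2)|

/-- `ω'`. At the points of `2πℤ`, where `ω` is not differentiable, the value is `0`. -/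
def velocity : ℝ → ℝ := deriv dispersion

/-- `F₊(x, y) = (cos(x/2) + cos(y/2))² + 4 sin(x/2) sin(y/2)`. -/
def Fplus (x y : ℝ) : ℝ :=
  (Real.cos (x / 2) + Real.cos (y / 2)) ^ 2 + 4 * Real.sin (x / 2) * Real.sin (y / 2)

/-- `F₋(x, y) = (cos(x/2) + cos(y/2))² - 4 sin(x/2) sin(y/2)`. -/
def Fminus (x y : ℝ) : ℝ :=
  (Real.cos (x / 2) + Real.cos (y / 2)) ^ 2 - 4 * Real.sin (x / 2) * Real.sin (y / 2)

open Classical in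
/-- The kernel `K₁(x, y) = 4 · 1(F₋(x, y) > 0) / √F₋(x, y)`. -/
def K1 (x y : ℝ) : ℝ := if 0 < Fminus x y then 4 / Real.sqrt (Fminus x y) else 0

/-- The kernel `K₂(x, y) = 2 / √F₊(x, y)`. -/
def K2 (x y : ℝ) : ℝ := 2 / Real.sqrt (Fplus x y)

/-- `V(x) = ∫_I K₂(x, y) dy`. -/
def V (x : ℝ) : ℝ := ∫ y, K2 x y ∂cellMeasure

/-- `W = ω² V`. -/
def W (x : ℝ) : ℝ := dispersion x ^ 2 * V x

/-- The linearized collision operator `L = V + K₁ - 2 K₂`, acting on functions on the cell. -/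
def collision (f : ℝ → ℂ) (x : ℝ) : ℂ :=
  (V x : ℂ) * f x + ∫ y, (K1 x y : ℂ) * f y ∂cellMeasure
    - 2 * ∫ y, (K2 x y : ℂ) * f y ∂cellMeasure

/-- The operator `T` on `L²(I)` is `ω L ω`: for every `f ∈ L²(I)` the integrals that define
`L (ω f)` converge absolutely almost everywhere, and `T f = ω L (ω f)`. -/
def IsWeightedCollision (T : L2 →L[ℂ] L2) : Prop :=
  ∀ f : L2,
    (∀ᵐ x ∂cellMeasure,
      Integrable (fun y => (K1 x y : ℂ) * ((dispersion y : ℂ) * f y)) cellMeasure ∧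
      Integrable (fun y => (K2 x y : ℂ) * ((dispersion y : ℂ) * f y)) cellMeasure) ∧
    T f =ᵐ[cellMeasure]
      fun x => (dispersion x : ℂ) * collision (fun y => (dispersion y : ℂ) * f y) x

/-- The operator `T` on `L²(I)` is multiplication by the real function `m`. -/
def IsMultiplication (T : L2 →L[ℂ] L2) (m : ℝ → ℝ) : Prop :=
  ∀ f : L2, T f =ᵐ[cellMeasure] fun x => (m x : ℂ) * f x

/-- The operator `s + T`. -/
def shift (s : ℝ) (T : L2 →L[ℂ] L2) : L2 →L[ℂ] L2 := (s : ℂ) • 1 + T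

/-- The bounded inverse `(s + T)⁻¹`; it is meaningful when `s + T` is a unit. -/
def shiftInv (s : ℝ) (T : L2 →L[ℂ] L2) : L2 →L[ℂ] L2 := Ring.inverse (shift s T)

theorem velocity_eq {x : ℝ} (hx : x ∈ Set.Ioo 0 (2 * Real.pi)) :
    velocity x = Real.cos (x / 2) / 2 := by
  have h1 : dispersion =ᶠ[𝓝 x] fun t => Real.sin (t / 2) := by
    filter_upwards [isOpen_Ioo.mem_nhds hx] with t ht
    exact abs_of_pos (Real.sin_pos_of_pos_of_lt_pi (by linarith [ht.1]) (by linarith [ht.2]))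
  have h2 : HasDerivAt (fun t : ℝ => Real.sin (t / 2)) (Real.cos (x / 2) * (1 / 2)) x :=
    ((hasDerivAt_id x).div_const 2).sin
  rw [velocity, h1.deriv_eq, h2.deriv]
  ring

theorem memLp_velocity : MemLp (fun x => (velocity x : ℂ)) 2 cellMeasure := by
  have : IsFiniteMeasure cellMeasure :=
    ⟨by simpa [cellMeasure, cell] using ENNReal.mul_lt_top (by simp) ENNReal.ofReal_lt_top⟩
  have hm : Measurable fun x => (velocity x : ℂ) :=
    Complex.measurable_ofReal.comp (measurable_deriv _)
  refine MemLp.of_bound hm.aestronglyMeasurable 1 ?_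
  have h : ∀ᵐ x ∂cellMeasure, x ∈ Set.Ioo 0 (2 * Real.pi) := by
    rw [cellMeasure, cell, ← Measure.restrict_congr_set Ioo_ae_eq_Ico]
    exact ae_restrict_mem measurableSet_Ioo
  filter_upwards [h] with x hx
  rw [velocity_eq hx, Complex.norm_real, Real.norm_eq_abs, abs_le]
  constructor <;> linarith [Real.cos_le_one (x / 2), Real.neg_one_le_cos (x / 2)]

/-- `ω'` as an element of `L²(I)`. -/
def velocityL2 : L2 := memLp_velocity.toLp _

/-- `w₀ = 4 ∫₀^∞ (2 s + s⁴)^(-1/2) ds`. -/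
def w0 : ℝ := 4 * ∫ s in Set.Ioi (0 : ℝ), 1 / Real.sqrt (2 * s + s ^ 4)

/-- `c₀ = ∫₀^∞ ds / (1 + w₀ s^(5/3))`. -/
def c0 : ℝ := ∫ s in Set.Ioi (0 : ℝ), 1 / (1 + w0 * s ^ (5 / 3 : ℝ))

end FPU

end

/-! The limit comes from the relaxation time term. At the ends of the cell `V` has the order
ω^(-1/3), with constant `w0` (`tendsto_V_end`), so `W` has the order ω^(5/3). With s = α⁵ and x =
2α³t, the integral of ω'²/(s + W) becomes α⁻² times an integral that tends to `c0`
(`tendsto_relaxation`). It remains to see that A = W - L̃ contributes only s^(-1/5-ε).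

Two uses of the resolvent identity split the error into ⟨g, Ag⟩ + ⟨Ag, (s + L̃)⁻¹ Ag⟩ with g = (s +
W)⁻¹ω' (`inner_shiftInv_sub`). Row bounds with the weight ω^(-1/2) for both kernels
(`lintegral_K1_weight_le`, `K2_le`) give |Ag| ≤ C s^(-1/10-η) ω^(1/2) (`exists_perturbation_le`),
which settles the first term. The second term needs a lower bound for L̃.

That bound rests on a parametrisation of the resonant set a + b = c + d, ω(a) + ω(b) = ω(c) + ω(d).
One finite measure on a square has `K1` as the joint law of (a, b) and (c, d), and `K2` as that of
(a, c) and (c, a). Hence the form of L̃ at f is half the integral of |F(a) + F(b) - F(c) - F(d)|²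
with F = ωf (`integral_normSq_defect`), and L̃ ≥ 0. It has a null space: F = ω is a collision
invariant. But ω is even under x ↦ 2π - x while ω' is odd, so a gap on odd functions is enough.

For the gap the weight ω is replaced by ω^(1/6). The part of `K1` near its singular curve has row
integrals below `V` by an amount of order ω^(-1/3), so `V` plus this part is coercive. The remaining
kernels are of Hilbert–Schmidt type (`exists_form_ge`). By compactness (`exists_gap`) a gap fails
only if there is an odd collision invariant, and there is none (`ae_eq_zero_of_odd_of_defect`):
integrating the invariance relation over fibres shows that an invariant is continuous, and two
explicit families of resonances then give a maximum principle. The gap returns to L̃ as L̃ ≥ cω² on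
odd functions (`exists_gap_dispersion`). -/

noncomputable section

namespace FPU

open Real Set

/-! ### The resonant manifold -/

/-- The parameter square of the resonant manifold. -/
def square : Set (ℝ × ℝ) := Ioo (-(π / 2)) (π / 2) ×ˢ Ioo (-(π / 2)) (π / 2)

/-- The common phase of the four resonant wave numbers. -/
def phase (p : ℝ × ℝ) : ℝ := arctan (cos ((p.2 - p.1) / 2) / cos ((p.1 + p.2) / 2))

/-- The resonant wave numbers: `pa + pb = pc + pd` modulo `2π`, with equal total energy. -/
def pa (p : ℝ × ℝ) : ℝ := 2 * π - 2 * phase p + (p.1 + p.2)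

def pb (p : ℝ × ℝ) : ℝ := 2 * π - 2 * phase p - (p.1 + p.2)

def pc (p : ℝ × ℝ) : ℝ := π - 2 * phase p + (p.2 - p.1)

def pd (p : ℝ × ℝ) : ℝ := π - 2 * phase p - (p.2 - p.1)

/-- `r² = cos² D + cos² D'` with `D = (u + v) / 2` and `D' = (v - u) / 2`. -/
def radius (p : ℝ × ℝ) : ℝ := √(1 + cos p.1 * cos p.2)

lemma measurableSet_square : MeasurableSet square := measurableSet_Ioo.prod measurableSet_Ioo

lemma isOpen_square : IsOpen square := isOpen_Ioo.prod isOpen_Ioo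

lemma measurable_phase : Measurable phase := by unfold phase; fun_prop
lemma measurable_pa : Measurable pa := by have := measurable_phase; unfold pa; fun_prop
lemma measurable_pb : Measurable pb := by have := measurable_phase; unfold pb; fun_prop
lemma measurable_pc : Measurable pc := by have := measurable_phase; unfold pc; fun_prop
lemma measurable_pd : Measurable pd := by have := measurable_phase; unfold pd; fun_prop
lemma measurable_radius : Measurable radius := by unfold radius; fun_prop

lemma cos_pos_of_mem {p : ℝ × ℝ} (hp : p ∈ square) :
    0 < cos ((p.1 + p.2) / 2) ∧ 0 < cos ((p.2 - p.1) / 2) := by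
  obtain ⟨⟨h1, h2⟩, h3, h4⟩ := hp
  constructor <;> apply cos_pos_of_mem_Ioo <;> constructor <;> linarith

lemma radius_sq (p : ℝ × ℝ) :
    radius p ^ 2 = cos ((p.1 + p.2) / 2) ^ 2 + cos ((p.2 - p.1) / 2) ^ 2 := by
  have h : 0 ≤ 1 + cos p.1 * cos p.2 := by
    have h1 := abs_cos_le_one p.1
    have h2 := abs_cos_le_one p.2
    have : |cos p.1 * cos p.2| ≤ 1 := by
      rw [abs_mul]; exact mul_le_one₀ h1 (abs_nonneg _) h2
    linarith [(abs_le.1 this).1]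
  rw [radius, sq_sqrt h]
  have e1 : cos p.1 = cos ((p.1 + p.2) / 2 - (p.2 - p.1) / 2) := by ring_nf
  have e2 : cos p.2 = cos ((p.1 + p.2) / 2 + (p.2 - p.1) / 2) := by ring_nf
  rw [e1, e2, cos_sub, cos_add]
  have h1 := sin_sq_add_cos_sq ((p.1 + p.2) / 2)
  have h2 := sin_sq_add_cos_sq ((p.2 - p.1) / 2)
  set P := cos ((p.1 + p.2) / 2)
  set Q := cos ((p.2 - p.1) / 2)
  linear_combination (-(1 - Q ^ 2)) * h1 + (-(sin ((p.1 + p.2) / 2)) ^ 2) * h2 + h2 - h2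

lemma sin_sub_half (p : ℝ × ℝ) :
    sin p.1 = sin ((p.1 + p.2) / 2) * cos ((p.2 - p.1) / 2)
      - cos ((p.1 + p.2) / 2) * sin ((p.2 - p.1) / 2) := by
  rw [← sin_sub]; ring_nf

lemma radius_pos {p : ℝ × ℝ} (hp : p ∈ square) : 0 < radius p := by
  have h := cos_pos_of_mem hp
  have h2 := radius_sq p
  have : 0 < radius p ^ 2 := by rw [h2]; nlinarith [h.1, h.2]
  exact lt_of_le_of_ne (sqrt_nonneg _) fun h => by simp [← h] at this

lemma cos_phase {p : ℝ × ℝ} (hp : p ∈ square) :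
    cos (phase p) = cos ((p.1 + p.2) / 2) / radius p := by
  obtain ⟨h1, h2⟩ := cos_pos_of_mem hp
  have hr := radius_pos hp
  have e : 1 + (cos ((p.2 - p.1) / 2) / cos ((p.1 + p.2) / 2)) ^ 2
      = (radius p / cos ((p.1 + p.2) / 2)) ^ 2 := by
    rw [div_pow, div_pow, radius_sq]; field_simp
  rw [phase, cos_arctan, e, sqrt_sq (by positivity)]
  field_simp

lemma sin_phase {p : ℝ × ℝ} (hp : p ∈ square) :
    sin (phase p) = cos ((p.2 - p.1) / 2) / radius p := by
  obtain ⟨h1, h2⟩ := cos_pos_of_mem hp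
  have hr := radius_pos hp
  rw [phase, ← tan_mul_cos (cos_arctan_pos _).ne', tan_arctan]
  change _ * cos (phase p) = _
  rw [cos_phase hp]
  field_simp

lemma sin_pa {p : ℝ × ℝ} (hp : p ∈ square) : sin (pa p / 2) = cos ((p.1 + p.2) / 2) *
    (cos ((p.2 - p.1) / 2) - sin ((p.1 + p.2) / 2)) / radius p := by
  have : pa p / 2 = π - (phase p - (p.1 + p.2) / 2) := by rw [pa]; ring
  rw [this, sin_pi_sub, sin_sub, sin_phase hp, cos_phase hp]; ring

lemma sin_pb {p : ℝ × ℝ} (hp : p ∈ square) : sin (pb p / 2) = cos ((p.1 + p.2) / 2) *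
    (cos ((p.2 - p.1) / 2) + sin ((p.1 + p.2) / 2)) / radius p := by
  have : pb p / 2 = π - (phase p + (p.1 + p.2) / 2) := by rw [pb]; ring
  rw [this, sin_pi_sub, sin_add, sin_phase hp, cos_phase hp]; ring

lemma sin_pc {p : ℝ × ℝ} (hp : p ∈ square) : sin (pc p / 2) = cos ((p.2 - p.1) / 2) *
    (cos ((p.1 + p.2) / 2) + sin ((p.2 - p.1) / 2)) / radius p := by
  have : pc p / 2 = π / 2 - (phase p - (p.2 - p.1) / 2) := by rw [pc]; ring
  rw [this, sin_pi_div_two_sub, cos_sub, sin_phase hp, cos_phase hp]; ring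

lemma sin_pd {p : ℝ × ℝ} (hp : p ∈ square) : sin (pd p / 2) = cos ((p.2 - p.1) / 2) *
    (cos ((p.1 + p.2) / 2) - sin ((p.2 - p.1) / 2)) / radius p := by
  have : pd p / 2 = π / 2 - (phase p + (p.2 - p.1) / 2) := by rw [pd]; ring
  rw [this, sin_pi_div_two_sub, cos_add, sin_phase hp, cos_phase hp]; ring

lemma cos_pa {p : ℝ × ℝ} (hp : p ∈ square) :
    cos (pa p / 2) = -(cos ((p.1 + p.2) / 2) ^ 2
    + cos ((p.2 - p.1) / 2) * sin ((p.1 + p.2) / 2)) / radius p := by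
  have : pa p / 2 = π - (phase p - (p.1 + p.2) / 2) := by rw [pa]; ring
  rw [this, cos_pi_sub, cos_sub, sin_phase hp, cos_phase hp]; ring

lemma cos_pb {p : ℝ × ℝ} (hp : p ∈ square) :
    cos (pb p / 2) = -(cos ((p.1 + p.2) / 2) ^ 2
    - cos ((p.2 - p.1) / 2) * sin ((p.1 + p.2) / 2)) / radius p := by
  have : pb p / 2 = π - (phase p + (p.1 + p.2) / 2) := by rw [pb]; ring
  rw [this, cos_pi_sub, cos_add, sin_phase hp, cos_phase hp]; ring

lemma cos_pc {p : ℝ × ℝ} (hp : p ∈ square) : cos (pc p / 2) = (cos ((p.2 - p.1) / 2) ^ 2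
    - cos ((p.1 + p.2) / 2) * sin ((p.2 - p.1) / 2)) / radius p := by
  have : pc p / 2 = π / 2 - (phase p - (p.2 - p.1) / 2) := by rw [pc]; ring
  rw [this, cos_pi_div_two_sub, sin_sub, sin_phase hp, cos_phase hp]; ring

lemma cos_pd {p : ℝ × ℝ} (hp : p ∈ square) : cos (pd p / 2) = (cos ((p.2 - p.1) / 2) ^ 2
    + cos ((p.1 + p.2) / 2) * sin ((p.2 - p.1) / 2)) / radius p := by
  have : pd p / 2 = π / 2 - (phase p + (p.2 - p.1) / 2) := by rw [pd]; ring
  rw [this, cos_pi_div_two_sub, sin_add, sin_phase hp, cos_phase hp]; ring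

/-- For D = (u + v)/2 and D' = (v - u)/2 one has |D| + |D'| = max(|u|, |v|) < π/2, and sine
increases on [-π/2, π/2]. -/
lemma abs_sin_lt_cos {p : ℝ × ℝ} (hp : p ∈ square) :
    |sin ((p.1 + p.2) / 2)| < cos ((p.2 - p.1) / 2) ∧
    |sin ((p.2 - p.1) / 2)| < cos ((p.1 + p.2) / 2) := by
  obtain ⟨⟨h1, h2⟩, h3, h4⟩ := hp
  have key : ∀ x y : ℝ, |x| + |y| < π / 2 → |sin x| < cos y := by
    intro x y h
    have hx := abs_nonneg x
    have hy := abs_nonneg y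
    have e : |sin x| = sin |x| := by
      rcases abs_cases x with h' | h'
      · rw [h'.1, abs_of_nonneg (sin_nonneg_of_nonneg_of_le_pi h'.2 (by linarith))]
      · rw [h'.1, sin_neg, abs_of_nonpos (sin_nonpos_of_nonpos_of_neg_pi_le h'.2.le (by linarith))]
    rw [e, ← cos_abs y, ← sin_pi_div_two_sub]
    exact sin_lt_sin_of_lt_of_le_pi_div_two (by linarith) (by linarith) (by linarith)
  constructor <;> apply key <;>
    rcases abs_cases ((p.1 + p.2) / 2) with h | h <;>
    rcases abs_cases ((p.2 - p.1) / 2) with h' | h' <;> linarith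

lemma phase_mem {p : ℝ × ℝ} (hp : p ∈ square) : phase p ∈ Ioo 0 (π / 2) := by
  obtain ⟨h1, h2⟩ := cos_pos_of_mem hp
  exact ⟨arctan_pos.2 (by positivity), arctan_lt_pi_div_two _⟩

/-- The sines of the four half wave numbers are positive by their explicit formulas. If one of the
inequalities failed, the corresponding angle would lie where that sine or cosine is nonpositive.
This is what keeps all four wave numbers inside the open cell. -/
lemma abs_half_lt_phase {p : ℝ × ℝ} (hp : p ∈ square) :
    |(p.1 + p.2) / 2| < phase p ∧ |(p.2 - p.1) / 2| < π / 2 - phase p := by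
  obtain ⟨h1, h2⟩ := cos_pos_of_mem hp
  obtain ⟨h3, h4⟩ := abs_sin_lt_cos hp
  obtain ⟨h5, h6⟩ := phase_mem hp
  have hr := radius_pos hp
  rw [abs_lt] at h3 h4
  have ha : 0 < sin (phase p - (p.1 + p.2) / 2) := by
    have : pa p / 2 = π - (phase p - (p.1 + p.2) / 2) := by rw [pa]; ring
    rw [← sin_pi_sub, ← this, sin_pa hp]
    have : 0 < cos ((p.2 - p.1) / 2) - sin ((p.1 + p.2) / 2) := by linarith
    positivity
  have hb : 0 < sin (phase p + (p.1 + p.2) / 2) := by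
    have : pb p / 2 = π - (phase p + (p.1 + p.2) / 2) := by rw [pb]; ring
    rw [← sin_pi_sub, ← this, sin_pb hp]
    have : 0 < cos ((p.2 - p.1) / 2) + sin ((p.1 + p.2) / 2) := by linarith
    positivity
  have hc : 0 < cos (phase p - (p.2 - p.1) / 2) := by
    have : pc p / 2 = π / 2 - (phase p - (p.2 - p.1) / 2) := by rw [pc]; ring
    rw [← sin_pi_div_two_sub, ← this, sin_pc hp]
    have : 0 < cos ((p.1 + p.2) / 2) + sin ((p.2 - p.1) / 2) := by linarith
    positivity
  have hd : 0 < cos (phase p + (p.2 - p.1) / 2) := by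
    have : pd p / 2 = π / 2 - (phase p + (p.2 - p.1) / 2) := by rw [pd]; ring
    rw [← sin_pi_div_two_sub, ← this, sin_pd hp]
    have : 0 < cos ((p.1 + p.2) / 2) - sin ((p.2 - p.1) / 2) := by linarith
    positivity
  obtain ⟨⟨g1, g2⟩, g3, g4⟩ := hp
  rw [abs_lt, abs_lt]
  refine ⟨⟨?_, ?_⟩, ?_, ?_⟩ <;> by_contra! hcon
  · exact absurd (sin_nonpos_of_nonpos_of_neg_pi_le (by linarith) (by linarith)) (not_le.2 hb)
  · exact absurd (sin_nonpos_of_nonpos_of_neg_pi_le (by linarith) (by linarith)) (not_le.2 ha)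
  · exact absurd (cos_nonpos_of_pi_div_two_le_of_le (x := phase p - (p.2 - p.1) / 2) (by linarith)
      (by linarith)) (not_le.2 hc)
  · exact absurd (cos_nonpos_of_pi_div_two_le_of_le (x := phase p + (p.2 - p.1) / 2) (by linarith)
      (by linarith)) (not_le.2 hd)

lemma pa_mem {p : ℝ × ℝ} (hp : p ∈ square) : pa p ∈ Ioo 0 (2 * π) := by
  have h := abs_lt.1 (abs_half_lt_phase hp).1
  have h' := phase_mem hp
  constructor <;> rw [pa] <;> linarith [h.1, h.2, h'.1, h'.2]

lemma pb_mem {p : ℝ × ℝ} (hp : p ∈ square) : pb p ∈ Ioo 0 (2 * π) := by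
  have h := abs_lt.1 (abs_half_lt_phase hp).1
  have h' := phase_mem hp
  constructor <;> rw [pb] <;> linarith [h.1, h.2, h'.1, h'.2]

lemma pc_mem {p : ℝ × ℝ} (hp : p ∈ square) : pc p ∈ Ioo 0 (2 * π) := by
  have h := abs_lt.1 (abs_half_lt_phase hp).2
  have h' := phase_mem hp
  constructor <;> rw [pc] <;> linarith [h.1, h.2, h'.1, h'.2]

lemma pd_mem {p : ℝ × ℝ} (hp : p ∈ square) : pd p ∈ Ioo 0 (2 * π) := by
  have h := abs_lt.1 (abs_half_lt_phase hp).2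
  have h' := phase_mem hp
  constructor <;> rw [pd] <;> linarith [h.1, h.2, h'.1, h'.2]

/-- On the resonant manifold F₊ and F₋ are perfect squares, so the kernels lose their square roots
in the parameters (u, v). The numerator is positive there, because r² = 1 + cos u cos v > 1 ≥ sin u.
-/
lemma Fplus_pa_pc {p : ℝ × ℝ} (hp : p ∈ square) :
    Fplus (pa p) (pc p) = ((radius p ^ 2 - sin p.1) / radius p) ^ 2 := by
  have hr := (radius_pos hp).ne'
  rw [Fplus, cos_pa hp, cos_pc hp, sin_pa hp, sin_pc hp, sin_sub_half]
  have h1 := sin_sq_add_cos_sq ((p.1 + p.2) / 2)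
  have h2 := sin_sq_add_cos_sq ((p.2 - p.1) / 2)
  have h3 := radius_sq p
  field_simp
  rw [h3]
  ring

lemma Fminus_pa_pb {p : ℝ × ℝ} (hp : p ∈ square) : Fminus (pa p) (pb p)
    = (2 * cos ((p.1 + p.2) / 2) * sin ((p.2 - p.1) / 2) / radius p) ^ 2 := by
  have hr := (radius_pos hp).ne'
  rw [Fminus, cos_pa hp, cos_pb hp, sin_pa hp, sin_pb hp]
  have h1 := sin_sq_add_cos_sq ((p.1 + p.2) / 2)
  have h2 := sin_sq_add_cos_sq ((p.2 - p.1) / 2)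
  field_simp
  set P := cos ((p.1 + p.2) / 2)
  set Q := cos ((p.2 - p.1) / 2)
  set S := sin ((p.1 + p.2) / 2)
  set T := sin ((p.2 - p.1) / 2)
  linear_combination 4 * P ^ 2 * h1 - 4 * P ^ 2 * h2

end FPU
end

noncomputable section

namespace FPU

open Real Set
open scoped ENNReal

/-! ### The resonant measure and its marginals -/

/-- A monotone change of variables for an arbitrary `g`. The derivative is needed only in the open
interval, and the image of the open interval differs from the interval between the end values by at
most two points. -/
lemma lintegral_Ioo_deriv_mul {a b : ℝ} {f f' : ℝ → ℝ} (hf : ContinuousOn f (Icc a b))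
    (hff' : ∀ x ∈ Ioo a b, HasDerivAt f (f' x) x) (hf' : ∀ x ∈ Ioo a b, 0 ≤ f' x) (hab : a ≤ b)
    (g : ℝ → ℝ≥0∞) :
    ∫⁻ x in Ioo a b, ENNReal.ofReal (f' x) * g (f x) = ∫⁻ y in Ioo (f a) (f b), g y := by
  have M : MonotoneOn f (Icc a b) := by
    apply monotoneOn_of_deriv_nonneg (convex_Icc a b) hf
    · rw [interior_Icc]
      exact fun z hz ↦ (hff' z hz).differentiableAt.differentiableWithinAt
    · rw [interior_Icc]
      intro z hz
      simpa [(hff' z hz).deriv] using hf' z hz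
  have A : ∫⁻ u in Icc (f a) (f b), g u = ∫⁻ u in f '' (Ioo a b), g u := by
    apply setLIntegral_congr
    rw [← hf.image_Icc_of_monotoneOn hab M]
    refine ae_eq_set.2 ⟨?_, by simp [show f '' Ioo a b \ f '' Icc a b = ∅ by grind]⟩
    have : f '' (Icc a b) \ f '' Ioo a b ⊆ {f a, f b} := by grind
    apply measure_mono_null this
    apply Finite.measure_zero (by simp)
  rw [Measure.restrict_congr_set (Ioo_ae_eq_Icc (a := f a)), A,
    lintegral_image_eq_lintegral_deriv_mul_of_monotoneOn measurableSet_Ioo]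
  · exact fun z hz ↦ (hff' z hz).hasDerivWithinAt
  · exact M.mono Ioo_subset_Icc_self

lemma lintegral_comp_two_mul (g : ℝ → ℝ≥0∞) : ∫⁻ x, g x = 2 * ∫⁻ x, g (2 * x) := by
  have := lintegral_image_eq_lintegral_abs_deriv_mul (s := univ) (f := fun x : ℝ => 2 * x)
    (f' := fun _ => 2) MeasurableSet.univ
    (fun x _ => (((hasDerivAt_id x).const_mul 2).congr_deriv (mul_one 2)).hasDerivWithinAt)
    (fun x _ y _ h => by simpa using h) g
  have h2 : (fun x : ℝ => 2 * x) '' univ = univ := by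
    rw [image_univ, range_eq_univ]
    exact fun y => ⟨y / 2, by ring⟩
  rw [h2] at this
  simp only [setLIntegral_univ, abs_two, ENNReal.ofReal_ofNat] at this
  rw [this, lintegral_const_mul' _ _ (by simp)]

/-- The coordinates (s + d, s - d) have Jacobian 2. The wave numbers are handled through half sums s
and half differences d, because one of the two stays constant on each fibre below. -/
lemma lintegral_shear {G : ℝ × ℝ → ℝ≥0∞} (hG : Measurable G) :
    ∫⁻ q, G q = 2 * ∫⁻ d, ∫⁻ s, G (s + d, s - d) := by
  have h1 : ∀ d : ℝ, ∫⁻ s, G (s + d, s - d) = ∫⁻ s, G (s + 2 * d, s) := fun d => by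
    rw [← lintegral_add_right_eq_self _ d]
    congr 1; ext s; congr 2 <;> ring
  simp_rw [h1]
  rw [lintegral_lintegral_swap (by fun_prop), Measure.volume_eq_prod,
    lintegral_prod_symm _ hG.aemeasurable, ← lintegral_const_mul' _ _ (by simp)]
  congr 1; ext s
  rw [← lintegral_comp_two_mul (fun d => G (s + d, s)),
    lintegral_add_left_eq_self (fun x => G (x, s)) s]

lemma lintegral_shear' {G : ℝ × ℝ → ℝ≥0∞} (hG : Measurable G) :
    ∫⁻ q, G q = 2 * ∫⁻ s, ∫⁻ d, G (s + d, s - d) := by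
  rw [lintegral_shear hG, lintegral_lintegral_swap (by fun_prop)]

/-- The natural measure on the resonant manifold. -/
def resMeasure : Measure (ℝ × ℝ) :=
  (volume.restrict square).withDensity fun p => ENNReal.ofReal (4 / radius p)

lemma measurable_K1 : Measurable fun q : ℝ × ℝ => K1 q.1 q.2 := by
  unfold K1 Fminus
  refine Measurable.ite ?_ (by fun_prop) measurable_const
  exact measurableSet_lt measurable_const (by fun_prop)

lemma measurable_K2 : Measurable fun q : ℝ × ℝ => K2 q.1 q.2 := by
  unfold K2 Fplus
  fun_prop

lemma lintegral_resMeasure {Φ : ℝ × ℝ → ℝ≥0∞} (hΦ : Measurable Φ) :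
    ∫⁻ p, Φ p ∂resMeasure = ∫⁻ p, square.indicator (fun p => ENNReal.ofReal (4 / radius p) * Φ p) p := by
  rw [resMeasure, lintegral_withDensity_eq_lintegral_mul _ (by have := measurable_radius; fun_prop) hΦ,
    lintegral_indicator measurableSet_square]
  rfl

lemma hasDerivAt_phase_snd {u v : ℝ} (hp : (u, v) ∈ square) :
    HasDerivAt (fun v => phase (u, v)) (sin u / (2 * radius (u, v) ^ 2)) v := by
  obtain ⟨h1, h2⟩ := cos_pos_of_mem hp
  have hr := radius_pos hp
  simp only at h1 h2
  have e1 : HasDerivAt (fun v : ℝ => cos ((v - u) / 2)) (-sin ((v - u) / 2) * (1 / 2)) v :=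
    (((hasDerivAt_id v).sub_const u).div_const 2).cos
  have e2 : HasDerivAt (fun v : ℝ => cos ((u + v) / 2)) (-sin ((u + v) / 2) * (1 / 2)) v :=
    (((hasDerivAt_id v).const_add u).div_const 2).cos
  refine (e1.div e2 h1.ne').arctan.congr_deriv ?_
  have h3 := sin_sub_half (u, v)
  simp only at h3
  rw [radius_sq]
  simp only [Pi.div_apply]
  rw [h3]
  field_simp
  ring

/-- For fixed u the difference a - c = π + 2u is constant and the half sum σ = 3π/2 - 2φ + v is
increasing in v, with derivative (r² - sin u)/r². Since `K2` equals 2r/(r² - sin u) there, the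
Jacobian turns 2 K₂ dσ into (4/r) dv. At v = ±π/2 the phase is an explicit angle, which yields the
end points. -/
lemma lintegral_pa_pc_fibre {u : ℝ} (hu : u ∈ Ioo (-(π / 2)) (π / 2)) (g : ℝ → ℝ≥0∞) :
    ∫⁻ v in Ioo (-(π / 2)) (π / 2), ENNReal.ofReal (4 / radius (u, v)) *
      g (3 * π / 2 - 2 * phase (u, v) + v) =
    ∫⁻ σ in Ioo (π / 2 + u) (3 * π / 2 - u),
      2 * ENNReal.ofReal (K2 (σ + (π / 2 + u)) (σ - (π / 2 + u))) * g σ := by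
  obtain ⟨hu1, hu2⟩ := hu
  have hpi := pi_pos
  have hmem : ∀ v ∈ Ioo (-(π / 2)) (π / 2), (u, v) ∈ square := fun v hv => ⟨⟨hu1, hu2⟩, hv⟩
  have hcont : ContinuousOn (fun v => 3 * π / 2 - 2 * phase (u, v) + v) (Icc (-(π / 2)) (π / 2)) := by
    have : ContinuousOn (fun v => phase (u, v)) (Icc (-(π / 2)) (π / 2)) := by
      unfold phase
      refine continuous_arctan.comp_continuousOn (ContinuousOn.div (by fun_prop) (by fun_prop) ?_)
      intro v hv
      exact (cos_pos_of_mem_Ioo ⟨by simp; linarith [hv.1], by simp; linarith [hv.2]⟩).ne'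
    fun_prop
  have hder : ∀ v ∈ Ioo (-(π / 2)) (π / 2), HasDerivAt
      (fun v => 3 * π / 2 - 2 * phase (u, v) + v)
      ((radius (u, v) ^ 2 - sin u) / radius (u, v) ^ 2) v := fun v hv => by
    have hr := radius_pos (hmem v hv)
    refine ((((hasDerivAt_phase_snd (hmem v hv)).const_mul 2).const_sub (3 * π / 2)).add
      (hasDerivAt_id v)).congr_deriv ?_
    field_simp
    ring
  have hpos : ∀ v ∈ Ioo (-(π / 2)) (π / 2), 0 < radius (u, v) ^ 2 - sin u := fun v hv => by
    have hc := cos_pos_of_mem_Ioo hv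
    have hcu := cos_pos_of_mem_Ioo (show u ∈ Ioo (-(π / 2)) (π / 2) from ⟨hu1, hu2⟩)
    rw [radius, sq_sqrt (by positivity)]
    have := sin_le_one u
    have := mul_pos hcu hc
    linarith
  have hend : (fun v => 3 * π / 2 - 2 * phase (u, v) + v) (-(π / 2)) = π / 2 + u := by
    have : phase (u, -(π / 2)) = -((u - π / 2) / 2) := by
      unfold phase
      have e : cos ((-(π / 2) - u) / 2) = -sin ((u - π / 2) / 2) := by
        rw [← cos_add_pi_div_two, ← cos_neg]; ring_nf
      simp only
      rw [e, ← sub_eq_add_neg, neg_div, ← tan_eq_sin_div_cos, ← tan_neg, arctan_tan] <;> linarith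
    simp only [this]; ring
  have hend' : (fun v => 3 * π / 2 - 2 * phase (u, v) + v) (π / 2) = 3 * π / 2 - u := by
    have : phase (u, π / 2) = (u + π / 2) / 2 := by
      unfold phase
      have e : cos ((π / 2 - u) / 2) = sin ((u + π / 2) / 2) := by
        rw [← cos_pi_div_two_sub]; ring_nf
      simp only
      rw [e, ← tan_eq_sin_div_cos, arctan_tan] <;> linarith
    simp only [this]; ring
  have key := lintegral_Ioo_deriv_mul hcont hder
    (fun v hv => div_nonneg (hpos v hv).le (sq_nonneg _)) (by linarith)
    (fun σ => 2 * ENNReal.ofReal (K2 (σ + (π / 2 + u)) (σ - (π / 2 + u))) * g σ)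
  beta_reduce at hend hend' key
  rw [hend, hend'] at key
  rw [← key]
  refine setLIntegral_congr_fun measurableSet_Ioo fun v hv => ?_
  have hp := hmem v hv
  have hr := radius_pos hp
  have e1 : 3 * π / 2 - 2 * phase (u, v) + v + (π / 2 + u) = pa (u, v) := by rw [pa]; ring
  have e2 : 3 * π / 2 - 2 * phase (u, v) + v - (π / 2 + u) = pc (u, v) := by rw [pc]; ring
  simp only [e1, e2]
  rw [← mul_assoc, ← mul_assoc, K2, Fplus_pa_pc hp, sqrt_sq (div_nonneg (hpos v hv).le hr.le)]
  congr 1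
  rw [← ENNReal.ofReal_ofNat 2, ← ENNReal.ofReal_mul (div_nonneg (hpos v hv).le (sq_nonneg _)),
    ← ENNReal.ofReal_mul (mul_nonneg (div_nonneg (hpos v hv).le (sq_nonneg _)) zero_le_two)]
  congr 1
  have := (hpos v hv).ne'
  field_simp
  ring

/-- The fibres u = const are mapped onto the full segments a - c = const of the triangle 0 < c < a <
2π, so (a, c) has density `K2` on that triangle. -/
theorem lintegral_pa_pc {Φ : ℝ × ℝ → ℝ≥0∞} (hΦ : Measurable Φ) :
    ∫⁻ p, Φ (pa p, pc p) ∂resMeasure =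
      ∫⁻ q, {q : ℝ × ℝ | 0 < q.2 ∧ q.2 < q.1 ∧ q.1 < 2 * π}.indicator
        (fun q => ENNReal.ofReal (K2 q.1 q.2) * Φ q) q := by
  have hm := measurable_K2
  have hR : MeasurableSet {q : ℝ × ℝ | 0 < q.2 ∧ q.2 < q.1 ∧ q.1 < 2 * π} := by measurability
  have hrad := measurable_radius
  have ha := measurable_pa
  have hc := measurable_pc
  -- The half difference of a and c is π/2 + u, so the outer variable on the right is translated by
  -- π/2 to match u.
  rw [lintegral_resMeasure (by fun_prop), Measure.volume_eq_prod,
    lintegral_prod _ (Measurable.aemeasurable ((by fun_prop : Measurable fun p =>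
      ENNReal.ofReal (4 / radius p) * Φ (pa p, pc p)).indicator measurableSet_square)),
    ← Measure.volume_eq_prod, lintegral_shear (by
      exact (by fun_prop : Measurable fun q : ℝ × ℝ =>
        ENNReal.ofReal (K2 q.1 q.2) * Φ q).indicator hR),
    ← lintegral_const_mul' _ _ (by simp), ← lintegral_add_left_eq_self (fun d => 2 * ∫⁻ s,
      {q : ℝ × ℝ | 0 < q.2 ∧ q.2 < q.1 ∧ q.1 < 2 * π}.indicator
        (fun q => ENNReal.ofReal (K2 q.1 q.2) * Φ q) (s + d, s - d)) (π / 2)]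
  congr 1; ext u
  by_cases hu : u ∈ Ioo (-(π / 2)) (π / 2)
  · have h1 : ∀ v, square.indicator (fun p => ENNReal.ofReal (4 / radius p) * Φ (pa p, pc p)) (u, v)
        = (Ioo (-(π / 2)) (π / 2)).indicator (fun v => ENNReal.ofReal (4 / radius (u, v)) *
          (fun σ => Φ (σ + (π / 2 + u), σ - (π / 2 + u))) (3 * π / 2 - 2 * phase (u, v) + v)) v := by
      intro v
      have e1 : 3 * π / 2 - 2 * phase (u, v) + v + (π / 2 + u) = pa (u, v) := by rw [pa]; ring
      have e2 : 3 * π / 2 - 2 * phase (u, v) + v - (π / 2 + u) = pc (u, v) := by rw [pc]; ring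
      simp only [indicator, square, mem_prod, hu, true_and, e1, e2]
    refine (lintegral_congr h1).trans ?_
    rw [lintegral_indicator measurableSet_Ioo]
    refine (lintegral_pa_pc_fibre hu (fun σ => Φ (σ + (π / 2 + u), σ - (π / 2 + u)))).trans ?_
    rw [← lintegral_const_mul' _ _ (by simp), ← lintegral_indicator measurableSet_Ioo]
    congr 1; ext σ
    have : σ ∈ Ioo (π / 2 + u) (3 * π / 2 - u) ↔ (0 < σ - (π / 2 + u) ∧
        σ - (π / 2 + u) < σ + (π / 2 + u) ∧ σ + (π / 2 + u) < 2 * π) := by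
      simp only [mem_Ioo] at hu ⊢
      constructor
      · rintro ⟨h1, h2⟩; refine ⟨?_, ?_, ?_⟩ <;> linarith [hu.1]
      · rintro ⟨h1, h2, h3⟩; constructor <;> linarith
    simp only [indicator, this, mem_ofPred_eq]
    split_ifs <;> simp [mul_assoc]
  · have h1 : ∀ v, square.indicator (fun p => ENNReal.ofReal (4 / radius p) * Φ (pa p, pc p)) (u, v)
        = 0 := fun v => indicator_of_notMem (fun h => hu h.1) _
    refine (lintegral_congr h1).trans ?_
    have h2 : ∀ σ, {q : ℝ × ℝ | 0 < q.2 ∧ q.2 < q.1 ∧ q.1 < 2 * π}.indicator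
        (fun q => ENNReal.ofReal (K2 q.1 q.2) * Φ q) (σ + (π / 2 + u), σ - (π / 2 + u)) = 0 := by
      intro σ
      refine indicator_of_notMem (fun h => hu ?_) _
      obtain ⟨h1, h2, h3⟩ := h
      simp only at h1 h2 h3
      constructor <;> linarith
    refine Eq.trans ?_ (congrArg (2 * ·) (lintegral_congr h2)).symm
    simp

lemma hasDerivAt_phase_diff {D E : ℝ} (hp : (D + E, D - E) ∈ square) :
    HasDerivAt (fun E => phase (D + E, D - E))
      (-(sin E * cos D) / radius (D + E, D - E) ^ 2) E := by
  obtain ⟨h1, h2⟩ := cos_pos_of_mem hp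
  have hr := radius_pos hp
  have a1 : ∀ E : ℝ, (D - E - (D + E)) / 2 = -E := fun E => by ring
  have a2 : ∀ E : ℝ, (D + E + (D - E)) / 2 = D := fun E => by ring
  rw [radius_sq]
  simp only [a1, a2, cos_neg] at h1 h2 ⊢
  have e0 : (fun E => phase (D + E, D - E)) = fun E => arctan (cos E / cos D) := by
    ext E; simp only [phase, a1, a2, cos_neg]
  rw [e0]
  refine (((hasDerivAt_cos E).div_const (cos D)).arctan).congr_deriv ?_
  field_simp

/-- In the coordinates u = D + E, v = D - E, fixing D fixes a - b = 4D, and the half sum 2π - 2φ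
increases for E > 0 with derivative 2 sin E cos D / r². There `K1` equals 2r/(cos D sin E), so the
product is again 4/r. Only E > 0 is used, since E and -E give the same pair (a, b). -/
lemma lintegral_pa_pb_fibre {D : ℝ} (hD : D ∈ Ioo (-(π / 2)) (π / 2)) (g : ℝ → ℝ≥0∞) :
    ∫⁻ E in Ioo 0 (π / 2 - |D|), ENNReal.ofReal (4 / radius (D + E, D - E)) *
      g (2 * π - 2 * phase (D + E, D - E)) =
    ∫⁻ σ in Ioo (2 * π - 2 * arctan (1 / cos D)) (2 * π - 2 * |D|),
      ENNReal.ofReal (K1 (σ + 2 * D) (σ - 2 * D)) * g σ := by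
  have hD0 : |D| < π / 2 := abs_lt.2 hD
  have hcD := cos_pos_of_mem_Ioo hD
  have hpi := pi_pos
  have a1 : ∀ E : ℝ, (D - E - (D + E)) / 2 = -E := fun E => by ring
  have a2 : ∀ E : ℝ, (D + E + (D - E)) / 2 = D := fun E => by ring
  have hmem : ∀ E ∈ Ioo 0 (π / 2 - |D|), (D + E, D - E) ∈ square := fun E hE => by
    rcases abs_cases D with h | h <;> refine ⟨⟨?_, ?_⟩, ?_, ?_⟩ <;> simp only <;>
      linarith [hE.1, hE.2, hD.1, hD.2]
  have e0 : ∀ E, phase (D + E, D - E) = arctan (cos E / cos D) := fun E => by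
    simp only [phase, a1, a2, cos_neg]
  have hcont : ContinuousOn (fun E => 2 * π - 2 * phase (D + E, D - E)) (Icc 0 (π / 2 - |D|)) := by
    simp only [e0]
    have : Continuous fun E => arctan (cos E / cos D) :=
      continuous_arctan.comp (continuous_cos.div_const _)
    fun_prop
  have hder : ∀ E ∈ Ioo 0 (π / 2 - |D|), HasDerivAt (fun E => 2 * π - 2 * phase (D + E, D - E))
      (2 * (sin E * cos D) / radius (D + E, D - E) ^ 2) E := fun E hE => by
    refine (((hasDerivAt_phase_diff (hmem E hE)).const_mul 2).const_sub (2 * π)).congr_deriv ?_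
    ring
  have hsE : ∀ E ∈ Ioo 0 (π / 2 - |D|), 0 < sin E := fun E hE =>
    sin_pos_of_pos_of_lt_pi hE.1 (by linarith [hE.2, abs_nonneg D])
  have hend : 2 * π - 2 * phase (D + 0, D - 0) = 2 * π - 2 * arctan (1 / cos D) := by
    rw [e0, cos_zero]
  have hend' : 2 * π - 2 * phase (D + (π / 2 - |D|), D - (π / 2 - |D|)) = 2 * π - 2 * |D| := by
    rw [e0, cos_pi_div_two_sub, ← cos_abs D, ← tan_eq_sin_div_cos, arctan_tan] <;>
      linarith [abs_nonneg D]
  have key := lintegral_Ioo_deriv_mul hcont hder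
    (fun E hE => by have := hsE E hE; positivity) (by linarith)
    (fun σ => ENNReal.ofReal (K1 (σ + 2 * D) (σ - 2 * D)) * g σ)
  rw [hend, hend'] at key
  rw [← key]
  refine setLIntegral_congr_fun measurableSet_Ioo fun E hE => ?_
  have hp := hmem E hE
  have hr := radius_pos hp
  have hs := hsE E hE
  have e1 : 2 * π - 2 * phase (D + E, D - E) + 2 * D = pa (D + E, D - E) := by rw [pa]; ring
  have e2 : 2 * π - 2 * phase (D + E, D - E) - 2 * D = pb (D + E, D - E) := by rw [pb]; ring
  have hF := Fminus_pa_pb hp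
  simp only [a1, a2, sin_neg] at hF
  have hF' : Fminus (pa (D + E, D - E)) (pb (D + E, D - E))
      = (2 * cos D * sin E / radius (D + E, D - E)) ^ 2 := by rw [hF]; ring
  have hq : 0 < 2 * cos D * sin E / radius (D + E, D - E) := by positivity
  simp only [e1, e2]
  rw [← mul_assoc, K1, hF', if_pos (by positivity), sqrt_sq hq.le,
    ← ENNReal.ofReal_mul (by positivity)]
  congr 2
  field_simp

lemma Fminus_add_sub (σ D : ℝ) : Fminus (σ + 2 * D) (σ - 2 * D)
    = 4 * (cos (σ / 2) ^ 2 - sin (σ / 2) ^ 2 * cos D ^ 2) := by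
  have e1 : (σ + 2 * D) / 2 = σ / 2 + D := by ring
  have e2 : (σ - 2 * D) / 2 = σ / 2 - D := by ring
  rw [Fminus, e1, e2, cos_add, cos_sub, sin_add, sin_sub]
  have h1 := sin_sq_add_cos_sq (σ / 2)
  have h2 := sin_sq_add_cos_sq D
  linear_combination (4 * cos (σ / 2) ^ 2) * h2

/-- For σ between π and 2π the inequality F₋ > 0 reads tan(π - σ/2) < 1/cos D, which is exactly the
lower end of the fibre image. Hence the support of `K1` in the half x + y > 2π of the cell square is
covered without remainder. -/
lemma mem_image_pa_pb_iff {D σ : ℝ} :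
    (0 < σ + 2 * D ∧ σ + 2 * D < 2 * π ∧ 0 < σ - 2 * D ∧ σ - 2 * D < 2 * π ∧ π < σ ∧
      0 < Fminus (σ + 2 * D) (σ - 2 * D)) ↔
    D ∈ Ioo (-(π / 2)) (π / 2) ∧
      σ ∈ Ioo (2 * π - 2 * arctan (1 / cos D)) (2 * π - 2 * |D|) := by
  have hpi := pi_pos
  rw [Fminus_add_sub]
  have hsσ : sin (σ / 2) = sin (π - σ / 2) := (sin_pi_sub _).symm
  have hcσ : cos (σ / 2) = -cos (π - σ / 2) := by rw [cos_pi_sub]; ring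
  have aux : D ∈ Ioo (-(π / 2)) (π / 2) → π < σ → σ < 2 * π →
      (0 < 4 * (cos (σ / 2) ^ 2 - sin (σ / 2) ^ 2 * cos D ^ 2) ↔
        2 * π - 2 * arctan (1 / cos D) < σ) := by
    intro hD h1 h2
    have hcD := cos_pos_of_mem_Ioo hD
    have hm : π - σ / 2 ∈ Ioo (-(π / 2)) (π / 2) := ⟨by linarith, by linarith⟩
    have hc := cos_pos_of_mem_Ioo hm
    have hs : 0 < sin (π - σ / 2) := sin_pos_of_pos_of_lt_pi (by linarith) (by linarith)
    have e1 : 2 * π - 2 * arctan (1 / cos D) < σ ↔ π - σ / 2 < arctan (1 / cos D) := by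
      constructor <;> intro h <;> linarith
    have e2 : π - σ / 2 < arctan (1 / cos D) ↔ tan (π - σ / 2) < 1 / cos D := by
      conv_rhs => rw [← arctan_lt_arctan_iff, arctan_tan hm.1 hm.2]
    rw [e1, e2, tan_eq_sin_div_cos, div_lt_div_iff₀ hc hcD, one_mul, hsσ, hcσ,
      ← pow_lt_pow_iff_left₀ (by positivity) hc.le two_ne_zero]
    constructor <;> intro h <;> nlinarith
  constructor
  · rintro ⟨h1, h2, h3, h4, h5, h6⟩
    have hD : D ∈ Ioo (-(π / 2)) (π / 2) := ⟨by linarith, by linarith⟩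
    have h7 : σ < 2 * π - 2 * |D| := by rcases abs_cases D with h | h <;> linarith
    refine ⟨hD, (aux hD h5 (by linarith [abs_nonneg D])).1 h6, h7⟩
  · rintro ⟨hD, h1, h2⟩
    have h3 := arctan_lt_pi_div_two (1 / cos D)
    have h5 : π < σ := by linarith
    rcases abs_cases D with h | h <;>
      refine ⟨by linarith, by linarith, by linarith, by linarith, h5,
        (aux hD h5 (by linarith [abs_nonneg D])).2 h1⟩

lemma lintegral_even {f : ℝ → ℝ≥0∞} (hf : ∀ x, f (-x) = f x) :
    ∫⁻ x, f x = 2 * ∫⁻ x in Ioi 0, f x := by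
  have h1 : ∫⁻ x in Iio 0, f x = ∫⁻ x in Ioi 0, f x := by
    rw [← lintegral_indicator measurableSet_Iio, ← lintegral_indicator measurableSet_Ioi,
      ← lintegral_neg_eq_self]
    congr 1; ext x
    simp [indicator, hf]
  rw [← lintegral_add_compl f (measurableSet_Ioi (a := (0 : ℝ))), compl_Ioi,
    Measure.restrict_congr_set Iio_ae_eq_Iic.symm, h1, two_mul]

/-- Integration over the fibres D = const shows that (a, b) has density `K1` on the half x + y > 2π
of the cell square. -/
theorem lintegral_pa_pb {Φ : ℝ × ℝ → ℝ≥0∞} (hΦ : Measurable Φ) :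
    ∫⁻ p, Φ (pa p, pb p) ∂resMeasure =
      ∫⁻ q, {q : ℝ × ℝ | 0 < q.1 ∧ q.1 < 2 * π ∧ 0 < q.2 ∧ q.2 < 2 * π ∧
          2 * π < q.1 + q.2}.indicator (fun q => ENNReal.ofReal (K1 q.1 q.2) * Φ q) q := by
  have hm := measurable_K1
  have hR : MeasurableSet {q : ℝ × ℝ | 0 < q.1 ∧ q.1 < 2 * π ∧ 0 < q.2 ∧ q.2 < 2 * π ∧
          2 * π < q.1 + q.2} := by measurability
  have hrad := measurable_radius
  have ha := measurable_pa
  have hb := measurable_pb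
  have a1 : ∀ D E : ℝ, (D - E - (D + E)) / 2 = -E := fun D E => by ring
  have a2 : ∀ D E : ℝ, (D + E + (D - E)) / 2 = D := fun D E => by ring
  -- On the right the half difference of a and b is 2D, hence the doubling of the outer variable.
  -- Its factor 2 pairs with the two-fold covering E ↦ -E on the left.
  rw [lintegral_resMeasure (by fun_prop), lintegral_shear' (by
      exact (by fun_prop : Measurable fun p =>
        ENNReal.ofReal (4 / radius p) * Φ (pa p, pb p)).indicator measurableSet_square),
    lintegral_shear (by exact (by fun_prop : Measurable fun q : ℝ × ℝ =>
        ENNReal.ofReal (K1 q.1 q.2) * Φ q).indicator hR), lintegral_comp_two_mul (fun d => ∫⁻ s,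
      {q : ℝ × ℝ | 0 < q.1 ∧ q.1 < 2 * π ∧ 0 < q.2 ∧ q.2 < 2 * π ∧ 2 * π < q.1 + q.2}.indicator
        (fun q => ENNReal.ofReal (K1 q.1 q.2) * Φ q) (s + d, s - d))]
  congr 1
  rw [← lintegral_const_mul' _ _ (by simp)]
  congr 1; ext D
  by_cases hD : D ∈ Ioo (-(π / 2)) (π / 2)
  · rw [lintegral_even]
    · congr 1
      have h1 : ∀ E ∈ Ioi (0 : ℝ), square.indicator
          (fun p => ENNReal.ofReal (4 / radius p) * Φ (pa p, pb p)) (D + E, D - E)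
          = (Ioo 0 (π / 2 - |D|)).indicator (fun E => ENNReal.ofReal (4 / radius (D + E, D - E)) *
            (fun σ => Φ (σ + 2 * D, σ - 2 * D)) (2 * π - 2 * phase (D + E, D - E))) E := by
        intro E hE
        have e1 : 2 * π - 2 * phase (D + E, D - E) + 2 * D = pa (D + E, D - E) := by
          rw [pa]; ring
        have e2 : 2 * π - 2 * phase (D + E, D - E) - 2 * D = pb (D + E, D - E) := by
          rw [pb]; ring
        have : (D + E, D - E) ∈ square ↔ E ∈ Ioo 0 (π / 2 - |D|) := by
          simp only [mem_Ioi] at hE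
          simp only [square, mem_prod, mem_Ioo] at hD ⊢
          rcases abs_cases D with h | h <;> constructor
          · rintro ⟨⟨_, _⟩, _, _⟩; constructor <;> linarith
          · rintro ⟨_, _⟩; refine ⟨⟨?_, ?_⟩, ?_, ?_⟩ <;> linarith
          · rintro ⟨⟨_, _⟩, _, _⟩; constructor <;> linarith
          · rintro ⟨_, _⟩; refine ⟨⟨?_, ?_⟩, ?_, ?_⟩ <;> linarith
        simp only [indicator, this, e1, e2]
      rw [setLIntegral_congr_fun measurableSet_Ioi h1, setLIntegral_indicator measurableSet_Ioo,
        inter_eq_left.2 (fun x hx => hx.1)]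
      refine (lintegral_pa_pb_fibre hD (fun σ => Φ (σ + 2 * D, σ - 2 * D))).trans ?_
      rw [← lintegral_indicator measurableSet_Ioo]
      congr 1; ext σ
      have := @mem_image_pa_pb_iff D σ
      by_cases h : σ ∈ Ioo (2 * π - 2 * arctan (1 / cos D)) (2 * π - 2 * |D|)
      · obtain ⟨h1, h2, h3, h4, h5, h6⟩ := this.2 ⟨hD, h⟩
        rw [indicator_of_mem h, indicator_of_mem]
        exact ⟨h1, h2, h3, h4, by simp only; linarith⟩
      · rw [indicator_of_notMem h]
        by_cases h' : (σ + 2 * D, σ - 2 * D) ∈ {q : ℝ × ℝ | 0 < q.1 ∧ q.1 < 2 * π ∧ 0 < q.2 ∧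
            q.2 < 2 * π ∧ 2 * π < q.1 + q.2}
        · rw [indicator_of_mem h']
          -- A point of the half square outside the fibre image has F₋ ≤ 0, and there `K1` vanishes.
          have hF : ¬ 0 < Fminus (σ + 2 * D) (σ - 2 * D) := fun hF => by
            obtain ⟨h1, h2, h3, h4, h5⟩ := h'
            simp only at h5
            exact h (this.1 ⟨h1, h2, h3, h4, by linarith, hF⟩).2
          simp [K1, hF]
        · rw [indicator_of_notMem h']
    · intro E
      have e1 : phase (D - E, D + E) = phase (D + E, D - E) := by
        simp only [phase, a1, cos_neg, show (D + E - (D - E)) / 2 = E by ring,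
          show (D - E + (D + E)) / 2 = D by ring, a2]
      have e2 : radius (D - E, D + E) = radius (D + E, D - E) := by
        simp only [radius, mul_comm]
      have e3 : (D - E, D + E) ∈ square ↔ (D + E, D - E) ∈ square := by
        simp only [square, mem_prod, and_comm]
      rw [show D + -E = D - E by ring, show D - -E = D + E by ring]
      by_cases h : (D + E, D - E) ∈ square
      · rw [indicator_of_mem h, indicator_of_mem (e3.2 h)]
        simp only [e2, pa, pb, e1, show D - E + (D + E) = D + E + (D - E) by ring]
      · rw [indicator_of_notMem h, indicator_of_notMem (mt e3.1 h)]
  · have h1 : ∀ E, square.indicator (fun p => ENNReal.ofReal (4 / radius p) * Φ (pa p, pb p))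
        (D + E, D - E) = 0 := fun E => indicator_of_notMem (fun h => hD (by
          obtain ⟨⟨_, _⟩, _, _⟩ := h
          simp only at *
          constructor <;> linarith)) _
    refine (lintegral_congr h1).trans ?_
    have h2 : ∀ σ, {q : ℝ × ℝ | 0 < q.1 ∧ q.1 < 2 * π ∧ 0 < q.2 ∧ q.2 < 2 * π ∧
          2 * π < q.1 + q.2}.indicator (fun q => ENNReal.ofReal (K1 q.1 q.2) * Φ q)
          (σ + 2 * D, σ - 2 * D) = 0 := by
      intro σ
      refine indicator_of_notMem (fun h => hD ?_) _
      obtain ⟨h1, h2, h3, h4, h5⟩ := h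
      simp only at *
      constructor <;> linarith
    refine Eq.trans ?_ (congrArg (2 * ·) (lintegral_congr h2)).symm
    simp

end FPU
end

/-! ### Symmetries of the resonant measure, and the kernels as its marginals. -/

noncomputable section

namespace FPU

open Real Set
open scoped ENNReal

instance : IsFiniteMeasure cellMeasure :=
  ⟨by simpa [cellMeasure, cell] using ENNReal.mul_lt_top (by simp) ENNReal.ofReal_lt_top⟩

lemma one_le_radius {p : ℝ × ℝ} (hp : p ∈ square) : 1 ≤ radius p := by
  have h1 := cos_pos_of_mem_Ioo hp.1
  have h2 := cos_pos_of_mem_Ioo hp.2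
  rw [radius, one_le_sqrt]
  have := mul_pos h1 h2
  linarith

instance : IsFiniteMeasure resMeasure := by
  have : IsFiniteMeasure ((volume : Measure (ℝ × ℝ)).restrict square) :=
    ⟨by rw [Measure.restrict_apply_univ]
        exact ((Metric.isBounded_Ioo _ _).prod (Metric.isBounded_Ioo _ _)).measure_lt_top⟩
  refine isFiniteMeasure_withDensity_ofReal (f := fun p => 4 / radius p) ?_
  have hm : Measurable fun p => 4 / radius p := by have := measurable_radius; fun_prop
  refine (Integrable.of_bound (C := 4) hm.aestronglyMeasurable ?_).2
  filter_upwards [ae_restrict_mem measurableSet_square] with p hp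
  have h := one_le_radius hp
  rw [norm_of_nonneg (by positivity)]
  exact div_le_self (by norm_num) h

lemma resMeasure_ae_mem : ∀ᵐ p ∂resMeasure, p ∈ square :=
  (withDensity_absolutelyContinuous _ _).ae_le (ae_restrict_mem measurableSet_square)

/-- The density depends only on the product cos u cos v, so the symmetries of the square preserve
the resonant measure. Three of them are used: (v, u) fixes a and exchanges c with d; (-v, -u)
exchanges a with b and fixes c and d; (-u, v) replaces the phase by its complement and carries (c,
d) to the reflection of (b, a). -/
lemma lintegral_comp_symm {e : ℝ × ℝ → ℝ × ℝ} (he : MeasurePreserving e volume volume)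
    (hs : ∀ p, e p ∈ square ↔ p ∈ square) (hr : ∀ p, radius (e p) = radius p)
    {Φ : ℝ × ℝ → ℝ≥0∞} (hΦ : Measurable Φ) :
    ∫⁻ p, Φ (e p) ∂resMeasure = ∫⁻ p, Φ p ∂resMeasure := by
  have hrad := measurable_radius
  rw [lintegral_resMeasure (Φ := fun p => Φ (e p)) (hΦ.comp he.measurable), lintegral_resMeasure hΦ,
    ← he.lintegral_comp ((by fun_prop : Measurable fun p =>
      ENNReal.ofReal (4 / radius p) * Φ p).indicator measurableSet_square)]
  refine lintegral_congr fun p => ?_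
  by_cases h : p ∈ square
  · rw [indicator_of_mem h, indicator_of_mem ((hs p).2 h), hr]
  · rw [indicator_of_notMem h, indicator_of_notMem (mt (hs p).1 h)]

lemma lintegral_swap {Φ : ℝ × ℝ → ℝ≥0∞} (hΦ : Measurable Φ) :
    ∫⁻ p, Φ (p.2, p.1) ∂resMeasure = ∫⁻ p, Φ p ∂resMeasure :=
  lintegral_comp_symm (e := Prod.swap) Measure.measurePreserving_swap
    (fun p => by simp only [square, mem_prod, Prod.fst_swap, Prod.snd_swap, and_comm])
    (fun p => by simp only [radius, Prod.fst_swap, Prod.snd_swap, mul_comm]) hΦ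

lemma lintegral_neg_fst {Φ : ℝ × ℝ → ℝ≥0∞} (hΦ : Measurable Φ) :
    ∫⁻ p, Φ (-p.1, p.2) ∂resMeasure = ∫⁻ p, Φ p ∂resMeasure := by
  refine lintegral_comp_symm (e := Prod.map Neg.neg id)
    ((Measure.measurePreserving_neg volume).prod (MeasurePreserving.id _))
    (fun p => ?_) (fun p => by simp [radius]) hΦ
  simp only [square, mem_prod, Prod.map_fst, Prod.map_snd, id, mem_Ioo]
  constructor <;> rintro ⟨⟨h1, h2⟩, h3⟩ <;> refine ⟨⟨by linarith, by linarith⟩, h3⟩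

lemma lintegral_neg_swap {Φ : ℝ × ℝ → ℝ≥0∞} (hΦ : Measurable Φ) :
    ∫⁻ p, Φ (-p.2, -p.1) ∂resMeasure = ∫⁻ p, Φ p ∂resMeasure := by
  have h1 := lintegral_neg_fst (Φ := fun p => Φ (p.1, -p.2)) (by fun_prop)
  have h2 := lintegral_swap (Φ := fun p => Φ (-p.1, -p.2)) (by fun_prop)
  have h3 := lintegral_swap (Φ := fun p => Φ (p.2, -p.1)) (by fun_prop)
  have h4 := lintegral_neg_fst (Φ := fun p => Φ (p.2, p.1)) (by fun_prop)
  have h5 := lintegral_swap hΦ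
  simp only at *
  rw [h2, h1, h3, h4, h5]

lemma phase_swap (p : ℝ × ℝ) : phase (p.2, p.1) = phase p := by
  rw [phase, phase, ← cos_neg ((p.2 - p.1) / 2)]; ring_nf

lemma phase_neg_swap (p : ℝ × ℝ) : phase (-p.2, -p.1) = phase p := by
  rw [phase, phase, ← cos_neg ((p.1 + p.2) / 2)]; ring_nf

lemma phase_neg_fst {p : ℝ × ℝ} (hp : p ∈ square) : phase (-p.1, p.2) = π / 2 - phase p := by
  obtain ⟨h1, h2⟩ := cos_pos_of_mem hp
  rw [phase, phase, ← arctan_inv_of_pos (by positivity), inv_div]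
  ring_nf

lemma pa_swap (p : ℝ × ℝ) : pa (p.2, p.1) = pa p := by simp only [pa, phase_swap]; ring
lemma pc_swap (p : ℝ × ℝ) : pc (p.2, p.1) = pd p := by simp only [pc, pd, phase_swap]; ring
lemma pd_swap (p : ℝ × ℝ) : pd (p.2, p.1) = pc p := by simp only [pc, pd, phase_swap]; ring
lemma pa_neg_swap (p : ℝ × ℝ) : pa (-p.2, -p.1) = pb p := by
  simp only [pa, pb, phase_neg_swap]; ring
lemma pc_neg_swap (p : ℝ × ℝ) : pc (-p.2, -p.1) = pc p := by
  simp only [pc, phase_neg_swap]; ring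
lemma pd_neg_swap (p : ℝ × ℝ) : pd (-p.2, -p.1) = pd p := by
  simp only [pd, phase_neg_swap]; ring
lemma pc_neg_fst {p : ℝ × ℝ} (hp : p ∈ square) : pc (-p.1, p.2) = 2 * π - pb p := by
  simp only [pc, pb, phase_neg_fst hp]; ring
lemma pd_neg_fst {p : ℝ × ℝ} (hp : p ∈ square) : pd (-p.1, p.2) = 2 * π - pa p := by
  simp only [pd, pa, phase_neg_fst hp]; ring

/-- The kernel `K₁` as a measure on the product of two cells. -/
def K1Measure : Measure (ℝ × ℝ) :=
  (cellMeasure.prod cellMeasure).withDensity fun q => ENNReal.ofReal (K1 q.1 q.2)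

/-- The kernel `K₂` as a measure on the product of two cells. -/
def K2Measure : Measure (ℝ × ℝ) :=
  (cellMeasure.prod cellMeasure).withDensity fun q => ENNReal.ofReal (K2 q.1 q.2)

lemma K2_comm (x y : ℝ) : K2 x y = K2 y x := by
  simp only [K2, Fplus]; ring_nf

lemma K1_comm (x y : ℝ) : K1 x y = K1 y x := by
  have : Fminus x y = Fminus y x := by simp only [Fminus]; ring
  simp only [K1, this]

lemma half_two_pi_sub (x : ℝ) : (2 * π - x) / 2 = π - x / 2 := by ring

lemma Fminus_reflect (x y : ℝ) : Fminus (2 * π - x) (2 * π - y) = Fminus x y := by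
  simp only [Fminus, half_two_pi_sub, cos_pi_sub, sin_pi_sub]; ring

lemma Fplus_reflect (x y : ℝ) : Fplus (2 * π - x) (2 * π - y) = Fplus x y := by
  simp only [Fplus, half_two_pi_sub, cos_pi_sub, sin_pi_sub]; ring

lemma K1_reflect (x y : ℝ) : K1 (2 * π - x) (2 * π - y) = K1 x y := by
  simp only [K1, Fminus_reflect]

lemma K2_reflect (x y : ℝ) : K2 (2 * π - x) (2 * π - y) = K2 x y := by
  simp only [K2, Fplus_reflect]

lemma ae_snd_ne {g : ℝ → ℝ} (hg : Measurable g) : ∀ᵐ q : ℝ × ℝ, q.2 ≠ g q.1 := by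
  have hs : MeasurableSet {q : ℝ × ℝ | q.2 ≠ g q.1} :=
    (measurableSet_eq_fun measurable_snd (hg.comp measurable_fst)).compl
  rw [Measure.volume_eq_prod]
  refine (Measure.ae_prod_mem_iff_ae_ae_mem hs).2 (Eventually.of_forall fun x => ?_)
  exact (measure_eq_zero_iff_ae_notMem.1 (measure_singleton (g x))).mono fun y hy => hy

lemma ae_fst_ne (c : ℝ) : ∀ᵐ q : ℝ × ℝ, q.1 ≠ c := by
  rw [Measure.volume_eq_prod]
  exact Measure.quasiMeasurePreserving_fst.ae (p := fun x => x ≠ c)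
    ((measure_eq_zero_iff_ae_notMem.1 (measure_singleton c)).mono fun y hy => hy)

lemma cellMeasure_prod : cellMeasure.prod cellMeasure
    = (volume : Measure (ℝ × ℝ)).restrict (cell ×ˢ cell) := by
  rw [cellMeasure, Measure.prod_restrict, Measure.volume_eq_prod]

/-- The law of (a, c) covers the triangle below the diagonal, and that of (c, a) the triangle above
it, by symmetry of `K2`. The diagonal and the edges are null. -/
lemma lintegral_K2Measure {Φ : ℝ × ℝ → ℝ≥0∞} (hΦ : Measurable Φ) :
    ∫⁻ q, Φ q ∂K2Measure =
      ∫⁻ p, Φ (pa p, pc p) ∂resMeasure + ∫⁻ p, Φ (pc p, pa p) ∂resMeasure := by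
  have hm := measurable_K2
  have hc : MeasurableSet (cell ×ˢ cell) := measurableSet_Ico.prod measurableSet_Ico
  have hR : MeasurableSet {q : ℝ × ℝ | 0 < q.2 ∧ q.2 < q.1 ∧ q.1 < 2 * π} := by measurability
  have h2 := lintegral_pa_pc (Φ := fun q => Φ q.swap) (by fun_prop)
  simp only [Prod.swap_prod_mk] at h2
  have hG : Measurable fun q : ℝ × ℝ => ENNReal.ofReal (K2 q.1 q.2) * Φ q := by fun_prop
  have hG2 : Measurable fun q : ℝ × ℝ => ENNReal.ofReal (K2 q.1 q.2) * Φ q.swap := by fun_prop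
  have hsw : MeasurePreserving Prod.swap (volume : Measure (ℝ × ℝ)) volume :=
    Measure.measurePreserving_swap
  rw [lintegral_pa_pc hΦ, h2, K2Measure, lintegral_withDensity_eq_lintegral_mul _ (by fun_prop) hΦ,
    cellMeasure_prod, ← lintegral_indicator hc, ← hsw.lintegral_comp
      (f := {q : ℝ × ℝ | 0 < q.2 ∧ q.2 < q.1 ∧ q.1 < 2 * π}.indicator
        (fun q => ENNReal.ofReal (K2 q.1 q.2) * Φ q.swap)) (hG2.indicator hR),
    ← lintegral_add_left (hG.indicator hR)]
  refine lintegral_congr_ae ?_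
  filter_upwards [ae_snd_ne measurable_id, ae_snd_ne (measurable_const (a := (0 : ℝ))),
    ae_fst_ne 0] with q h1 h2 h3
  simp only [id] at h1
  simp only [indicator, mem_prod, cell, mem_Ico, Pi.mul_apply, mem_ofPred_eq, Prod.swap_swap,
    Prod.fst_swap, Prod.snd_swap, K2_comm q.2 q.1]
  by_cases hq : (0 ≤ q.1 ∧ q.1 < 2 * π) ∧ 0 ≤ q.2 ∧ q.2 < 2 * π
  · rw [if_pos hq]
    obtain ⟨⟨g1, g2⟩, g3, g4⟩ := hq
    have g1' := lt_of_le_of_ne g1 (Ne.symm h3)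
    have g3' := lt_of_le_of_ne g3 (Ne.symm h2)
    rcases lt_or_gt_of_ne h1 with h | h
    · rw [if_pos ⟨g3', h, g2⟩, if_neg (fun h' => by linarith [h'.2.1]), add_zero]
    · rw [if_neg (fun h' => by linarith [h'.2.1]), if_pos ⟨g1', h, g4⟩, zero_add]
  · rw [if_neg hq, if_neg, if_neg, add_zero]
    · exact fun h => hq ⟨⟨by linarith [h.1], by linarith [h.2.1, h.2.2]⟩, by linarith [h.1, h.2.1],
        by linarith [h.2.2]⟩
    · exact fun h => hq ⟨⟨by linarith [h.1, h.2.1], by linarith [h.2.1, h.2.2]⟩, by linarith [h.1],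
        by linarith [h.2.2, h.2.1]⟩

lemma measurePreserving_reflect : MeasurePreserving (fun x : ℝ => 2 * π - x) volume volume := by
  have h1 : MeasurePreserving (fun x : ℝ => 2 * π + x) volume volume :=
    measurePreserving_add_left volume (2 * π)
  exact h1.comp (Measure.measurePreserving_neg volume)

/-- The pair (a, b) covers the half x + y > 2π. After u ↦ -u the pair (c, d) is the point reflection
of (b, a), so it covers the other half; the line x + y = 2π is null. -/
lemma lintegral_K1Measure {Φ : ℝ × ℝ → ℝ≥0∞} (hΦ : Measurable Φ) :
    ∫⁻ q, Φ q ∂K1Measure =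
      ∫⁻ p, Φ (pa p, pb p) ∂resMeasure + ∫⁻ p, Φ (pc p, pd p) ∂resMeasure := by
  have hm := measurable_K1
  have hc : MeasurableSet (cell ×ˢ cell) := measurableSet_Ico.prod measurableSet_Ico
  have hR : MeasurableSet {q : ℝ × ℝ | 0 < q.1 ∧ q.1 < 2 * π ∧ 0 < q.2 ∧ q.2 < 2 * π ∧
          2 * π < q.1 + q.2} := by measurability
  have hpc := measurable_pc
  have hpd := measurable_pd
  have h2 : ∫⁻ p, Φ (pc p, pd p) ∂resMeasure
      = ∫⁻ p, Φ (2 * π - pb p, 2 * π - pa p) ∂resMeasure := by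
    rw [← lintegral_neg_fst (by fun_prop)]
    refine lintegral_congr_ae ?_
    filter_upwards [resMeasure_ae_mem] with p hp
    rw [pc_neg_fst hp, pd_neg_fst hp]
  have h3 := lintegral_pa_pb (Φ := fun q => Φ (2 * π - q.2, 2 * π - q.1)) (by fun_prop)
  simp only at h3
  have hG : Measurable fun q : ℝ × ℝ => ENNReal.ofReal (K1 q.1 q.2) * Φ q := by fun_prop
  have hG2 : Measurable fun q : ℝ × ℝ => ENNReal.ofReal (K1 q.1 q.2) *
    Φ (2 * π - q.2, 2 * π - q.1) := by fun_prop
  have hmp : MeasurePreserving (fun q : ℝ × ℝ => (2 * π - q.2, 2 * π - q.1)) volume volume :=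
    (measurePreserving_reflect.prod measurePreserving_reflect).comp Measure.measurePreserving_swap
  rw [lintegral_pa_pb hΦ, h2, h3, K1Measure,
    lintegral_withDensity_eq_lintegral_mul _ (by fun_prop) hΦ,
    cellMeasure_prod, ← lintegral_indicator hc, ← hmp.lintegral_comp
      (f := {q : ℝ × ℝ | 0 < q.1 ∧ q.1 < 2 * π ∧ 0 < q.2 ∧ q.2 < 2 * π ∧
          2 * π < q.1 + q.2}.indicator
        (fun q => ENNReal.ofReal (K1 q.1 q.2) * Φ (2 * π - q.2, 2 * π - q.1))) (hG2.indicator hR),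
    ← lintegral_add_left (hG.indicator hR)]
  refine lintegral_congr_ae ?_
  filter_upwards [ae_snd_ne (g := fun x => 2 * π - x) (by fun_prop),
    ae_snd_ne (measurable_const (a := (0 : ℝ))), ae_fst_ne 0] with q h1 h2 h3
  simp only [indicator, mem_prod, cell, mem_Ico, Pi.mul_apply, mem_ofPred_eq, K1_reflect,
    K1_comm q.2 q.1, sub_sub_cancel]
  by_cases hq : (0 ≤ q.1 ∧ q.1 < 2 * π) ∧ 0 ≤ q.2 ∧ q.2 < 2 * π
  · rw [if_pos hq]
    obtain ⟨⟨g1, g2⟩, g3, g4⟩ := hq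
    have g1' := lt_of_le_of_ne g1 (Ne.symm h3)
    have g3' := lt_of_le_of_ne g3 (Ne.symm h2)
    rcases lt_or_gt_of_ne h1 with h | h
    · rw [if_neg (fun h' => by linarith [h'.2.2.2.2]), if_pos, zero_add]
      refine ⟨?_, ?_, ?_, ?_, ?_⟩ <;> linarith
    · rw [if_pos, if_neg (fun h' => by linarith [h'.2.2.2.2]), add_zero]
      refine ⟨?_, ?_, ?_, ?_, ?_⟩ <;> linarith
  · rw [if_neg hq, if_neg, if_neg, add_zero]
    · rintro ⟨_, _, _, _, _⟩
      exact hq ⟨⟨by linarith, by linarith⟩, by linarith, by linarith⟩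
    · rintro ⟨_, _, _, _, _⟩
      exact hq ⟨⟨by linarith, by linarith⟩, by linarith, by linarith⟩

lemma K1Measure_eq : K1Measure = resMeasure.map (fun p => (pa p, pb p)) +
    resMeasure.map (fun p => (pc p, pd p)) := by
  have h1 := measurable_pa.prodMk measurable_pb
  have h2 := measurable_pc.prodMk measurable_pd
  refine Measure.ext_of_lintegral _ fun Φ hΦ => ?_
  rw [lintegral_K1Measure hΦ, lintegral_add_measure, lintegral_map hΦ h1, lintegral_map hΦ h2]

lemma K2Measure_eq : K2Measure = resMeasure.map (fun p => (pa p, pc p)) +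
    resMeasure.map (fun p => (pc p, pa p)) := by
  have h1 := measurable_pa.prodMk measurable_pc
  have h2 := measurable_pc.prodMk measurable_pa
  refine Measure.ext_of_lintegral _ fun Φ hΦ => ?_
  rw [lintegral_K2Measure hΦ, lintegral_add_measure, lintegral_map hΦ h1, lintegral_map hΦ h2]

end FPU
end

noncomputable section

namespace FPU

open Real Set
open scoped ENNReal

/-! ### Elementary kernel bounds and the collision frequency -/

lemma cell_ae : ∀ᵐ x ∂cellMeasure, x ∈ Ioo 0 (2 * π) := by
  rw [cellMeasure, cell, ← Measure.restrict_congr_set Ioo_ae_eq_Ico]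
  exact ae_restrict_mem measurableSet_Ioo

lemma cellMeasure_eq_Ioo : cellMeasure = volume.restrict (Ioo 0 (2 * π)) := by
  rw [cellMeasure, cell, Measure.restrict_congr_set Ioo_ae_eq_Ico]

lemma sin_half_pos {x : ℝ} (hx : x ∈ Ioo 0 (2 * π)) : 0 < sin (x / 2) :=
  sin_pos_of_pos_of_lt_pi (by linarith [hx.1]) (by linarith [hx.2])

lemma dispersion_eq {x : ℝ} (hx : x ∈ Ioo 0 (2 * π)) : dispersion x = sin (x / 2) :=
  abs_of_pos (sin_half_pos hx)

lemma dispersion_pos {x : ℝ} (hx : x ∈ Ioo 0 (2 * π)) : 0 < dispersion x := by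
  rw [dispersion_eq hx]; exact sin_half_pos hx

lemma dispersion_nonneg (x : ℝ) : 0 ≤ dispersion x := abs_nonneg _

lemma dispersion_le_one (x : ℝ) : dispersion x ≤ 1 := abs_sin_le_one _

lemma measurable_dispersion : Measurable dispersion := by
  unfold dispersion
  exact (continuous_sin.comp (continuous_id.div_const 2)).abs.measurable

lemma dispersion_reflect (x : ℝ) : dispersion (2 * π - x) = dispersion x := by
  simp only [dispersion, half_two_pi_sub, sin_pi_sub]

lemma reflect_mem {x : ℝ} : 2 * π - x ∈ Ioo 0 (2 * π) ↔ x ∈ Ioo 0 (2 * π) := by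
  simp only [mem_Ioo]; constructor <;> rintro ⟨h1, h2⟩ <;> constructor <;> linarith

lemma measurePreserving_reflect_cell :
    MeasurePreserving (fun x : ℝ => 2 * π - x) cellMeasure cellMeasure := by
  have h := measurePreserving_reflect.restrict_preimage (s := Ioo 0 (2 * π)) measurableSet_Ioo
  have e : (fun x : ℝ => 2 * π - x) ⁻¹' Ioo 0 (2 * π) = Ioo 0 (2 * π) := by
    ext x; exact reflect_mem
  rwa [e, ← cellMeasure_eq_Ioo] at h

lemma lintegral_reflect (f : ℝ → ℝ≥0∞) :
    ∫⁻ x, f (2 * π - x) ∂cellMeasure = ∫⁻ x, f x ∂cellMeasure := by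
  have he : MeasurableEmbedding fun x : ℝ => 2 * π - x :=
    (Homeomorph.subLeft (2 * π)).measurableEmbedding
  exact measurePreserving_reflect_cell.lintegral_comp_emb he f

lemma integral_reflect {E : Type*} [NormedAddCommGroup E] [NormedSpace ℝ E] (f : ℝ → E) :
    ∫ x, f (2 * π - x) ∂cellMeasure = ∫ x, f x ∂cellMeasure := by
  have he : MeasurableEmbedding fun x : ℝ => 2 * π - x :=
    (Homeomorph.subLeft (2 * π)).measurableEmbedding
  exact measurePreserving_reflect_cell.integral_comp he f

lemma integrable_rpow_dispersion {r : ℝ} (hr : -1 < r) :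
    Integrable (fun x => dispersion x ^ r) cellMeasure := by
  have hm : Measurable fun x => dispersion x ^ r := measurable_dispersion.pow_const r
  have hpi := pi_pos
  rcases le_or_gt 0 r with h0 | h0
  · refine Integrable.of_bound (C := 1) hm.aestronglyMeasurable (Eventually.of_forall fun x => ?_)
    rw [norm_of_nonneg (rpow_nonneg (dispersion_nonneg x) _)]
    exact rpow_le_one (dispersion_nonneg x) (dispersion_le_one x) h0
  · have h1 : Integrable (fun x : ℝ => x ^ r) cellMeasure := by
      have := (intervalIntegral.intervalIntegrable_rpow' (a := 0) (b := 2 * π) hr).1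
      rwa [IntegrableOn, ← Measure.restrict_congr_set Ioo_ae_eq_Ioc, ← cellMeasure_eq_Ioo] at this
    have h2 : Integrable (fun x : ℝ => (2 * π - x) ^ r) cellMeasure :=
      (measurePreserving_reflect_cell.integrable_comp_emb
        (Homeomorph.subLeft (2 * π)).measurableEmbedding).2 h1
    refine ((h1.add h2).const_mul (π⁻¹ ^ r)).mono' hm.aestronglyMeasurable ?_
    filter_upwards [cell_ae] with x hx
    rw [norm_of_nonneg (rpow_nonneg (dispersion_nonneg x) _), dispersion_eq hx]
    simp only [Pi.add_apply]
    have hx1 : 0 ≤ x ^ r := rpow_nonneg hx.1.le _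
    have hx2 : 0 ≤ (2 * π - x) ^ r := rpow_nonneg (by linarith [hx.2]) _
    have hp : 0 ≤ π⁻¹ ^ r := by positivity
    rcases le_or_gt x π with h | h
    · have hs : π⁻¹ * x ≤ sin (x / 2) := by
        have := mul_le_sin (x := x / 2) (by linarith [hx.1]) (by linarith)
        calc π⁻¹ * x = 2 / π * (x / 2) := by field_simp
          _ ≤ _ := this
      calc sin (x / 2) ^ r ≤ (π⁻¹ * x) ^ r :=
            rpow_le_rpow_of_nonpos (mul_pos (by positivity) hx.1) hs h0.le
        _ = π⁻¹ ^ r * x ^ r := mul_rpow (by positivity) hx.1.le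
        _ ≤ _ := by nlinarith
    · have hs : π⁻¹ * (2 * π - x) ≤ sin (x / 2) := by
        have := mul_le_sin (x := (2 * π - x) / 2) (by linarith [hx.2]) (by linarith)
        rw [half_two_pi_sub, sin_pi_sub] at this
        calc π⁻¹ * (2 * π - x) = 2 / π * (π - x / 2) := by field_simp
          _ ≤ _ := this
      calc sin (x / 2) ^ r ≤ (π⁻¹ * (2 * π - x)) ^ r :=
            rpow_le_rpow_of_nonpos (mul_pos (by positivity) (by linarith [hx.2])) hs h0.le
        _ = π⁻¹ ^ r * (2 * π - x) ^ r := mul_rpow (by positivity) (by linarith [hx.2])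
        _ ≤ _ := by nlinarith

lemma K1_nonneg (x y : ℝ) : 0 ≤ K1 x y := by
  unfold K1; split_ifs
  · positivity
  · exact le_rfl

lemma K2_nonneg (x y : ℝ) : 0 ≤ K2 x y := by unfold K2; positivity

/-- Dropping the square of the cosine sum leaves F₊ ≥ 4 sin(x/2) sin(y/2). -/
lemma K2_le {x y : ℝ} (hx : x ∈ Ioo 0 (2 * π)) (hy : y ∈ Ioo 0 (2 * π)) :
    K2 x y ≤ dispersion x ^ (-(1 / 2) : ℝ) * dispersion y ^ (-(1 / 2) : ℝ) := by
  have h1 := sin_half_pos hx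
  have h2 := sin_half_pos hy
  rw [dispersion_eq hx, dispersion_eq hy, ← mul_rpow h1.le h2.le, rpow_neg (by positivity),
    ← sqrt_eq_rpow, K2, ← one_div]
  have h3 : 2 * √(sin (x / 2) * sin (y / 2)) ≤ √(Fplus x y) := by
    apply le_sqrt_of_sq_le
    rw [mul_pow, sq_sqrt (by positivity), Fplus]
    nlinarith [sq_nonneg (cos (x / 2) + cos (y / 2))]
  have h4 : 0 < √(sin (x / 2) * sin (y / 2)) := sqrt_pos.2 (by positivity)
  rw [div_le_div_iff₀ (by linarith) h4]
  linarith

lemma integrable_K2 {x : ℝ} (hx : x ∈ Ioo 0 (2 * π)) :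
    Integrable (fun y => K2 x y) cellMeasure := by
  refine ((integrable_rpow_dispersion (r := -(1 / 2)) (by norm_num)).const_mul
    (dispersion x ^ (-(1 / 2) : ℝ))).mono'
    (measurable_K2.comp (measurable_const.prodMk measurable_id)).aestronglyMeasurable ?_
  filter_upwards [cell_ae] with y hy
  rw [norm_of_nonneg (K2_nonneg x y)]
  exact K2_le hx hy

lemma lintegral_K2_eq {x : ℝ} (hx : x ∈ Ioo 0 (2 * π)) :
    ∫⁻ y, ENNReal.ofReal (K2 x y) ∂cellMeasure = ENNReal.ofReal (V x) := by
  rw [V, ofReal_integral_eq_lintegral_ofReal (integrable_K2 hx)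
    (Eventually.of_forall fun y => K2_nonneg x y)]

lemma V_nonneg (x : ℝ) : 0 ≤ V x := integral_nonneg fun y => K2_nonneg x y

lemma measurable_V : Measurable V :=
  (measurable_K2.stronglyMeasurable.integral_prod_right').measurable

lemma V_reflect (x : ℝ) : V (2 * π - x) = V x := by
  rw [V, V, ← integral_reflect]
  simp only [K2_reflect]

/-- A crude bound, enough for ω²V to be bounded and thus for L̃ to be defined. The true order -1/3
is obtained in `exists_V_le_rpow`. -/
lemma exists_V_le : ∃ C : ℝ, 0 < C ∧ ∀ x ∈ Ioo 0 (2 * π), V x ≤ C * dispersion x ^ (-(1 / 2) : ℝ) := by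
  refine ⟨∫ y, dispersion y ^ (-(1 / 2) : ℝ) ∂cellMeasure + 1, ?_, fun x hx => ?_⟩
  · have : 0 ≤ ∫ y, dispersion y ^ (-(1 / 2) : ℝ) ∂cellMeasure :=
      integral_nonneg fun y => rpow_nonneg (dispersion_nonneg y) _
    linarith
  · have hi := integrable_rpow_dispersion (r := -(1 / 2)) (by norm_num)
    have h0 := rpow_nonneg (dispersion_nonneg x) (-(1 / 2) : ℝ)
    calc V x ≤ ∫ y, dispersion x ^ (-(1 / 2) : ℝ) * dispersion y ^ (-(1 / 2) : ℝ) ∂cellMeasure := by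
          refine integral_mono_ae (integrable_K2 hx) (hi.const_mul _) ?_
          filter_upwards [cell_ae] with y hy using K2_le hx hy
      _ ≤ _ := by rw [integral_const_mul]; nlinarith

/-- The measure with density `V` on the cell. -/
def VMeasure : Measure ℝ := cellMeasure.withDensity fun x => ENNReal.ofReal (V x)

lemma K2Measure_fst : K2Measure.map Prod.fst = VMeasure := by
  have hm := measurable_K2
  refine Measure.ext_of_lintegral _ fun φ hφ => ?_
  rw [lintegral_map hφ measurable_fst, K2Measure,
    lintegral_withDensity_eq_lintegral_mul _ (by fun_prop) (by fun_prop),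
    lintegral_prod _ (by fun_prop), VMeasure,
    lintegral_withDensity_eq_lintegral_mul _ measurable_V.ennreal_ofReal hφ]
  refine lintegral_congr_ae ?_
  filter_upwards [cell_ae] with x hx
  simp only [Pi.mul_apply]
  rw [lintegral_mul_const _ (by fun_prop), lintegral_K2_eq hx]

lemma VMeasure_eq : VMeasure = resMeasure.map pa + resMeasure.map pc := by
  have h1 := measurable_pa
  have h2 := measurable_pc
  rw [← K2Measure_fst, K2Measure_eq, Measure.map_add _ _ measurable_fst,
    Measure.map_map measurable_fst (by fun_prop), Measure.map_map measurable_fst (by fun_prop)]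
  rfl

lemma K1Measure_fst : K1Measure.map Prod.fst = VMeasure := by
  have h1 := measurable_pa
  have h2 := measurable_pc
  have h3 := measurable_pb
  have h4 := measurable_pd
  rw [VMeasure_eq, K1Measure_eq, Measure.map_add _ _ measurable_fst,
    Measure.map_map measurable_fst (by fun_prop), Measure.map_map measurable_fst (by fun_prop)]
  rfl

/-- The first marginals of `K1Measure` and of `K2Measure` are both the sum of the laws of a and c.
This identity between the two row integrals is hard to see from the kernels themselves; it makes `V`
control the gain part as well. -/
lemma lintegral_K1_ae :
    ∀ᵐ x ∂cellMeasure, ∫⁻ y, ENNReal.ofReal (K1 x y) ∂cellMeasure = ENNReal.ofReal (V x) := by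
  have hm := measurable_K1
  refine ae_eq_of_forall_setLIntegral_eq_of_sigmaFinite ?_ measurable_V.ennreal_ofReal ?_
  · exact Measurable.lintegral_prod_right' (f := fun q : ℝ × ℝ => ENNReal.ofReal (K1 q.1 q.2))
      (by fun_prop)
  · intro s hs _
    have h1 : K1Measure.map Prod.fst s = VMeasure s := by rw [K1Measure_fst]
    rw [VMeasure, withDensity_apply _ hs, Measure.map_apply measurable_fst hs, K1Measure,
      withDensity_apply _ (measurable_fst hs), show Prod.fst ⁻¹' s = s ×ˢ (univ : Set ℝ) by
        ext; simp, ← Measure.prod_restrict, lintegral_prod _ (by fun_prop),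
      Measure.restrict_univ] at h1
    exact h1

end FPU
end

noncomputable section

namespace FPU

open Real Set
open scoped ENNReal NNReal

/-! ### Integral operators on `L²(I)` -/

/-- Cauchy–Schwarz for the measure k dμ. -/
lemma sq_lintegral_mul_le {α : Type*} [MeasurableSpace α] {μ : Measure α} {k g : α → ℝ≥0∞}
    (hk : AEMeasurable k μ) (hg : AEMeasurable g μ) :
    (∫⁻ x, k x * g x ∂μ) ^ 2 ≤ (∫⁻ x, k x ∂μ) * ∫⁻ x, k x * g x ^ 2 ∂μ := by
  have h := ENNReal.lintegral_mul_le_Lp_mul_Lq μ Real.HolderConjugate.two_two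
    (f := fun x => k x ^ (1 / 2 : ℝ)) (g := fun x => k x ^ (1 / 2 : ℝ) * g x)
    (hk.pow_const _) ((hk.pow_const _).mul hg)
  have e1 : ∀ x, k x ^ (1 / 2 : ℝ) * k x ^ (1 / 2 : ℝ) = k x := fun x => by
    rw [← ENNReal.rpow_add_of_nonneg _ _ (by norm_num) (by norm_num)]; norm_num
  have e2 : ∀ x, (k x ^ (1 / 2 : ℝ)) ^ (2 : ℝ) = k x := fun x => by
    rw [← ENNReal.rpow_mul]; norm_num
  have e3 : ∀ x, (k x ^ (1 / 2 : ℝ) * g x) ^ (2 : ℝ) = k x * g x ^ 2 := fun x => by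
    rw [ENNReal.mul_rpow_of_nonneg _ _ (by norm_num), e2]; norm_num
  simp only [Pi.mul_apply, ← mul_assoc, e1, e2, e3] at h
  calc (∫⁻ x, k x * g x ∂μ) ^ 2 ≤ ((∫⁻ x, k x ∂μ) ^ (1 / 2 : ℝ) *
        (∫⁻ x, k x * g x ^ 2 ∂μ) ^ (1 / 2 : ℝ)) ^ 2 := by gcongr
    _ = _ := by
      rw [mul_pow, ← ENNReal.rpow_natCast, ← ENNReal.rpow_natCast, ← ENNReal.rpow_mul,
        ← ENNReal.rpow_mul]
      norm_num

/-- A symmetric measurable kernel whose row integrals are dominated by `V`. -/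
structure Dominated (k : ℝ → ℝ → ℝ) : Prop where
  measurable : Measurable fun q : ℝ × ℝ => k q.1 q.2
  comm : ∀ x y, k x y = k y x
  row_le : ∀ᵐ x ∂cellMeasure, ∫⁻ y, ‖k x y‖ₑ ∂cellMeasure ≤ ENNReal.ofReal (V x)

lemma dominated_K1 : Dominated K1 where
  measurable := measurable_K1
  comm := K1_comm
  row_le := by
    filter_upwards [lintegral_K1_ae] with x hx
    rw [← hx]
    exact (lintegral_congr fun y => Real.enorm_of_nonneg (K1_nonneg x y)).le

lemma dominated_K2 : Dominated K2 where
  measurable := measurable_K2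
  comm := K2_comm
  row_le := by
    filter_upwards [cell_ae] with x hx
    rw [← lintegral_K2_eq hx]
    exact (lintegral_congr fun y => Real.enorm_of_nonneg (K2_nonneg x y)).le

/-- An admissible weight: `p² V` is bounded. -/
structure Admissible (p : ℝ → ℝ) (C : ℝ) : Prop where
  measurable : Measurable p
  nonneg_const : 0 ≤ C
  le : ∀ x ∈ Ioo 0 (2 * π), p x ^ 2 * V x ≤ C

lemma L2_measurable (f : L2) : Measurable (f : ℝ → ℂ) := (Lp.stronglyMeasurable f).measurable

/-- Schur's test: Cauchy–Schwarz in each row costs p²V ≤ C, and after Tonelli the symmetry of the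
kernel makes the columns cost the same again. -/
lemma lintegral_row_sq_le {k : ℝ → ℝ → ℝ} (hk : Dominated k) {p : ℝ → ℝ} {C : ℝ}
    (hp : Admissible p C) {f : ℝ → ℂ} (hf : Measurable f) :
    ∫⁻ x, (‖p x‖ₑ * ∫⁻ y, ‖k x y‖ₑ * ‖(p y : ℂ) * f y‖ₑ ∂cellMeasure) ^ 2 ∂cellMeasure ≤
      ENNReal.ofReal C ^ 2 * ∫⁻ y, ‖f y‖ₑ ^ 2 ∂cellMeasure := by
  have hkm := hk.measurable
  have hpm := hp.measurable
  have hV := measurable_V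
  have hpV : ∀ᵐ x ∂cellMeasure, ‖p x‖ₑ ^ 2 * ENNReal.ofReal (V x) ≤ ENNReal.ofReal C := by
    filter_upwards [cell_ae] with x hx
    rw [← enorm_pow, Real.enorm_of_nonneg (sq_nonneg _), ← ENNReal.ofReal_mul (sq_nonneg _)]
    exact ENNReal.ofReal_le_ofReal (hp.le x hx)
  have hkx : ∀ x, Measurable fun y => ‖k x y‖ₑ := fun x =>
    (hkm.comp (measurable_const.prodMk measurable_id)).enorm
  calc ∫⁻ x, (‖p x‖ₑ * ∫⁻ y, ‖k x y‖ₑ * ‖(p y : ℂ) * f y‖ₑ ∂cellMeasure) ^ 2 ∂cellMeasure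
      ≤ ∫⁻ x, ENNReal.ofReal C * ∫⁻ y, ‖k x y‖ₑ * ‖(p y : ℂ) * f y‖ₑ ^ 2 ∂cellMeasure
          ∂cellMeasure := by
        refine lintegral_mono_ae ?_
        filter_upwards [hk.row_le, hpV] with x h1 h2
        rw [mul_pow]
        calc _ ≤ ‖p x‖ₑ ^ 2 * ((∫⁻ y, ‖k x y‖ₑ ∂cellMeasure) *
              ∫⁻ y, ‖k x y‖ₑ * ‖(p y : ℂ) * f y‖ₑ ^ 2 ∂cellMeasure) := by
              gcongr
              exact sq_lintegral_mul_le (hkx x).aemeasurable (by fun_prop)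
          _ ≤ ‖p x‖ₑ ^ 2 * (ENNReal.ofReal (V x) *
              ∫⁻ y, ‖k x y‖ₑ * ‖(p y : ℂ) * f y‖ₑ ^ 2 ∂cellMeasure) := by gcongr
          _ ≤ _ := by rw [← mul_assoc]; gcongr
    _ = ENNReal.ofReal C * ∫⁻ y, ∫⁻ x, ‖k x y‖ₑ * ‖(p y : ℂ) * f y‖ₑ ^ 2 ∂cellMeasure
          ∂cellMeasure := by
        rw [lintegral_const_mul' _ _ ENNReal.ofReal_ne_top, lintegral_lintegral_swap]
        have : Measurable fun q : ℝ × ℝ => ‖k q.1 q.2‖ₑ * ‖(p q.2 : ℂ) * f q.2‖ₑ ^ 2 := by fun_prop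
        exact this.aemeasurable
    _ ≤ ENNReal.ofReal C * ∫⁻ y, ENNReal.ofReal C * ‖f y‖ₑ ^ 2 ∂cellMeasure := by
        refine mul_le_mul_right (lintegral_mono_ae ?_) _
        filter_upwards [hk.row_le, hpV] with y h1 h2
        have h3 : Measurable fun x => ‖k x y‖ₑ :=
          (hkm.comp (measurable_id.prodMk measurable_const)).enorm
        rw [lintegral_mul_const _ h3, enorm_mul, mul_pow, ← mul_assoc]
        gcongr
        have e : ‖(p y : ℂ)‖ₑ = ‖p y‖ₑ := by simp [enorm]
        simp_rw [hk.comm _ y]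
        rw [e, mul_comm]
        exact (mul_le_mul_right h1 _).trans h2
    _ = _ := by
        rw [lintegral_const_mul' _ _ ENNReal.ofReal_ne_top, ← mul_assoc, sq]

lemma lintegral_L2_sq (f : L2) : ∫⁻ y, ‖f y‖ₑ ^ 2 ∂cellMeasure = ENNReal.ofReal (‖f‖ ^ 2) := by
  have h := Lp.norm_def f
  rw [eLpNorm_eq_lintegral_rpow_enorm_toReal (by norm_num) (by norm_num)] at h
  simp only [ENNReal.toReal_ofNat, ENNReal.rpow_ofNat] at h
  have hfin : ∫⁻ y, ‖f y‖ₑ ^ 2 ∂cellMeasure ≠ ⊤ := by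
    have := (Lp.memLp f).2
    rw [eLpNorm_lt_top_iff_lintegral_rpow_enorm_lt_top (by norm_num) (by norm_num)] at this
    simpa using this.ne
  rw [h, ← ENNReal.toReal_rpow, ← rpow_natCast, ← rpow_mul ENNReal.toReal_nonneg]
  norm_num [ENNReal.ofReal_toReal hfin]

lemma Dominated.ae_integrable {k : ℝ → ℝ → ℝ} (hk : Dominated k) {p : ℝ → ℝ} {C : ℝ}
    (hp : Admissible p C) (hp0 : ∀ x ∈ Ioo 0 (2 * π), p x ≠ 0) (f : L2) :
    ∀ᵐ x ∂cellMeasure, Integrable (fun y => (k x y : ℂ) * ((p y : ℂ) * f y)) cellMeasure := by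
  have hkm := hk.measurable
  have hpm := hp.measurable
  have hfm := L2_measurable f
  have h := lintegral_row_sq_le hk hp hfm
  rw [lintegral_L2_sq] at h
  have hm : Measurable fun x => (‖p x‖ₑ * ∫⁻ y, ‖k x y‖ₑ * ‖(p y : ℂ) * f y‖ₑ ∂cellMeasure) ^ 2 := by
    have : Measurable fun x => ∫⁻ y, ‖k x y‖ₑ * ‖(p y : ℂ) * f y‖ₑ ∂cellMeasure :=
      Measurable.lintegral_prod_right'
        (f := fun q : ℝ × ℝ => ‖k q.1 q.2‖ₑ * ‖(p q.2 : ℂ) * f q.2‖ₑ) (by fun_prop)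
    fun_prop
  have h2 := ae_lt_top hm (h.trans_lt (by
    exact ENNReal.mul_lt_top (by simp) ENNReal.ofReal_lt_top)).ne
  filter_upwards [h2, cell_ae] with x hx hxI
  have hx2 : ∫⁻ y, ‖k x y‖ₑ * ‖(p y : ℂ) * f y‖ₑ ∂cellMeasure < ⊤ := by
    by_contra hcon
    rw [not_lt, top_le_iff] at hcon
    rw [hcon, ENNReal.mul_top (by simpa using hp0 x hxI)] at hx
    simp at hx
  have hkx : Measurable fun y => k x y := hkm.comp (measurable_const.prodMk measurable_id)
  refine ⟨by fun_prop, ?_⟩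
  rw [hasFiniteIntegral_iff_enorm]
  refine lt_of_le_of_lt (lintegral_mono fun y => ?_) hx2
  rw [enorm_mul]
  gcongr
  simp [enorm]

/-- The function `x ↦ p(x) ∫ k(x, y) p(y) f(y) dy`. -/
def kernelFun (k : ℝ → ℝ → ℝ) (p : ℝ → ℝ) (f : ℝ → ℂ) (x : ℝ) : ℂ :=
  (p x : ℂ) * ∫ y, (k x y : ℂ) * ((p y : ℂ) * f y) ∂cellMeasure

lemma measurable_kernelFun {k : ℝ → ℝ → ℝ} (hk : Dominated k) {p : ℝ → ℝ} (hp : Measurable p)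
    {f : ℝ → ℂ} (hf : Measurable f) : Measurable (kernelFun k p f) := by
  have hkm := hk.measurable
  have : Measurable fun q : ℝ × ℝ => (k q.1 q.2 : ℂ) * ((p q.2 : ℂ) * f q.2) := by fun_prop
  have h2 := this.stronglyMeasurable.integral_prod_right' (ν := cellMeasure)
  exact Measurable.mul (by fun_prop) h2.measurable

lemma lintegral_kernelFun_le {k : ℝ → ℝ → ℝ} (hk : Dominated k) {p : ℝ → ℝ} {C : ℝ}
    (hp : Admissible p C) (f : L2) :
    ∫⁻ x, ‖kernelFun k p f x‖ₑ ^ 2 ∂cellMeasure ≤ ENNReal.ofReal ((C * ‖f‖) ^ 2) := by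
  have h := lintegral_row_sq_le hk hp (L2_measurable f)
  rw [lintegral_L2_sq, ← ENNReal.ofReal_pow hp.nonneg_const,
    ← ENNReal.ofReal_mul (sq_nonneg C), ← mul_pow] at h
  refine le_trans (lintegral_mono fun x => ?_) h
  rw [kernelFun, enorm_mul]
  have e : ‖(p x : ℂ)‖ₑ = ‖p x‖ₑ := by simp [enorm]
  rw [e]
  gcongr
  refine (enorm_integral_le_lintegral_enorm _).trans (lintegral_mono fun y => ?_)
  rw [enorm_mul (k x y : ℂ)]
  gcongr
  simp [enorm]

lemma memLp_two_of_lintegral {u : ℝ → ℂ} (hu : Measurable u) {M : ℝ} (hM : 0 ≤ M)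
    (h : ∫⁻ x, ‖u x‖ₑ ^ 2 ∂cellMeasure ≤ ENNReal.ofReal (M ^ 2)) :
    MemLp u 2 cellMeasure ∧ eLpNorm u 2 cellMeasure ≤ ENNReal.ofReal M := by
  have h2 : eLpNorm u 2 cellMeasure ≤ ENNReal.ofReal M := by
    rw [eLpNorm_eq_lintegral_rpow_enorm_toReal (by norm_num) (by norm_num)]
    simp only [ENNReal.toReal_ofNat, ENNReal.rpow_ofNat]
    calc _ ≤ (ENNReal.ofReal (M ^ 2)) ^ (1 / 2 : ℝ) := by gcongr
      _ = _ := by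
        rw [ENNReal.ofReal_pow hM, ← ENNReal.rpow_natCast, ← ENNReal.rpow_mul]; norm_num
  exact ⟨⟨hu.aestronglyMeasurable, h2.trans_lt ENNReal.ofReal_lt_top⟩, h2⟩

theorem exists_kernelOperator {k : ℝ → ℝ → ℝ} (hk : Dominated k) {p : ℝ → ℝ} {C : ℝ}
    (hp : Admissible p C) (hp0 : ∀ x ∈ Ioo 0 (2 * π), p x ≠ 0) :
    ∃ T : L2 →L[ℂ] L2, ∀ f : L2, T f =ᵐ[cellMeasure] kernelFun k p f := by
  have hmem : ∀ f : L2, MemLp (kernelFun k p f) 2 cellMeasure ∧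
      eLpNorm (kernelFun k p f) 2 cellMeasure ≤ ENNReal.ofReal (C * ‖f‖) := fun f =>
    memLp_two_of_lintegral (measurable_kernelFun hk hp.measurable (L2_measurable f))
      (mul_nonneg hp.nonneg_const (norm_nonneg _)) (lintegral_kernelFun_le hk hp f)
  let T0 : L2 →ₗ[ℂ] L2 :=
    { toFun := fun f => (hmem f).1.toLp _
      map_add' := fun f g => by
        refine Lp.ext ?_
        filter_upwards [(hmem (f + g)).1.coeFn_toLp, (hmem f).1.coeFn_toLp, (hmem g).1.coeFn_toLp,
          Lp.coeFn_add ((hmem f).1.toLp _) ((hmem g).1.toLp _), hk.ae_integrable hp hp0 f,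
          hk.ae_integrable hp hp0 g] with x h1 h2 h3 h4 h5 h6
        rw [h1, h4, Pi.add_apply, h2, h3, kernelFun, kernelFun, kernelFun, ← mul_add,
          ← integral_add h5 h6]
        congr 1
        refine integral_congr_ae ?_
        filter_upwards [Lp.coeFn_add f g] with y hy
        rw [hy, Pi.add_apply]; ring
      map_smul' := fun c f => by
        refine Lp.ext ?_
        filter_upwards [(hmem (c • f)).1.coeFn_toLp, (hmem f).1.coeFn_toLp,
          Lp.coeFn_smul c ((hmem f).1.toLp _)] with x h1 h2 h4
        have h5 : ∫ y, (k x y : ℂ) * ((p y : ℂ) * (c • f) y) ∂cellMeasure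
            = ∫ y, c * ((k x y : ℂ) * ((p y : ℂ) * f y)) ∂cellMeasure := by
          refine integral_congr_ae ?_
          filter_upwards [Lp.coeFn_smul c f] with y hy
          rw [hy, Pi.smul_apply, smul_eq_mul]; ring
        rw [RingHom.id_apply, h1, h4, Pi.smul_apply, h2, kernelFun, kernelFun, smul_eq_mul, h5,
          integral_const_mul]
        ring }
  refine ⟨T0.mkContinuous C fun f => ?_, fun f => (hmem f).1.coeFn_toLp⟩
  change ‖(hmem f).1.toLp _‖ ≤ _
  rw [Lp.norm_toLp]
  exact ENNReal.toReal_le_of_le_ofReal (mul_nonneg hp.nonneg_const (norm_nonneg _)) (hmem f).2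

/-- Multiplication by a bounded measurable real function. -/
theorem exists_multiplication {m : ℝ → ℝ} (hm : Measurable m) {C : ℝ} (hC : 0 ≤ C)
    (hb : ∀ x ∈ Ioo 0 (2 * π), |m x| ≤ C) :
    ∃ M : L2 →L[ℂ] L2, IsMultiplication M m := by
  have hmem : ∀ f : L2, MemLp (fun x => (m x : ℂ) * f x) 2 cellMeasure ∧
      eLpNorm (fun x => (m x : ℂ) * f x) 2 cellMeasure ≤ ENNReal.ofReal (C * ‖f‖) := fun f => by
    have hfm := L2_measurable f
    refine memLp_two_of_lintegral (by fun_prop) (mul_nonneg hC (norm_nonneg _)) ?_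
    rw [mul_pow, ENNReal.ofReal_mul (sq_nonneg C), ← lintegral_L2_sq,
      ← lintegral_const_mul' _ _ ENNReal.ofReal_ne_top]
    refine lintegral_mono_ae ?_
    filter_upwards [cell_ae] with x hx
    rw [enorm_mul, mul_pow]
    gcongr
    rw [ENNReal.ofReal_pow hC]
    gcongr
    rw [← ofReal_norm, Complex.norm_real]
    exact ENNReal.ofReal_le_ofReal (hb x hx)
  let T0 : L2 →ₗ[ℂ] L2 :=
    { toFun := fun f => (hmem f).1.toLp _
      map_add' := fun f g => by
        refine Lp.ext ?_
        filter_upwards [(hmem (f + g)).1.coeFn_toLp, (hmem f).1.coeFn_toLp, (hmem g).1.coeFn_toLp,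
          Lp.coeFn_add ((hmem f).1.toLp _) ((hmem g).1.toLp _), Lp.coeFn_add f g]
          with x h1 h2 h3 h4 h5
        rw [h1, h4, Pi.add_apply, h2, h3, h5, Pi.add_apply]; ring
      map_smul' := fun c f => by
        refine Lp.ext ?_
        filter_upwards [(hmem (c • f)).1.coeFn_toLp, (hmem f).1.coeFn_toLp,
          Lp.coeFn_smul c ((hmem f).1.toLp _), Lp.coeFn_smul c f] with x h1 h2 h4 h5
        rw [RingHom.id_apply, h1, h4, Pi.smul_apply, h2, h5, Pi.smul_apply, smul_eq_mul,
          smul_eq_mul]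
        ring }
  refine ⟨T0.mkContinuous C fun f => ?_, fun f => (hmem f).1.coeFn_toLp⟩
  change ‖(hmem f).1.toLp _‖ ≤ _
  rw [Lp.norm_toLp]
  exact ENNReal.toReal_le_of_le_ofReal (mul_nonneg hC (norm_nonneg _)) (hmem f).2

end FPU
end

noncomputable section

namespace FPU

open Real Set
open scoped ENNReal NNReal ComplexConjugate

/-! ### The quadratic form of the collision operator -/

lemma map_pb : resMeasure.map pb = resMeasure.map pa := by
  refine Measure.ext_of_lintegral _ fun φ hφ => ?_
  have h1 := measurable_pa
  rw [lintegral_map hφ measurable_pb, lintegral_map hφ measurable_pa,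
    ← lintegral_neg_swap (Φ := fun p => φ (pa p)) (by fun_prop)]
  simp only [pa_neg_swap]

lemma map_pd : resMeasure.map pd = resMeasure.map pc := by
  refine Measure.ext_of_lintegral _ fun φ hφ => ?_
  have h1 := measurable_pc
  rw [lintegral_map hφ measurable_pd, lintegral_map hφ measurable_pc,
    ← lintegral_swap (Φ := fun p => φ (pc p)) (by fun_prop)]
  simp only [pc_swap]

lemma map_pa_le : resMeasure.map pa ≤ VMeasure := by
  rw [VMeasure_eq]; exact Measure.le_add_right le_rfl

lemma map_pc_le : resMeasure.map pc ≤ VMeasure := by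
  rw [VMeasure_eq]; exact Measure.le_add_left le_rfl

lemma memLp_comp_pa {E : Type*} [NormedAddCommGroup E] {F : ℝ → E} (hF : MemLp F 2 VMeasure) :
    MemLp (fun p => F (pa p)) 2 resMeasure :=
  (hF.mono_measure map_pa_le).comp_of_map measurable_pa.aemeasurable

lemma memLp_comp_pb {E : Type*} [NormedAddCommGroup E] {F : ℝ → E} (hF : MemLp F 2 VMeasure) :
    MemLp (fun p => F (pb p)) 2 resMeasure :=
  (hF.mono_measure (map_pb.trans_le map_pa_le)).comp_of_map measurable_pb.aemeasurable

lemma memLp_comp_pc {E : Type*} [NormedAddCommGroup E] {F : ℝ → E} (hF : MemLp F 2 VMeasure) :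
    MemLp (fun p => F (pc p)) 2 resMeasure :=
  (hF.mono_measure map_pc_le).comp_of_map measurable_pc.aemeasurable

lemma memLp_comp_pd {E : Type*} [NormedAddCommGroup E] {F : ℝ → E} (hF : MemLp F 2 VMeasure) :
    MemLp (fun p => F (pd p)) 2 resMeasure :=
  (hF.mono_measure (map_pd.trans_le map_pc_le)).comp_of_map measurable_pd.aemeasurable

lemma integral_comp_swap {Ψ : ℝ × ℝ → ℝ} (hΨ : Measurable Ψ) :
    ∫ p, Ψ (p.2, p.1) ∂resMeasure = ∫ p, Ψ p ∂resMeasure := by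
  have : resMeasure.map (fun p : ℝ × ℝ => (p.2, p.1)) = resMeasure :=
    Measure.ext_of_lintegral _ fun φ hφ => by
      rw [lintegral_map hφ (by fun_prop), lintegral_swap hφ]
  conv_rhs => rw [← this]
  rw [integral_map (by fun_prop) hΨ.aestronglyMeasurable]

lemma integral_comp_neg_swap {Ψ : ℝ × ℝ → ℝ} (hΨ : Measurable Ψ) :
    ∫ p, Ψ (-p.2, -p.1) ∂resMeasure = ∫ p, Ψ p ∂resMeasure := by
  have : resMeasure.map (fun p : ℝ × ℝ => (-p.2, -p.1)) = resMeasure :=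
    Measure.ext_of_lintegral _ fun φ hφ => by
      rw [lintegral_map hφ (by fun_prop), lintegral_neg_swap hφ]
  conv_rhs => rw [← this]
  rw [integral_map (by fun_prop) hΨ.aestronglyMeasurable]

/-- The defect `F(a) + F(b) - F(c) - F(d)` on the resonant manifold. -/
def defect (F : ℝ → ℂ) (p : ℝ × ℝ) : ℂ := F (pa p) + F (pb p) - F (pc p) - F (pd p)

lemma integrable_re_mul {α : Type*} [MeasurableSpace α] {μ : Measure α} {X Y : α → ℂ}
    (hX : MemLp X 2 μ) (hY : MemLp Y 2 μ) : Integrable (fun a => (conj (X a) * Y a).re) μ :=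
  (hX.star.integrable_mul hY).re

lemma integrable_normSq {α : Type*} [MeasurableSpace α] {μ : Measure α} {X : α → ℂ}
    (hX : MemLp X 2 μ) : Integrable (fun a => Complex.normSq (X a)) μ := by
  simpa only [Complex.normSq_eq_norm_sq] using hX.integrable_norm_pow (p := 2) two_ne_zero

/-- Expand the square. The symmetries of the resonant measure identify the b and d terms with the a
and c terms, and make all four mixed products equal to the (a, c) one. What remains is the `V`
integral, the `K1` integral over (a, b) and (c, d), and four times the (a, c) product, which is
twice the `K2` integral. -/
theorem integral_normSq_defect {F : ℝ → ℂ} (hFm : Measurable F) (hF : MemLp F 2 VMeasure) :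
    ∫ x, Complex.normSq (F x) ∂VMeasure
      + ∫ q : ℝ × ℝ, (conj (F q.1) * F q.2).re ∂K1Measure
      - 2 * ∫ q : ℝ × ℝ, (conj (F q.1) * F q.2).re ∂K2Measure
      = 1 / 2 * ∫ p, Complex.normSq (defect F p) ∂resMeasure := by
  have ha := measurable_pa
  have hb := measurable_pb
  have hc := measurable_pc
  have hd := measurable_pd
  have hA := memLp_comp_pa hF
  have hB := memLp_comp_pb hF
  have hC := memLp_comp_pc hF
  have hD := memLp_comp_pd hF
  have hns : Measurable fun x => Complex.normSq (F x) := by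
    simp only [Complex.normSq_eq_norm_sq]; fun_prop
  have hre : Measurable fun q : ℝ × ℝ => (conj (F q.1) * F q.2).re := by fun_prop
  have hre2 : ∀ {f g : ℝ × ℝ → ℝ}, Measurable f → Measurable g →
      Measurable fun p => (conj (F (f p)) * F (g p)).re := fun hf hg => by fun_prop
  have iV : ∫ x, Complex.normSq (F x) ∂VMeasure = ∫ p, Complex.normSq (F (pa p)) ∂resMeasure
      + ∫ p, Complex.normSq (F (pc p)) ∂resMeasure := by
    rw [VMeasure_eq, integral_add_measure, integral_map ha.aemeasurable hns.aestronglyMeasurable,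
      integral_map hc.aemeasurable hns.aestronglyMeasurable]
    · exact (integrable_map_measure hns.aestronglyMeasurable ha.aemeasurable).2
        (integrable_normSq hA)
    · exact (integrable_map_measure hns.aestronglyMeasurable hc.aemeasurable).2
        (integrable_normSq hC)
  have i1 : ∫ q : ℝ × ℝ, (conj (F q.1) * F q.2).re ∂K1Measure
      = ∫ p, (conj (F (pa p)) * F (pb p)).re ∂resMeasure
      + ∫ p, (conj (F (pc p)) * F (pd p)).re ∂resMeasure := by
    rw [K1Measure_eq, integral_add_measure, integral_map (by fun_prop) hre.aestronglyMeasurable,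
      integral_map (by fun_prop) hre.aestronglyMeasurable]
    · exact (integrable_map_measure hre.aestronglyMeasurable (by fun_prop)).2
        (integrable_re_mul hA hB)
    · exact (integrable_map_measure hre.aestronglyMeasurable (by fun_prop)).2
        (integrable_re_mul hC hD)
  have i2 : ∫ q : ℝ × ℝ, (conj (F q.1) * F q.2).re ∂K2Measure
      = 2 * ∫ p, (conj (F (pa p)) * F (pc p)).re ∂resMeasure := by
    rw [K2Measure_eq, integral_add_measure, integral_map (by fun_prop) hre.aestronglyMeasurable,
      integral_map (by fun_prop) hre.aestronglyMeasurable, two_mul]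
    · congr 1
      refine integral_congr_ae (Eventually.of_forall fun p => ?_)
      simp only [Complex.mul_re, Complex.conj_re, Complex.conj_im]; ring
    · exact (integrable_map_measure hre.aestronglyMeasurable (by fun_prop)).2
        (integrable_re_mul hA hC)
    · exact (integrable_map_measure hre.aestronglyMeasurable (by fun_prop)).2
        (integrable_re_mul hC hA)
  have sB : ∫ p, Complex.normSq (F (pb p)) ∂resMeasure
      = ∫ p, Complex.normSq (F (pa p)) ∂resMeasure := by
    rw [← integral_comp_neg_swap (Ψ := fun p => Complex.normSq (F (pa p))) (hns.comp ha)]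
    simp only [pa_neg_swap]
  have sD : ∫ p, Complex.normSq (F (pd p)) ∂resMeasure
      = ∫ p, Complex.normSq (F (pc p)) ∂resMeasure := by
    rw [← integral_comp_swap (Ψ := fun p => Complex.normSq (F (pc p))) (hns.comp hc)]
    simp only [pc_swap]
  have sAD : ∫ p, (conj (F (pa p)) * F (pd p)).re ∂resMeasure
      = ∫ p, (conj (F (pa p)) * F (pc p)).re ∂resMeasure := by
    rw [← integral_comp_swap (hre2 ha hc)]
    simp only [pc_swap, pa_swap]
  have sBC : ∫ p, (conj (F (pb p)) * F (pc p)).re ∂resMeasure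
      = ∫ p, (conj (F (pa p)) * F (pc p)).re ∂resMeasure := by
    rw [← integral_comp_neg_swap (hre2 ha hc)]
    simp only [pc_neg_swap, pa_neg_swap]
  have sBD : ∫ p, (conj (F (pb p)) * F (pd p)).re ∂resMeasure
      = ∫ p, (conj (F (pa p)) * F (pc p)).re ∂resMeasure := by
    rw [← sAD, ← integral_comp_neg_swap (hre2 ha hd)]
    simp only [pd_neg_swap, pa_neg_swap]
  have hexp : ∀ p, Complex.normSq (defect F p) = Complex.normSq (F (pa p))
      + Complex.normSq (F (pb p)) + Complex.normSq (F (pc p)) + Complex.normSq (F (pd p))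
      + 2 * (conj (F (pa p)) * F (pb p)).re + 2 * (conj (F (pc p)) * F (pd p)).re
      - 2 * (conj (F (pa p)) * F (pc p)).re - 2 * (conj (F (pa p)) * F (pd p)).re
      - 2 * (conj (F (pb p)) * F (pc p)).re - 2 * (conj (F (pb p)) * F (pd p)).re := by
    intro p
    simp only [defect, Complex.normSq_apply, Complex.mul_re, Complex.conj_re, Complex.conj_im,
      Complex.add_re, Complex.add_im, Complex.sub_re, Complex.sub_im]
    ring
  have nA := integrable_normSq hA
  have nB := integrable_normSq hB
  have nC := integrable_normSq hC
  have nD := integrable_normSq hD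
  have rAB := (integrable_re_mul hA hB).const_mul 2
  have rCD := (integrable_re_mul hC hD).const_mul 2
  have rAC := (integrable_re_mul hA hC).const_mul 2
  have rAD := (integrable_re_mul hA hD).const_mul 2
  have rBC := (integrable_re_mul hB hC).const_mul 2
  have rBD := (integrable_re_mul hB hD).const_mul 2
  have s2 := nA.add nB
  have s3 := s2.add nC
  have s4 := s3.add nD
  have s5 := s4.add rAB
  have s6 := s5.add rCD
  have s7 := s6.sub rAC
  have s8 := s7.sub rAD
  have s9 := s8.sub rBC
  have htot : ∫ p, Complex.normSq (defect F p) ∂resMeasure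
      = ∫ p, Complex.normSq (F (pa p)) ∂resMeasure
      + ∫ p, Complex.normSq (F (pb p)) ∂resMeasure + ∫ p, Complex.normSq (F (pc p)) ∂resMeasure
      + ∫ p, Complex.normSq (F (pd p)) ∂resMeasure
      + 2 * ∫ p, (conj (F (pa p)) * F (pb p)).re ∂resMeasure
      + 2 * ∫ p, (conj (F (pc p)) * F (pd p)).re ∂resMeasure
      - 2 * ∫ p, (conj (F (pa p)) * F (pc p)).re ∂resMeasure
      - 2 * ∫ p, (conj (F (pa p)) * F (pd p)).re ∂resMeasure
      - 2 * ∫ p, (conj (F (pb p)) * F (pc p)).re ∂resMeasure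
      - 2 * ∫ p, (conj (F (pb p)) * F (pd p)).re ∂resMeasure := by
    refine (integral_congr_ae (Eventually.of_forall hexp)).trans ?_
    refine (integral_sub s9 rBD).trans ?_
    refine congrArg₂ _ ((integral_sub s8 rBC).trans ?_) (integral_const_mul _ _)
    refine congrArg₂ _ ((integral_sub s7 rAD).trans ?_) (integral_const_mul _ _)
    refine congrArg₂ _ ((integral_sub s6 rAC).trans ?_) (integral_const_mul _ _)
    refine congrArg₂ _ ((integral_add s5 rCD).trans ?_) (integral_const_mul _ _)
    refine congrArg₂ _ ((integral_add s4 rAB).trans ?_) (integral_const_mul _ _)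
    refine congrArg₂ _ ((integral_add s3 nD).trans (congrArg₂ _ ?_ rfl)) (integral_const_mul _ _)
    exact (integral_add s2 nC).trans (congrArg₂ _ (integral_add nA nB) rfl)
  rw [htot, iV, i1, i2, sB, sD, sAD, sBC, sBD]
  ring

lemma Admissible.memLp {p : ℝ → ℝ} {C : ℝ} (hp : Admissible p C) (f : L2) :
    MemLp (fun x => (p x : ℂ) * f x) 2 VMeasure := by
  have hpm := hp.measurable
  have hfm := L2_measurable f
  have hV := measurable_V
  have hm : Measurable fun x => (p x : ℂ) * f x := by fun_prop
  refine ⟨hm.aestronglyMeasurable, ?_⟩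
  rw [eLpNorm_lt_top_iff_lintegral_rpow_enorm_lt_top (by norm_num) (by norm_num)]
  simp only [ENNReal.toReal_ofNat, ENNReal.rpow_ofNat]
  rw [VMeasure, lintegral_withDensity_eq_lintegral_mul _ (by fun_prop) (by fun_prop)]
  calc _ ≤ ∫⁻ x, ENNReal.ofReal C * ‖f x‖ₑ ^ 2 ∂cellMeasure := by
        refine lintegral_mono_ae ?_
        filter_upwards [cell_ae] with x hx
        simp only [Pi.mul_apply]
        rw [enorm_mul, mul_pow, ← mul_assoc]
        gcongr
        rw [← ofReal_norm, Complex.norm_real, ← ENNReal.ofReal_pow (norm_nonneg _),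
          ← ENNReal.ofReal_mul (V_nonneg x), norm_eq_abs, sq_abs, mul_comm]
        exact ENNReal.ofReal_le_ofReal (hp.le x hx)
    _ < ⊤ := by
        rw [lintegral_const_mul' _ _ ENNReal.ofReal_ne_top, lintegral_L2_sq]
        exact ENNReal.mul_lt_top ENNReal.ofReal_lt_top ENNReal.ofReal_lt_top

lemma memLp_VMeasure_lintegral {F : ℝ → ℂ} (hFm : Measurable F) (hF : MemLp F 2 VMeasure) :
    ∫⁻ x, ENNReal.ofReal (V x) * ‖F x‖ₑ ^ 2 ∂cellMeasure < ⊤ := by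
  have h := hF.2
  rw [eLpNorm_lt_top_iff_lintegral_rpow_enorm_lt_top (by norm_num) (by norm_num)] at h
  simp only [ENNReal.toReal_ofNat, ENNReal.rpow_ofNat] at h
  rwa [VMeasure, lintegral_withDensity_eq_lintegral_mul _ measurable_V.ennreal_ofReal
    (by fun_prop)] at h

/-- The product |H(x)||F(y)| is at most |H(x)|² + |F(y)|², and each term integrates along rows or
columns to at most an integral against `V`. -/
lemma Dominated.integrable_prod {k : ℝ → ℝ → ℝ} (hk : Dominated k) {H F : ℝ → ℂ}
    (hHm : Measurable H) (hH : MemLp H 2 VMeasure) (hFm : Measurable F)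
    (hF : MemLp F 2 VMeasure) :
    Integrable (fun q : ℝ × ℝ => conj (H q.1) * ((k q.1 q.2 : ℂ) * F q.2))
      (cellMeasure.prod cellMeasure) := by
  have hkm := hk.measurable
  have hm : Measurable fun q : ℝ × ℝ => conj (H q.1) * ((k q.1 q.2 : ℂ) * F q.2) := by fun_prop
  have key : ∀ {G : ℝ → ℂ}, Measurable G → MemLp G 2 VMeasure →
      ∫⁻ x, ∫⁻ y, ‖G x‖ₑ ^ 2 * ‖k x y‖ₑ ∂cellMeasure ∂cellMeasure < ⊤ := fun {G} hGm hG => by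
    refine lt_of_le_of_lt (lintegral_mono_ae ?_) (memLp_VMeasure_lintegral hGm hG)
    filter_upwards [hk.row_le] with x hx
    have hkx : Measurable fun y => ‖k x y‖ₑ :=
      (hkm.comp (measurable_const.prodMk measurable_id)).enorm
    rw [lintegral_const_mul _ hkx, mul_comm]
    gcongr
  refine ⟨hm.aestronglyMeasurable, ?_⟩
  rw [hasFiniteIntegral_iff_enorm]
  have hle : ∀ q : ℝ × ℝ, ‖conj (H q.1) * ((k q.1 q.2 : ℂ) * F q.2)‖ₑ ≤
      ‖H q.1‖ₑ ^ 2 * ‖k q.1 q.2‖ₑ + ‖F q.2‖ₑ ^ 2 * ‖k q.1 q.2‖ₑ := fun q => by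
    rw [enorm_mul, enorm_mul, RCLike.enorm_conj, ← add_mul]
    have e : ‖(k q.1 q.2 : ℂ)‖ₑ = ‖k q.1 q.2‖ₑ := by simp [enorm]
    rw [e, mul_left_comm, mul_comm]
    gcongr
    rcases le_total ‖H q.1‖ₑ ‖F q.2‖ₑ with h | h
    · calc _ ≤ ‖F q.2‖ₑ * ‖F q.2‖ₑ := by gcongr
        _ ≤ _ := by rw [← sq]; exact le_add_self
    · calc _ ≤ ‖H q.1‖ₑ * ‖H q.1‖ₑ := by gcongr
        _ ≤ _ := by rw [← sq]; exact le_self_add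
  refine lt_of_le_of_lt (lintegral_mono hle) ?_
  rw [lintegral_add_left (by fun_prop), lintegral_prod _ (by fun_prop),
    lintegral_prod_symm _ (by fun_prop)]
  refine ENNReal.add_lt_top.2 ⟨key hHm hH, ?_⟩
  convert! key hFm hF using 6 with y x
  simp only [hk.comm]

lemma inner_L2_eq (f g : L2) : inner ℂ f g = ∫ x, conj (f x) * g x ∂cellMeasure := by
  rw [L2.inner_def]
  refine integral_congr_ae (Eventually.of_forall fun x => ?_)
  simp only [RCLike.inner_apply, mul_comm]

lemma inner_kernelOperator {k : ℝ → ℝ → ℝ} (hk : Dominated k) {p : ℝ → ℝ} {C : ℝ}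
    (hp : Admissible p C) {T : L2 →L[ℂ] L2} (hT : ∀ f : L2, T f =ᵐ[cellMeasure] kernelFun k p f)
    (h f : L2) : inner ℂ h (T f) = ∫ q : ℝ × ℝ, conj ((p q.1 : ℂ) * h q.1) *
      ((k q.1 q.2 : ℂ) * ((p q.2 : ℂ) * f q.2)) ∂(cellMeasure.prod cellMeasure) := by
  have hpm := hp.measurable
  have hfm := L2_measurable f
  have hhm := L2_measurable h
  rw [inner_L2_eq, integral_prod _ (hk.integrable_prod (H := fun x => (p x : ℂ) * h x)
    (F := fun x => (p x : ℂ) * f x) (by fun_prop) (hp.memLp h) (by fun_prop) (hp.memLp f))]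
  refine integral_congr_ae ?_
  filter_upwards [hT f] with x hx
  rw [hx, kernelFun, integral_const_mul, map_mul, Complex.conj_ofReal]
  ring

lemma kernelOperator_symm {k : ℝ → ℝ → ℝ} (hk : Dominated k) {p : ℝ → ℝ} {C : ℝ}
    (hp : Admissible p C) {T : L2 →L[ℂ] L2} (hT : ∀ f : L2, T f =ᵐ[cellMeasure] kernelFun k p f)
    (h f : L2) : inner ℂ (T h) f = inner ℂ h (T f) := by
  rw [← inner_conj_symm, inner_kernelOperator hk hp hT, inner_kernelOperator hk hp hT,
    ← integral_conj, ← integral_prod_swap]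
  refine integral_congr_ae (Eventually.of_forall fun q => ?_)
  simp only [Prod.fst_swap, Prod.snd_swap, map_mul, Complex.conj_conj, Complex.conj_ofReal,
    hk.comm q.2 q.1]
  ring

lemma integral_K1Measure {Φ : ℝ × ℝ → ℝ} :
    ∫ q, Φ q ∂K1Measure = ∫ q, K1 q.1 q.2 * Φ q ∂(cellMeasure.prod cellMeasure) := by
  rw [K1Measure, integral_withDensity_eq_integral_toReal_smul
    (by have := measurable_K1; fun_prop) (Eventually.of_forall fun q => ENNReal.ofReal_lt_top)]
  simp only [ENNReal.toReal_ofReal (K1_nonneg _ _), smul_eq_mul]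

lemma integral_K2Measure {Φ : ℝ × ℝ → ℝ} :
    ∫ q, Φ q ∂K2Measure = ∫ q, K2 q.1 q.2 * Φ q ∂(cellMeasure.prod cellMeasure) := by
  rw [K2Measure, integral_withDensity_eq_integral_toReal_smul
    (by have := measurable_K2; fun_prop) (Eventually.of_forall fun q => ENNReal.ofReal_lt_top)]
  simp only [ENNReal.toReal_ofReal (K2_nonneg _ _), smul_eq_mul]

lemma integral_VMeasure {Φ : ℝ → ℝ} :
    ∫ x, Φ x ∂VMeasure = ∫ x, V x * Φ x ∂cellMeasure := by
  rw [VMeasure, integral_withDensity_eq_integral_toReal_smul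
    (by have := measurable_V; fun_prop) (Eventually.of_forall fun q => ENNReal.ofReal_lt_top)]
  simp only [ENNReal.toReal_ofReal (V_nonneg _), smul_eq_mul]

lemma inner_multiplication {M : L2 →L[ℂ] L2} {m : ℝ → ℝ} (hM : IsMultiplication M m) (h f : L2) :
    inner ℂ h (M f) = ∫ x, (m x : ℂ) * (conj (h x) * f x) ∂cellMeasure := by
  rw [inner_L2_eq]
  refine integral_congr_ae ?_
  filter_upwards [hM f] with x hx
  rw [hx]; ring

lemma multiplication_symm {M : L2 →L[ℂ] L2} {m : ℝ → ℝ} (hM : IsMultiplication M m) (h f : L2) :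
    inner ℂ (M h) f = inner ℂ h (M f) := by
  rw [← inner_conj_symm, inner_multiplication hM, inner_multiplication hM, ← integral_conj]
  refine integral_congr_ae (Eventually.of_forall fun q => ?_)
  simp only [map_mul, Complex.conj_conj, Complex.conj_ofReal]
  ring

/-- The weighted collision operator `p L p` for a general weight `p`, split into its parts. -/
structure IsCollision (p : ℝ → ℝ) (T M T1 T2 : L2 →L[ℂ] L2) : Prop where
  mult : IsMultiplication M fun x => p x ^ 2 * V x
  fst : ∀ f : L2, T1 f =ᵐ[cellMeasure] kernelFun K1 p f
  snd : ∀ f : L2, T2 f =ᵐ[cellMeasure] kernelFun K2 p f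
  eq : T = M + T1 - (2 : ℂ) • T2

theorem exists_isCollision {p : ℝ → ℝ} {C : ℝ} (hp : Admissible p C)
    (hp0 : ∀ x ∈ Ioo 0 (2 * π), p x ≠ 0) :
    ∃ T M T1 T2 : L2 →L[ℂ] L2, IsCollision p T M T1 T2 := by
  have hpm := hp.measurable
  have hV := measurable_V
  obtain ⟨M, hM⟩ := exists_multiplication (m := fun x => p x ^ 2 * V x) (by fun_prop)
    hp.nonneg_const (fun x hx => by
      rw [abs_of_nonneg (mul_nonneg (sq_nonneg _) (V_nonneg x))]; exact hp.le x hx)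
  obtain ⟨T1, h1⟩ := exists_kernelOperator dominated_K1 hp hp0
  obtain ⟨T2, h2⟩ := exists_kernelOperator dominated_K2 hp hp0
  exact ⟨_, M, T1, T2, hM, h1, h2, rfl⟩

lemma IsCollision.symm {p : ℝ → ℝ} {C : ℝ} (hp : Admissible p C) {T M T1 T2 : L2 →L[ℂ] L2}
    (h : IsCollision p T M T1 T2) (f g : L2) : inner ℂ (T f) g = inner ℂ f (T g) := by
  rw [h.eq]
  simp only [sub_apply, add_apply, smul_apply, inner_sub_left,
    inner_sub_right, inner_add_left, inner_add_right, inner_smul_left, inner_smul_right,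
    multiplication_symm h.mult, kernelOperator_symm dominated_K1 hp h.fst,
    kernelOperator_symm dominated_K2 hp h.snd, map_ofNat]

/-- Only the product p f enters the right side. This later allows a bound obtained with one weight
to be transferred to another. -/
theorem IsCollision.re_inner {p : ℝ → ℝ} {C : ℝ} (hp : Admissible p C) {T M T1 T2 : L2 →L[ℂ] L2}
    (h : IsCollision p T M T1 T2) (f : L2) :
    (inner ℂ f (T f)).re
      = 1 / 2 * ∫ q, Complex.normSq (defect (fun x => (p x : ℂ) * f x) q) ∂resMeasure := by
  have hpm := hp.measurable
  have hfm := L2_measurable f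
  have hFm : Measurable fun x => (p x : ℂ) * f x := by fun_prop
  have hF := hp.memLp f
  rw [← integral_normSq_defect hFm hF, integral_K1Measure, integral_K2Measure, integral_VMeasure,
    h.eq, sub_apply, add_apply, smul_apply, inner_sub_right, inner_add_right, inner_smul_right,
    inner_multiplication h.mult, inner_kernelOperator dominated_K1 hp h.fst,
    inner_kernelOperator dominated_K2 hp h.snd, Complex.sub_re, Complex.add_re]
  have e0 : (∫ x, ((p x ^ 2 * V x : ℝ) : ℂ) * (conj (f x) * f x) ∂cellMeasure).re
      = ∫ x, V x * Complex.normSq ((p x : ℂ) * f x) ∂cellMeasure := by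
    refine Eq.trans (congrArg Complex.re ?_) (Complex.ofReal_re
      (∫ x, V x * Complex.normSq ((p x : ℂ) * f x) ∂cellMeasure))
    refine Eq.trans ?_ integral_ofReal
    refine integral_congr_ae (Eventually.of_forall fun x => ?_)
    simp only [RCLike.ofReal_eq_complex_ofReal]
    rw [← Complex.normSq_eq_conj_mul_self, Complex.normSq_mul, Complex.normSq_ofReal]
    push_cast; ring
  have e1 : ∀ {k : ℝ → ℝ → ℝ}, Dominated k → (∫ q : ℝ × ℝ, conj ((p q.1 : ℂ) * f q.1) *
      ((k q.1 q.2 : ℂ) * ((p q.2 : ℂ) * f q.2)) ∂(cellMeasure.prod cellMeasure)).re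
      = ∫ q : ℝ × ℝ, k q.1 q.2 * (conj ((p q.1 : ℂ) * f q.1) * ((p q.2 : ℂ) * f q.2)).re
        ∂(cellMeasure.prod cellMeasure) := fun {k} hk => by
    have := integral_re (𝕜 := ℂ) (hk.integrable_prod hFm hF hFm hF)
    simp only [RCLike.re_to_complex] at this
    rw [← this]
    congr 1; ext q
    rw [mul_left_comm, Complex.re_ofReal_mul]
  rw [e0, e1 dominated_K1, show (2 : ℂ) = ((2 : ℝ) : ℂ) by norm_num, Complex.re_ofReal_mul,
    e1 dominated_K2]

end FPU
end

noncomputable section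

namespace FPU

open Real Set
open scoped ENNReal NNReal ComplexConjugate

/-! ### Well-posedness of the weighted operator and its resolvent -/

lemma admissible_of_rpow {p : ℝ → ℝ} (hp : Measurable p) {r t : ℝ} (hr : 0 ≤ 2 * r + t) {C : ℝ}
    (hC : 0 ≤ C) (hpr : ∀ x ∈ Ioo 0 (2 * π), p x = dispersion x ^ r)
    (hV : ∀ x ∈ Ioo 0 (2 * π), V x ≤ C * dispersion x ^ t) : Admissible p C where
  measurable := hp
  nonneg_const := hC
  le x hx := by
    have hs := dispersion_pos hx
    rw [hpr x hx, ← rpow_natCast, ← rpow_mul hs.le]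
    calc dispersion x ^ (r * (2 : ℕ)) * V x
        ≤ dispersion x ^ (r * (2 : ℕ)) * (C * dispersion x ^ t) := by gcongr; exact hV x hx
      _ = C * dispersion x ^ (2 * r + t) := by
        rw [mul_left_comm, ← rpow_add hs]; congr 2; push_cast; ring
      _ ≤ C * 1 := by
        gcongr; exact rpow_le_one hs.le (dispersion_le_one x) hr
      _ = C := mul_one C

lemma exists_admissible_dispersion : ∃ C : ℝ, Admissible dispersion C := by
  obtain ⟨C, hC, hV⟩ := exists_V_le
  exact ⟨C, admissible_of_rpow measurable_dispersion (r := 1) (by norm_num) hC.le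
    (fun x _ => (rpow_one _).symm) hV⟩

lemma dispersion_ne_zero {x : ℝ} (hx : x ∈ Ioo 0 (2 * π)) : dispersion x ≠ 0 :=
  (dispersion_pos hx).ne'

lemma IsCollision.coeFn {p : ℝ → ℝ} {T M T1 T2 : L2 →L[ℂ] L2} (h : IsCollision p T M T1 T2)
    (f : L2) : T f =ᵐ[cellMeasure] fun x => (p x : ℂ) * collision (fun y => (p y : ℂ) * f y) x := by
  rw [h.eq]
  change ((M f + T1 f - (2 : ℂ) • T2 f : L2) : ℝ → ℂ) =ᵐ[cellMeasure] _
  filter_upwards [Lp.coeFn_sub (M f + T1 f) ((2 : ℂ) • T2 f), Lp.coeFn_add (M f) (T1 f),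
    Lp.coeFn_smul (2 : ℂ) (T2 f), h.mult f, h.fst f, h.snd f] with x h1 h2 h3 h4 h5 h6
  rw [h1, Pi.sub_apply, h2, Pi.add_apply, h3, Pi.smul_apply, h4, h5, h6, kernelFun, kernelFun,
    collision, smul_eq_mul]
  push_cast
  ring

lemma IsCollision.isWeightedCollision {T M T1 T2 : L2 →L[ℂ] L2}
    (h : IsCollision dispersion T M T1 T2) : IsWeightedCollision T := fun f => by
  obtain ⟨C, hC⟩ := exists_admissible_dispersion
  refine ⟨?_, h.coeFn f⟩
  filter_upwards [dominated_K1.ae_integrable hC (fun _ => dispersion_ne_zero) f,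
    dominated_K2.ae_integrable hC (fun _ => dispersion_ne_zero) f] with x h1 h2
  exact ⟨h1, h2⟩

lemma IsWeightedCollision.unique {T T' : L2 →L[ℂ] L2} (h : IsWeightedCollision T)
    (h' : IsWeightedCollision T') : T = T' :=
  ContinuousLinearMap.ext fun f => Lp.ext ((h f).2.trans (h' f).2.symm)

lemma IsMultiplication.unique {M M' : L2 →L[ℂ] L2} {m : ℝ → ℝ} (h : IsMultiplication M m)
    (h' : IsMultiplication M' m) : M = M' :=
  ContinuousLinearMap.ext fun f => Lp.ext ((h f).trans (h' f).symm)

theorem exists_isCollision_dispersion :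
    ∃ T M T1 T2 : L2 →L[ℂ] L2, IsCollision dispersion T M T1 T2 := by
  obtain ⟨C, hC⟩ := exists_admissible_dispersion
  exact exists_isCollision hC fun _ => dispersion_ne_zero

theorem existsUnique_isWeightedCollision : ∃! T : L2 →L[ℂ] L2, IsWeightedCollision T := by
  obtain ⟨T, M, T1, T2, h⟩ := exists_isCollision_dispersion
  exact ⟨T, h.isWeightedCollision, fun T' h' => h'.unique h.isWeightedCollision⟩

theorem existsUnique_isMultiplication_W : ∃! M : L2 →L[ℂ] L2, IsMultiplication M W := by
  obtain ⟨T, M, T1, T2, h⟩ := exists_isCollision_dispersion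
  exact ⟨M, h.mult, fun T' h' => IsMultiplication.unique h' h.mult⟩

theorem IsWeightedCollision.exists_isCollision {T M : L2 →L[ℂ] L2} (hT : IsWeightedCollision T)
    (hM : IsMultiplication M W) : ∃ T1 T2 : L2 →L[ℂ] L2, IsCollision dispersion T M T1 T2 := by
  obtain ⟨T', M', T1, T2, h⟩ := exists_isCollision_dispersion
  obtain rfl := hT.unique h.isWeightedCollision
  obtain rfl := IsMultiplication.unique hM h.mult
  exact ⟨T1, T2, h⟩

/-- A symmetric nonnegative operator on `L²(I)`. -/
structure IsNonneg (T : L2 →L[ℂ] L2) : Prop where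
  symm : ∀ f g : L2, inner ℂ (T f) g = inner ℂ f (T g)
  nonneg : ∀ f : L2, 0 ≤ (inner ℂ f (T f)).re

lemma IsCollision.isNonneg {p : ℝ → ℝ} {C : ℝ} (hp : Admissible p C) {T M T1 T2 : L2 →L[ℂ] L2}
    (h : IsCollision p T M T1 T2) : IsNonneg T where
  symm := h.symm hp
  nonneg f := by
    rw [h.re_inner hp]
    exact mul_nonneg (by norm_num) (integral_nonneg fun _ => Complex.normSq_nonneg _)

lemma inner_self_multiplication {M : L2 →L[ℂ] L2} {m : ℝ → ℝ} (hM : IsMultiplication M m) (f : L2) :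
    inner ℂ f (M f) = ((∫ x, m x * ‖f x‖ ^ 2 ∂cellMeasure : ℝ) : ℂ) := by
  rw [inner_multiplication hM]
  refine Eq.trans ?_ integral_ofReal
  refine integral_congr_ae (Eventually.of_forall fun x => ?_)
  simp only [RCLike.ofReal_eq_complex_ofReal]
  rw [Complex.conj_mul']
  push_cast; ring

lemma isNonneg_multiplication {M : L2 →L[ℂ] L2} {m : ℝ → ℝ} (hM : IsMultiplication M m)
    (hm : ∀ x, 0 ≤ m x) : IsNonneg M where
  symm := multiplication_symm hM
  nonneg f := by
    rw [inner_self_multiplication hM, Complex.ofReal_re]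
    exact integral_nonneg fun x => mul_nonneg (hm x) (sq_nonneg _)

lemma W_nonneg (x : ℝ) : 0 ≤ W x := mul_nonneg (sq_nonneg _) (V_nonneg x)

/-! ### Resolvents of symmetric nonnegative operators. -/

section Resolvent

variable {T : L2 →L[ℂ] L2}

lemma shift_apply (s : ℝ) (T : L2 →L[ℂ] L2) (f : L2) : shift s T f = (s : ℂ) • f + T f := rfl

lemma re_inner_shift (s : ℝ) (T : L2 →L[ℂ] L2) (f : L2) :
    (inner ℂ f (shift s T f)).re = s * ‖f‖ ^ 2 + (inner ℂ f (T f)).re := by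
  rw [shift_apply, inner_add_right, inner_smul_right, Complex.add_re, Complex.re_ofReal_mul,
    inner_self_eq_norm_sq_to_K]
  simp [← Complex.ofReal_pow]

/-- The form of s + T is coercive with constant s, and a coercive bounded operator is invertible. -/
lemma IsNonneg.isUnit_shift (hT : IsNonneg T) {s : ℝ} (hs : 0 < s) : IsUnit (shift s T) := by
  refine ContinuousLinearMap.isUnit_of_forall_le_norm_inner_map _ (c := s.toNNReal)
    (by simpa using hs) fun f => ?_
  rw [coe_toNNReal _ hs.le]
  calc ‖f‖ ^ 2 * s ≤ (inner ℂ f (shift s T f)).re := by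
        rw [re_inner_shift]; linarith [hT.nonneg f]
    _ ≤ ‖inner ℂ f (shift s T f)‖ := Complex.re_le_norm _
    _ = _ := norm_inner_symm _ _

lemma IsNonneg.shift_shiftInv (hT : IsNonneg T) {s : ℝ} (hs : 0 < s) (f : L2) :
    shift s T (shiftInv s T f) = f := by
  have h := Ring.mul_inverse_cancel _ (hT.isUnit_shift hs)
  exact congrArg (fun A : L2 →L[ℂ] L2 => A f) h

lemma IsNonneg.shiftInv_shift (hT : IsNonneg T) {s : ℝ} (hs : 0 < s) (f : L2) :
    shiftInv s T (shift s T f) = f := by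
  have h := Ring.inverse_mul_cancel _ (hT.isUnit_shift hs)
  exact congrArg (fun A : L2 →L[ℂ] L2 => A f) h

lemma IsNonneg.shiftInv_symm (hT : IsNonneg T) {s : ℝ} (hs : 0 < s) (f g : L2) :
    inner ℂ (shiftInv s T f) g = inner ℂ f (shiftInv s T g) := by
  conv_lhs => rw [← hT.shift_shiftInv hs g]
  conv_rhs => rw [← hT.shift_shiftInv hs f]
  rw [shift_apply, shift_apply, inner_add_left, inner_add_right, inner_smul_left, inner_smul_right,
    hT.symm, Complex.conj_ofReal]

lemma IsNonneg.shiftInv_im (hT : IsNonneg T) {s : ℝ} (hs : 0 < s) (f : L2) :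
    (inner ℂ f (shiftInv s T f)).im = 0 := by
  have h := inner_conj_symm (𝕜 := ℂ) f (shiftInv s T f)
  rw [hT.shiftInv_symm hs] at h
  exact Complex.conj_eq_iff_im.1 h

/-- By symmetry of the resolvent, ⟨f, z⟩ = ⟨z, (s + T)z⟩ for z = (s + T)⁻¹f. Strict positivity of R
and the form bound on odd functions both start from this. -/
lemma IsNonneg.re_inner_shiftInv (hT : IsNonneg T) {s : ℝ} (hs : 0 < s) (f : L2) :
    (inner ℂ f (shiftInv s T f)).re
      = s * ‖shiftInv s T f‖ ^ 2 + (inner ℂ (shiftInv s T f) (T (shiftInv s T f))).re := by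
  rw [← re_inner_shift, hT.shift_shiftInv hs, hT.shiftInv_symm hs]

lemma IsNonneg.re_inner_shiftInv_pos (hT : IsNonneg T) {s : ℝ} (hs : 0 < s) {f : L2} (hf : f ≠ 0) :
    0 < (inner ℂ f (shiftInv s T f)).re := by
  rw [hT.re_inner_shiftInv hs]
  have : shiftInv s T f ≠ 0 := fun h => hf (by
    rw [← hT.shift_shiftInv hs f, h, map_zero])
  have := hT.nonneg (shiftInv s T f)
  positivity

/-- The second resolvent identity. -/
lemma shiftInv_sub_shiftInv {M : L2 →L[ℂ] L2} (hT : IsNonneg T) (hM : IsNonneg M) {s : ℝ}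
    (hs : 0 < s) (f : L2) :
    shiftInv s T f = shiftInv s M f + shiftInv s M ((M - T) (shiftInv s T f)) := by
  set z := shiftInv s T f with hz
  have h1 : f = shift s T z := (hT.shift_shiftInv hs f).symm
  have h2 : f + (M - T) z = shift s M z := by
    rw [h1, shift_apply, shift_apply, sub_apply]; abel
  rw [← map_add, h2, hM.shiftInv_shift hs]

lemma shiftInv_sub_shiftInv' {M : L2 →L[ℂ] L2} (hT : IsNonneg T) (hM : IsNonneg M) {s : ℝ}
    (hs : 0 < s) (f : L2) :
    shiftInv s T f = shiftInv s M f + shiftInv s T ((M - T) (shiftInv s M f)) := by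
  set z := shiftInv s M f with hz
  have h1 : f = shift s M z := (hM.shift_shiftInv hs f).symm
  have h2 : shift s T z + (M - T) z = f := by
    rw [h1, shift_apply, shift_apply, sub_apply]; abel
  rw [← h2, map_add, hT.shiftInv_shift hs]

/-- The resolvent of a multiplication operator is a multiplication operator. -/
lemma shiftInv_multiplication {M : L2 →L[ℂ] L2} {m : ℝ → ℝ} (hM : IsMultiplication M m)
    (hm : ∀ x, 0 ≤ m x) {s : ℝ} (hs : 0 < s) : IsMultiplication (shiftInv s M) fun x => 1 / (s + m x) := by
  intro f
  have h := (isNonneg_multiplication hM hm).shift_shiftInv hs f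
  set z := shiftInv s M f
  have h2 : shift s M z =ᵐ[cellMeasure] f := by rw [h]
  rw [shift_apply] at h2
  filter_upwards [h2, Lp.coeFn_add ((s : ℂ) • z) (M z), Lp.coeFn_smul (s : ℂ) z, hM z]
    with x h3 h4 h5 h6
  rw [h4, Pi.add_apply, h5, h6, Pi.smul_apply, smul_eq_mul] at h3
  have h7 : ((s + m x : ℝ) : ℂ) ≠ 0 := by
    exact_mod_cast (by linarith [hm x] : (0 : ℝ) < s + m x).ne'
  rw [← h3]
  push_cast at h7 ⊢
  field_simp

end Resolvent

/-! ### The velocity as a vector of L²(I). -/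

lemma velocity_reflect {x : ℝ} (hx : x ∈ Ioo 0 (2 * π)) : velocity (2 * π - x) = -velocity x := by
  rw [velocity_eq hx, velocity_eq (reflect_mem.2 hx), show (2 * π - x) / 2 = π - x / 2 by ring,
    cos_pi_sub]
  ring

lemma velocityL2_coeFn : velocityL2 =ᵐ[cellMeasure] fun x => (velocity x : ℂ) :=
  memLp_velocity.coeFn_toLp

/-- In the open cell cos(x/2) vanishes only at π, and the cell without that point is not null. -/
lemma velocityL2_ne_zero : velocityL2 ≠ 0 := by
  intro h
  have h1 := velocityL2_coeFn
  rw [h] at h1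
  have h2 : ∀ᵐ x ∂cellMeasure, x = π := by
    filter_upwards [h1, Lp.coeFn_zero ℂ 2 cellMeasure, cell_ae] with x h3 h4 hx
    rw [h4, velocity_eq hx, Pi.zero_apply] at h3
    have h5 : cos (x / 2) = 0 := by
      have : ((cos (x / 2) / 2 : ℝ) : ℂ) = 0 := h3.symm
      have := Complex.ofReal_eq_zero.1 this
      linarith
    have h6 : x / 2 = π / 2 := by
      refine injOn_cos ⟨by linarith [hx.1], by linarith [hx.2]⟩ ⟨by positivity, by linarith [pi_pos]⟩ ?_
      rw [h5, cos_pi_div_two]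
    linarith
  rw [cellMeasure_eq_Ioo] at h2
  have h3 : volume (Ioo 0 (2 * π) \ {π}) = 0 := by
    rw [ae_iff, Measure.restrict_apply' measurableSet_Ioo] at h2
    rw [← h2]; congr 1; ext x; simp [and_comm]
  have h4 : volume (Ioo 0 (2 * π)) = 0 := by
    rw [← measure_sdiff_null (Real.volume_singleton (a := π)) , h3]
  simp at h4
  linarith [pi_pos]

end FPU
end

noncomputable section

namespace FPU

open Real Set
open scoped ENNReal NNReal

/-! ### The constants -/

/-- The integrand is at most s^(-1/2) near 0 and at most s^(-2) near infinity. -/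
lemma integrableOn_w0 : IntegrableOn (fun s : ℝ => 1 / √(2 * s + s ^ 4)) (Ioi 0) := by
  have hm : ∀ S : Set ℝ, AEStronglyMeasurable (fun s : ℝ => 1 / √(2 * s + s ^ 4))
    (volume.restrict S) := fun S =>
    Measurable.aestronglyMeasurable (by fun_prop)
  have h1 : IntegrableOn (fun s : ℝ => 1 / √(2 * s + s ^ 4)) (Ioc 0 1) := by
    have h := (intervalIntegral.intervalIntegrable_rpow' (r := -(1 / 2)) (a := 0) (b := 1)
      (by norm_num))
    rw [intervalIntegrable_iff_integrableOn_Ioc_of_le zero_le_one] at h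
    refine h.mono' (hm _) ((ae_restrict_mem measurableSet_Ioc).mono fun s hs => ?_)
    rw [norm_of_nonneg (by positivity), rpow_neg hs.1.le, ← sqrt_eq_rpow, one_div]
    have := hs.1
    gcongr
    nlinarith [pow_pos this 4]
  have h2 : IntegrableOn (fun s : ℝ => 1 / √(2 * s + s ^ 4)) (Ioi 1) := by
    have h := integrableOn_Ioi_rpow_of_lt (a := -2) (c := 1) (by norm_num) one_pos
    refine h.mono' (hm _) ((ae_restrict_mem measurableSet_Ioi).mono fun s hs => ?_)
    have hs0 : (0 : ℝ) < s := one_pos.trans hs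
    rw [norm_of_nonneg (by positivity), rpow_neg hs0.le, one_div]
    gcongr
    refine le_sqrt_of_sq_le ?_
    norm_cast
    nlinarith
  rw [← Ioc_union_Ioi_eq_Ioi zero_le_one]
  exact h1.union h2

lemma w0_pos : 0 < w0 := by
  refine mul_pos four_pos ?_
  rw [setIntegral_pos_iff_support_of_nonneg_ae (Eventually.of_forall fun s => by positivity)
    integrableOn_w0]
  have : Ioi (0 : ℝ) ⊆ (Function.support fun s : ℝ => 1 / √(2 * s + s ^ 4)) := fun s hs => by
    have hs : (0 : ℝ) < s := hs
    exact (by positivity : (0 : ℝ) < 1 / √(2 * s + s ^ 4)).ne'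
  rw [inter_eq_right.2 this]
  simp

lemma integrableOn_c0 {c : ℝ} (hc : 0 < c) :
    IntegrableOn (fun s : ℝ => 1 / (1 + c * s ^ (5 / 3 : ℝ))) (Ioi 0) := by
  have hm : ∀ S : Set ℝ, AEStronglyMeasurable (fun s : ℝ => 1 / (1 + c * s ^ (5 / 3 : ℝ)))
    (volume.restrict S) := fun S =>
    Measurable.aestronglyMeasurable (by fun_prop)
  have h1 : IntegrableOn (fun s : ℝ => 1 / (1 + c * s ^ (5 / 3 : ℝ))) (Ioc 0 1) := by
    refine Measure.integrableOn_of_bounded (M := 1) (by simp)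
      (Measurable.aestronglyMeasurable (by fun_prop)) ((ae_restrict_mem measurableSet_Ioc).mono fun s hs => ?_)
    have := hs.1
    rw [norm_of_nonneg (by positivity)]
    exact div_le_one_of_le₀ (by linarith [(by positivity : 0 ≤ c * s ^ (5 / 3 : ℝ))]) (by positivity)
  have h2 : IntegrableOn (fun s : ℝ => 1 / (1 + c * s ^ (5 / 3 : ℝ))) (Ioi 1) := by
    have h := (integrableOn_Ioi_rpow_of_lt (a := -(5 / 3)) (c := 1) (by norm_num) one_pos).const_mul
      c⁻¹
    refine h.mono' (hm _) ((ae_restrict_mem measurableSet_Ioi).mono fun s hs => ?_)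
    have hs0 : (0 : ℝ) < s := one_pos.trans hs
    rw [norm_of_nonneg (by positivity), rpow_neg hs0.le, one_div, ← mul_inv]
    gcongr
    linarith
  rw [← Ioc_union_Ioi_eq_Ioi zero_le_one]
  exact h1.union h2

lemma c0_pos : 0 < c0 := by
  have hw := w0_pos
  have hp : ∀ s ∈ Ioi (0 : ℝ), 0 < 1 / (1 + w0 * s ^ (5 / 3 : ℝ)) := fun s hs => by
    have hs : (0 : ℝ) < s := hs
    positivity
  rw [c0, setIntegral_pos_iff_support_of_nonneg_ae
    ((ae_restrict_mem measurableSet_Ioi).mono fun s hs => (hp s hs).le) (integrableOn_c0 hw)]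
  have : Ioi (0 : ℝ) ⊆ (Function.support fun s : ℝ => 1 / (1 + w0 * s ^ (5 / 3 : ℝ))) :=
    fun s hs => (hp s hs).ne'
  rw [inter_eq_right.2 this]
  simp

/-! ### The asymptotics of `V` at the ends of the cell -/

lemma Fplus_end (α γ : ℝ) : Fplus (2 * α) (2 * π - 2 * γ) = (cos α - cos γ) ^ 2 + 4 * sin α * sin γ := by
  rw [Fplus, show 2 * α / 2 = α by ring, show (2 * π - 2 * γ) / 2 = π - γ by ring, cos_pi_sub,
    sin_pi_sub]
  ring

/-- The difference is 2 sin((γ+α)/2) sin((γ-α)/2); both factors are bounded below by Jordan's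
inequality, using γ - α ≥ γ/2. -/
lemma cos_sub_cos_ge {α γ : ℝ} (hα0 : 0 < α) (h : 2 * α ≤ γ) (hγ2 : γ ≤ 2 * π / 3) :
    γ ^ 2 / π ^ 2 ≤ cos α - cos γ := by
  have hγ0 : 0 < γ := by linarith
  have hpi := pi_pos
  have h1 : 2 / π * ((γ + α) / 2) ≤ sin ((γ + α) / 2) := mul_le_sin (by linarith) (by linarith)
  have h2 : 2 / π * ((γ - α) / 2) ≤ sin ((γ - α) / 2) := mul_le_sin (by linarith) (by linarith)
  rw [cos_sub_cos, ← neg_sub γ α, neg_div, sin_neg, add_comm α γ]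
  calc γ ^ 2 / π ^ 2 = 2 * (2 / π * (γ / 2)) * (2 / π * (γ / 4)) := by field_simp; norm_num
    _ ≤ 2 * sin ((γ + α) / 2) * sin ((γ - α) / 2) := by
      have e1 : 2 / π * (γ / 2) ≤ sin ((γ + α) / 2) := le_trans (by gcongr; linarith) h1
      have e2 : 2 / π * (γ / 4) ≤ sin ((γ - α) / 2) :=
        le_trans (mul_le_mul_of_nonneg_left (by linarith) (by positivity)) h2
      have e3 : 0 ≤ 2 / π * (γ / 2) := by positivity
      exact mul_le_mul (by linarith) e2 (by positivity) (by linarith)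
    _ = _ := by ring

/-- A uniform form of F₊ ≳ αγ + γ⁴ near the corner, which supplies the dominating function for the
limit of `V`. The term αγ always comes from the sines. The term γ⁴ comes from αγ when γ ≤ 2α, and
from the cosine difference when γ ≥ 2α. The constant is not optimised. -/
lemma Fplus_end_ge {α γ : ℝ} (hα : α ∈ Ioc 0 (π / 2)) (hγ : γ ∈ Ioo 0 π) :
    α * γ + γ ^ 4 ≤ 1088 * ((cos α - cos γ) ^ 2 + 4 * sin α * sin γ) := by
  obtain ⟨hα0, hα1⟩ := hα
  obtain ⟨hγ0, hγ1⟩ := hγ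
  have hpi := pi_pos
  have hpi3 := pi_gt_three
  have hpi4 : π ≤ 3.2 := by linarith [pi_lt_d2]
  have hsα : 2 / π * α ≤ sin α := mul_le_sin hα0.le hα1
  have hsγ0 : 0 < sin γ := sin_pos_of_pos_of_lt_pi hγ0 hγ1
  have hsα0 : 0 < sin α := sin_pos_of_pos_of_lt_pi hα0 (by linarith)
  -- For γ beyond 2π/3 the sine of γ degenerates, but there the cosine difference is at least 1/2
  -- and the left side is bounded.
  rcases le_or_gt γ (2 * π / 3) with hγ2 | hγ2
  · have hsγ : γ / π ≤ sin γ := by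
      rcases le_total γ (π / 2) with h | h
      · refine le_trans ?_ (mul_le_sin hγ0.le h)
        rw [div_mul_eq_mul_div]; gcongr; linarith
      · rw [← sin_pi_sub]
        refine le_trans ?_ (mul_le_sin (by linarith) (by linarith))
        rw [div_mul_eq_mul_div]; gcongr; linarith
    have hss : 2 * (α * γ) / π ^ 2 ≤ sin α * sin γ := by
      calc _ = 2 / π * α * (γ / π) := by field_simp
        _ ≤ _ := by gcongr
    have h10 : π ^ 2 ≤ 10.24 := by nlinarith
    have hss' : α * γ ≤ 5.12 * (sin α * sin γ) := by
      rw [div_le_iff₀ (by positivity)] at hss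
      nlinarith [mul_pos hsα0 hsγ0]
    rcases le_total γ (2 * α) with h | h
    · have h4 : γ ^ 4 ≤ 10.24 * (2 * (α * γ)) := by
        have e1 : γ ^ 2 ≤ 10.24 := by nlinarith
        have e2 : γ ^ 2 ≤ 2 * (α * γ) := by nlinarith
        calc γ ^ 4 = γ ^ 2 * γ ^ 2 := by ring
          _ ≤ _ := by gcongr
      nlinarith [sq_nonneg (cos α - cos γ)]
    · have e := cos_sub_cos_ge hα0 h hγ2
      have e2 : γ ^ 4 ≤ 10.24 ^ 2 * (cos α - cos γ) ^ 2 := by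
        rw [div_le_iff₀ (by positivity)] at e
        have hc : 0 ≤ cos α - cos γ := by
          by_contra hcon
          nlinarith [sq_nonneg γ, sq_nonneg π]
        have e3 : γ ^ 2 ≤ 10.24 * (cos α - cos γ) := by nlinarith
        calc γ ^ 4 = (γ ^ 2) ^ 2 := by ring
          _ ≤ (10.24 * (cos α - cos γ)) ^ 2 := by gcongr
          _ = _ := by ring
      nlinarith [mul_pos hsα0 hsγ0, sq_nonneg (cos α - cos γ)]
  · have h1 : 1 / 2 ≤ cos α - cos γ := by
      have := cos_nonneg_of_mem_Icc ⟨by linarith, hα1⟩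
      have h2 : cos γ ≤ cos (2 * π / 3) :=
        cos_le_cos_of_nonneg_of_le_pi (by positivity) hγ1.le hγ2.le
      rw [show 2 * π / 3 = π - π / 3 by ring, cos_pi_sub, cos_pi_div_three] at h2
      linarith
    have h2 : (1 / 2) ^ 2 ≤ (cos α - cos γ) ^ 2 := by gcongr
    have h3 : α * γ ≤ 1.6 * 3.2 := by gcongr <;> linarith
    have h4 : γ ^ 4 ≤ 3.2 ^ 4 := by gcongr; linarith
    nlinarith [mul_pos hsα0 hsγ0]

/-- The substitution y = 2π - 2γ with γ = 2βt. It is used with α = β³, the scale at which 4 sin α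
sin γ ≈ 8β⁴t and (cos α - cos γ)² ≈ 4β⁴t⁴ are of the same order. -/
lemma V_eq_integral {α β : ℝ} (hβ : 0 < β) : V (2 * α) = 4 * β * ∫ t in Ioi (0 : ℝ),
    (Iio π).indicator (fun γ => 2 / √((cos α - cos γ) ^ 2 + 4 * sin α * sin γ)) (2 * β * t) := by
  have h1 : V (2 * α) = ∫ y in Ioi (0 : ℝ),
      (Iio π).indicator (fun γ => 2 / √((cos α - cos γ) ^ 2 + 4 * sin α * sin γ)) (2⁻¹ * y) := by
    rw [V, ← integral_reflect, cellMeasure_eq_Ioo, ← Ioi_inter_Iio, inter_comm,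
      ← Measure.restrict_restrict measurableSet_Iio, ← integral_indicator measurableSet_Iio]
    congr 1
    ext y
    by_cases hy : y < 2 * π
    · rw [indicator_of_mem (s := Iio (2 * π)) hy, indicator_of_mem (by rw [mem_Iio]; linarith), K2,
        ← Fplus_end, show 2 * (2⁻¹ * y) = y by ring]
    · rw [indicator_of_notMem (s := Iio (2 * π)) hy,
        indicator_of_notMem (by rw [mem_Iio]; intro h; exact hy (by linarith))]
  rw [h1]
  have h2 := integral_comp_mul_left_Ioi (fun y => (Iio π).indicator
    (fun γ => 2 / √((cos α - cos γ) ^ 2 + 4 * sin α * sin γ)) (2⁻¹ * y)) 0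
    (b := 4 * β) (by positivity)
  rw [mul_zero, smul_eq_mul] at h2
  rw [eq_inv_mul_iff_mul_eq₀ (by positivity)] at h2
  rw [← h2]
  simp only [← mul_assoc]
  norm_num

lemma end_integrand_le {β t : ℝ} (hβ : 0 < β) (hβ2 : β ^ 3 ≤ π / 2) (ht : 0 < t) :
    (Iio π).indicator (fun γ => 2 / √((cos (β ^ 3) - cos γ) ^ 2 + 4 * sin (β ^ 3) * sin γ))
      (2 * β * t) ≤ 66 / β ^ 2 * (1 / √(2 * t + t ^ 4)) := by
  by_cases h : 2 * β * t < π
  · rw [indicator_of_mem (s := Iio π) h]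
    have h1 := Fplus_end_ge (α := β ^ 3) (γ := 2 * β * t) ⟨by positivity, hβ2⟩ ⟨by positivity, h⟩
    set F := (cos (β ^ 3) - cos (2 * β * t)) ^ 2 + 4 * sin (β ^ 3) * sin (2 * β * t)
    -- With α = β³ and γ = 2βt the corner estimate reads β⁴(2t + 16t⁴) ≤ 1088 F, and 1088 < 33².
    have h2 : β ^ 2 * √(2 * t + t ^ 4) ≤ 33 * √F := by
      rw [← sqrt_sq (by positivity : (0 : ℝ) ≤ 33), ← sqrt_mul (by positivity),
        ← sqrt_sq (by positivity : (0 : ℝ) ≤ β ^ 2), ← sqrt_mul (by positivity)]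
      apply sqrt_le_sqrt
      have : 0 ≤ β ^ 4 * t ^ 4 := by positivity
      nlinarith
    have h3 : 0 < β ^ 2 * √(2 * t + t ^ 4) := by positivity
    rw [div_mul_div_comm, div_le_div_iff₀ (by linarith) h3]
    linarith
  · rw [indicator_of_notMem (s := Iio π) h]
    positivity

lemma end_integrand_nonneg (α γ : ℝ) :
    0 ≤ (Iio π).indicator (fun γ => 2 / √((cos α - cos γ) ^ 2 + 4 * sin α * sin γ)) γ :=
  indicator_nonneg (fun _ _ => by positivity) _

/-- The sharp order of `V` at the ends of the cell. -/
theorem exists_V_le_rpow :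
    ∃ C : ℝ, 0 < C ∧ ∀ x ∈ Ioo 0 (2 * π), V x ≤ C * dispersion x ^ (-(1 / 3) : ℝ) := by
  refine ⟨66 * w0, mul_pos (by norm_num) w0_pos, ?_⟩
  have key : ∀ x ∈ Ioc 0 π, V x ≤ 66 * w0 * dispersion x ^ (-(1 / 3) : ℝ) := fun x hx => by
    have hpi := pi_pos
    have hxI : x ∈ Ioo 0 (2 * π) := ⟨hx.1, by linarith [hx.2]⟩
    have hx2 : 0 < x / 2 := by linarith [hx.1]
    -- The scale with x = 2β³; the factor 4β from the substitution times β⁻² from the integrand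
    -- gives β⁻¹ = (x/2)^(-1/3).
    set β := (x / 2) ^ (1 / 3 : ℝ) with hβdef
    have hβ : 0 < β := rpow_pos_of_pos hx2 _
    have hβ3 : β ^ 3 = x / 2 := by
      rw [hβdef, ← rpow_natCast, ← rpow_mul hx2.le]; norm_num
    have hV := V_eq_integral (α := β ^ 3) hβ
    rw [show 2 * β ^ 3 = x by rw [hβ3]; ring] at hV
    have h1 : V x ≤ 4 * β * (66 / β ^ 2 * (w0 / 4)) := by
      rw [hV]
      gcongr
      rw [w0, mul_div_cancel_left₀ _ four_ne_zero, ← integral_const_mul]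
      refine integral_mono_of_nonneg (Eventually.of_forall fun t => end_integrand_nonneg _ _)
        (integrableOn_w0.const_mul _) ((ae_restrict_mem measurableSet_Ioi).mono fun t ht =>
          end_integrand_le hβ (by rw [hβ3]; linarith [hx.2]) ht)
    calc V x ≤ 66 * w0 * β⁻¹ := by
          refine h1.trans (le_of_eq ?_); field_simp
      _ ≤ _ := by
        have hw := w0_pos
        gcongr
        rw [hβdef, ← rpow_neg hx2.le]
        refine rpow_le_rpow_of_nonpos (dispersion_pos hxI) ?_ (by norm_num)
        rw [dispersion_eq hxI]
        exact sin_le hx2.le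
  intro x hx
  rcases le_or_gt x π with h | h
  · exact key x ⟨hx.1, h⟩
  · rw [← V_reflect, ← dispersion_reflect]
    exact key _ ⟨by linarith [hx.2], by linarith⟩

lemma tendsto_sin_div (c : ℝ) : Tendsto (fun β => sin (c * β) / β) (𝓝[>] 0) (𝓝 c) := by
  have h : HasDerivAt (fun β => sin (c * β)) c 0 := by
    have := ((hasDerivAt_id (0 : ℝ)).const_mul c).sin
    simpa using this
  have h2 := h.tendsto_slope_zero_right
  simpa [div_eq_inv_mul] using h2

/-- Each cosine is written as 1 - 2 sin², so that only limits of sin(cβ)/β occur. The contribution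
of β³/2 vanishes in the limit. -/
lemma tendsto_Fplus_end (t : ℝ) :
    Tendsto (fun β : ℝ => ((cos (β ^ 3) - cos (2 * β * t)) ^ 2
      + 4 * sin (β ^ 3) * sin (2 * β * t)) / β ^ 4) (𝓝[>] 0) (𝓝 (4 * (2 * t + t ^ 4))) := by
  have hβ0 : Tendsto (fun β : ℝ => β) (𝓝[>] 0) (𝓝 0) := tendsto_id.mono_left nhdsWithin_le_nhds
  have h1 : Tendsto (fun β : ℝ => sin (β ^ 3) / β ^ 3) (𝓝[>] 0) (𝓝 1) := by
    have := (tendsto_sin_div 1).comp (f := fun β : ℝ => β ^ 3) (x := 𝓝[>] 0)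
      (tendsto_nhdsWithin_iff.2 ⟨by simpa using hβ0.pow 3, ?_⟩)
    · simpa [Function.comp_def] using this
    · filter_upwards [self_mem_nhdsWithin] with β hβ
      exact pow_pos (mem_Ioi.1 hβ) 3
  have h2 : Tendsto (fun β : ℝ => sin (2 * β * t) / β) (𝓝[>] 0) (𝓝 (2 * t)) := by
    refine (tendsto_sin_div (2 * t)).congr fun β => ?_
    rw [mul_right_comm]
  have h3 : Tendsto (fun β : ℝ => sin (β * t) / β) (𝓝[>] 0) (𝓝 t) := by
    refine (tendsto_sin_div t).congr fun β => ?_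
    rw [mul_comm]
  have h4 : Tendsto (fun β : ℝ => sin (β ^ 3 / 2) / β) (𝓝[>] 0) (𝓝 0) := by
    refine squeeze_zero_norm' (a := fun β : ℝ => β ^ 2 / 2) ?_ (by simpa using (hβ0.pow 2).div_const 2)
    filter_upwards [self_mem_nhdsWithin] with β hβ
    have hβ : 0 < β := hβ
    rw [norm_div, norm_of_nonneg hβ.le, div_le_iff₀ hβ]
    calc _ ≤ |β ^ 3 / 2| := abs_sin_le_abs
      _ = _ := by rw [abs_of_pos (by positivity)]; ring
  have h5 := ((((h3.pow 2).const_mul 2).sub ((h4.pow 2).const_mul 2)).pow 2).add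
    ((h1.mul h2).const_mul 4)
  refine (h5.congr' ?_).trans (le_of_eq (by congr 1; ring))
  filter_upwards [self_mem_nhdsWithin] with β hβ
  have hβ : 0 < β := hβ
  have e1 : cos (β ^ 3) = 1 - 2 * sin (β ^ 3 / 2) ^ 2 := by
    rw [← cos_sq_add_sin_sq (β ^ 3 / 2)] 
    have := cos_two_mul (β ^ 3 / 2)
    rw [show 2 * (β ^ 3 / 2) = β ^ 3 by ring] at this
    rw [this]; linarith [cos_sq_add_sin_sq (β ^ 3 / 2)]
  have e2 : cos (2 * β * t) = 1 - 2 * sin (β * t) ^ 2 := by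
    rw [show 2 * β * t = 2 * (β * t) by ring, cos_two_mul]
    linarith [cos_sq_add_sin_sq (β * t)]
  rw [e1, e2]
  field_simp
  ring

/-- The leading order of `V` at the ends of the cell. -/
theorem tendsto_V_end : Tendsto (fun β : ℝ => β * V (2 * β ^ 3)) (𝓝[>] 0) (𝓝 w0) := by
  have hI : Tendsto (fun β : ℝ => ∫ t in Ioi (0 : ℝ), β ^ 2 * (Iio π).indicator
      (fun γ => 2 / √((cos (β ^ 3) - cos γ) ^ 2 + 4 * sin (β ^ 3) * sin γ)) (2 * β * t)) (𝓝[>] 0)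
      (𝓝 (∫ t in Ioi (0 : ℝ), 1 / √(2 * t + t ^ 4))) := by
    have hβ0 : Tendsto (fun β : ℝ => β) (𝓝[>] 0) (𝓝 0) := tendsto_id.mono_left nhdsWithin_le_nhds
    refine tendsto_integral_filter_of_dominated_convergence (fun t => 66 * (1 / √(2 * t + t ^ 4)))
      ?_ ?_ (integrableOn_w0.const_mul _) ?_
    · refine Eventually.of_forall fun β => Measurable.aestronglyMeasurable ?_
      refine measurable_const.mul ((Measurable.indicator ?_ measurableSet_Iio).comp (by fun_prop))
      fun_prop
    · have h3 : ∀ᶠ β : ℝ in 𝓝[>] 0, β ^ 3 < π / 2 :=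
        (hβ0.pow 3).eventually_lt_const (by norm_num [pi_pos])
      filter_upwards [self_mem_nhdsWithin, h3] with β hβ hβ3
      have hβ : 0 < β := hβ
      filter_upwards [ae_restrict_mem measurableSet_Ioi] with t ht
      rw [norm_of_nonneg (mul_nonneg (sq_nonneg _) (end_integrand_nonneg _ _))]
      calc _ ≤ β ^ 2 * (66 / β ^ 2 * (1 / √(2 * t + t ^ 4))) := by
            gcongr; exact end_integrand_le hβ hβ3.le ht
        _ = _ := by field_simp
    · filter_upwards [ae_restrict_mem measurableSet_Ioi] with t ht
      have ht : 0 < t := ht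
      have hF := (tendsto_Fplus_end t).sqrt
      have hF2 := hF.inv₀ (by positivity)
      refine ((hF2.const_mul 2).congr' ?_).trans (le_of_eq ?_)
      · have h4 : ∀ᶠ β : ℝ in 𝓝[>] 0, 2 * β * t < π := by
          refine ((hβ0.const_mul 2).mul_const t).eventually_lt_const (by norm_num [pi_pos])
        filter_upwards [self_mem_nhdsWithin, h4] with β hβ hβ4
        have hβ : 0 < β := hβ
        rw [indicator_of_mem (s := Iio π) hβ4, sqrt_div' _ (by positivity),
          show β ^ 4 = (β ^ 2) ^ 2 by ring, sqrt_sq (by positivity)]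
        field_simp
      · rw [sqrt_mul four_pos.le, show (4 : ℝ) = 2 ^ 2 by norm_num, sqrt_sq two_pos.le]
        congr 1; field_simp
  refine ((hI.const_mul 4).congr' ?_)
  filter_upwards [self_mem_nhdsWithin] with β hβ
  rw [V_eq_integral hβ, integral_const_mul]
  ring

end FPU
end

noncomputable section

namespace FPU

open Real Set
open scoped ENNReal NNReal

/-! ### Weighted row integrals of the gain kernel -/

lemma hasDerivAt_arctan_sqrt {q : ℝ → ℝ} {q' b : ℝ} (hq : HasDerivAt q q' b) (h1 : 1 < q b) :
    HasDerivAt (fun b => 2 * arctan √(q b - 1)) (q' / (q b * √(q b - 1))) b := by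
  have h2 : 0 < q b - 1 := by linarith
  have h := (((hq.sub_const 1).sqrt h2.ne').arctan).const_mul 2
  refine h.congr_deriv ?_
  have h3 : 0 < √(q b - 1) := sqrt_pos.2 h2
  rw [sq_sqrt h2.le]
  field_simp
  ring

lemma hasDerivAt_ratio {a y : ℝ} (ha : 0 < sin a) (hy : 0 < sin (y / 2)) :
    HasDerivAt (fun y => (cos a + cos (y / 2)) ^ 2 / (4 * sin a * sin (y / 2)))
      (-((cos a + cos (y / 2)) * (2 * sin (y / 2) ^ 2 + (cos a + cos (y / 2)) * cos (y / 2)))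
        / (8 * sin a * sin (y / 2) ^ 2)) y := by
  have h0 : HasDerivAt (fun y : ℝ => y / 2) (1 / 2) y := (hasDerivAt_id y).div_const 2
  have h1 := ((h0.cos.const_add (cos a)).pow 2)
  have h2 := h0.sin.const_mul (4 * sin a)
  refine (h1.div h2 (by positivity)).congr_deriv ?_
  simp only [Pi.pow_apply]
  field_simp
  push_cast
  ring

lemma abs_add_le_one_add_mul {u v : ℝ} (hu : |u| ≤ 1) (hv : |v| ≤ 1) : |u + v| ≤ 1 + u * v := by
  rw [abs_le] at *
  constructor <;> nlinarith

/-- The right side equals 1 + sin² b + cos a cos b, and |u + v| ≤ 1 + uv for u, v in [-1, 1]. -/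
lemma two_sin_sq_add_ge (a b : ℝ) :
    |cos a + cos b| ≤ 2 * sin b ^ 2 + (cos a + cos b) * cos b := by
  have := abs_add_le_one_add_mul (abs_cos_le_one a) (abs_cos_le_one b)
  nlinarith [sin_sq_add_cos_sq b, sq_nonneg (sin b)]

/-- The ratio q = (cos a + cos(y/2))²/(4 sin a sin(y/2)) satisfies F₋ = 4 sin a sin(y/2)(q - 1). Its
monotonicity gives injectivity in the substitution for `K1`, and the uniqueness of the zero of F₋ in
each half row. -/
lemma ratio_injOn {a : ℝ} (ha : a ∈ Ioo 0 π) :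
    StrictAntiOn (fun y => (cos a + cos (y / 2)) ^ 2 / (4 * sin a * sin (y / 2)))
      (Ioo 0 (2 * (π - a))) := by
  have hsa := sin_pos_of_mem_Ioo ha
  have hs : ∀ y ∈ Ioo 0 (2 * (π - a)), 0 < sin (y / 2) := fun y hy =>
    sin_pos_of_pos_of_lt_pi (by linarith [hy.1]) (by linarith [hy.2, ha.1])
  refine strictAntiOn_of_deriv_neg (convex_Ioo _ _)
    (fun y hy => (hasDerivAt_ratio hsa (hs y hy)).continuousAt.continuousWithinAt) fun y hy => ?_
  rw [interior_Ioo] at hy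
  have hsy := hs y hy
  rw [(hasDerivAt_ratio hsa hsy).deriv]
  have hX : 0 < cos a + cos (y / 2) := by
    have := cos_lt_cos_of_nonneg_of_le_pi (x := y / 2) (y := π - a) (by linarith [hy.1])
      (by linarith [ha.1]) (by linarith [hy.2])
    rw [cos_pi_sub] at this
    linarith
  have h2 := two_sin_sq_add_ge a (y / 2)
  rw [abs_of_pos hX] at h2
  have h3 : 0 < (cos a + cos (y / 2)) *
    (2 * sin (y / 2) ^ 2 + (cos a + cos (y / 2)) * cos (y / 2)) := mul_pos hX (by linarith)
  rw [neg_div]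
  exact neg_neg_of_pos (by positivity)

/-- Up to the factor 4 ω(x)^(-1/2), the function `K1` ω^(-1/2) is at most the absolute derivative of
2 arctan √(q - 1) wherever q > 1. This function is injective there with values in [0, π], so the
integral of its derivative is at most π. The inverse square root singularity at q = 1 is absorbed by
the substitution. -/
lemma lintegral_K1_weight_half {x : ℝ} (hx : x ∈ Ioo 0 (2 * π)) :
    ∫⁻ y in Ioo 0 (2 * π - x), ENNReal.ofReal (K1 x y * dispersion y ^ (-(1 / 2) : ℝ)) ≤
      ENNReal.ofReal (4 * π * dispersion x ^ (-(1 / 2) : ℝ)) := by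
  have hsa := sin_half_pos hx
  have ha : x / 2 ∈ Ioo 0 π := ⟨by linarith [hx.1], by linarith [hx.2]⟩
  set a := x / 2 with hadef
  have hI : Ioo 0 (2 * π - x) = Ioo 0 (2 * (π - a)) := by rw [hadef]; congr 1; ring
  rw [hI]
  set q : ℝ → ℝ := fun y => (cos a + cos (y / 2)) ^ 2 / (4 * sin a * sin (y / 2)) with hq
  set q' : ℝ → ℝ := fun y =>
    (-((cos a + cos (y / 2)) * (2 * sin (y / 2) ^ 2 + (cos a + cos (y / 2)) * cos (y / 2)))
        / (8 * sin a * sin (y / 2) ^ 2)) with hq'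
  have hqm : Measurable q := by fun_prop
  set S := Ioo 0 (2 * (π - a)) ∩ {y | 1 < q y} with hS
  have hSm : MeasurableSet S := measurableSet_Ioo.inter (measurableSet_lt measurable_const hqm)
  have hs : ∀ y ∈ Ioo 0 (2 * (π - a)), 0 < sin (y / 2) := fun y hy =>
    sin_pos_of_pos_of_lt_pi (by linarith [hy.1]) (by linarith [hy.2, ha.1])
  have hf' : ∀ y ∈ S, HasDerivWithinAt (fun b => 2 * arctan √(q b - 1))
      (q' y / (q y * √(q y - 1))) S y := fun y hy =>
    (hasDerivAt_arctan_sqrt (hasDerivAt_ratio hsa (hs y hy.1)) hy.2).hasDerivWithinAt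
  have hinj : InjOn (fun b => 2 * arctan √(q b - 1)) S := by
    intro y hy z hz h
    have h1 := arctan_injective (mul_left_cancel₀ two_ne_zero h)
    rw [sqrt_inj (by linarith [hy.2.out]) (by linarith [hz.2.out])] at h1
    exact (ratio_injOn ha).injOn hy.1 hz.1 (sub_left_injective h1)
  have hvol := lintegral_image_eq_lintegral_abs_deriv_mul hSm hf' hinj fun _ => 1
  simp only [lintegral_one, Measure.restrict_apply_univ, mul_one] at hvol
  have hle : volume ((fun b => 2 * arctan √(q b - 1)) '' S) ≤ ENNReal.ofReal π := by
    calc _ ≤ volume (Icc 0 π) := by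
          refine measure_mono ?_
          rintro _ ⟨y, -, rfl⟩
          have h1 := arctan_lt_pi_div_two √(q y - 1)
          have h2 := arctan_nonneg.2 (sqrt_nonneg (q y - 1))
          exact ⟨by linarith, by linarith⟩
      _ = _ := by simp
  calc ∫⁻ y in Ioo 0 (2 * (π - a)), ENNReal.ofReal (K1 x y * dispersion y ^ (-(1 / 2) : ℝ))
      ≤ ∫⁻ y in Ioo 0 (2 * (π - a)), S.indicator (fun y => ENNReal.ofReal (4 * (√(sin a))⁻¹) *
          ENNReal.ofReal |q' y / (q y * √(q y - 1))|) y := by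
        refine setLIntegral_mono' measurableSet_Ioo fun y hy => ?_
        have hsy := hs y hy
        have hyI : y ∈ Ioo 0 (2 * π) := ⟨hy.1, by linarith [hy.2, ha.1]⟩
        have hF : Fminus x y = 4 * sin a * sin (y / 2) * (q y - 1) := by
          rw [Fminus, hq, ← hadef]; field_simp
        by_cases h : 1 < q y
        · rw [indicator_of_mem (show y ∈ S from ⟨hy, h⟩), ← ENNReal.ofReal_mul (by positivity)]
          apply ENNReal.ofReal_le_ofReal
          have hq1 : 0 < q y - 1 := by linarith
          have hX : 0 < cos a + cos (y / 2) := by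
            have := cos_lt_cos_of_nonneg_of_le_pi (x := y / 2) (y := π - a) (by linarith [hy.1])
              (by linarith [ha.1]) (by linarith [hy.2])
            rw [cos_pi_sub] at this
            linarith
          have hF0 : 0 < Fminus x y := by rw [hF]; positivity
          have h2 := two_sin_sq_add_ge a (y / 2)
          rw [abs_of_pos hX] at h2
          have e1 : √(Fminus x y) = 2 * √(sin a) * √(sin (y / 2)) * √(q y - 1) := by
            rw [hF, sqrt_mul (by positivity), sqrt_mul (by positivity), sqrt_mul (by norm_num),
              show (4 : ℝ) = 2 ^ 2 by norm_num, sqrt_sq two_pos.le]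
          have e2 : |q' y / (q y * √(q y - 1))| = (2 * sin (y / 2) ^ 2 + (cos a + cos (y / 2)) *
              cos (y / 2)) / (cos a + cos (y / 2)) / (2 * sin (y / 2) * √(q y - 1)) := by
            have hq0 : q' y / q y = -((2 * sin (y / 2) ^ 2 + (cos a + cos (y / 2)) *
              cos (y / 2)) / (cos a + cos (y / 2)) / (2 * sin (y / 2))) := by
              simp only [hq, hq']
              field_simp
              ring
            rw [← div_div, hq0, abs_div, abs_neg, abs_of_nonneg (sqrt_nonneg _), abs_of_nonneg,
              div_div]
            exact div_nonneg (div_nonneg (hX.le.trans h2) hX.le) (by positivity)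
          have e3 : 1 ≤ (2 * sin (y / 2) ^ 2 + (cos a + cos (y / 2)) *
              cos (y / 2)) / (cos a + cos (y / 2)) := (one_le_div hX).2 h2
          -- The weighted kernel equals the derivative up to the factor in `e3`, which is at least
          -- 1.
          rw [K1, if_pos hF0, e1, e2, dispersion_eq hyI, rpow_neg hsy.le, ← sqrt_eq_rpow]
          calc 4 / (2 * √(sin a) * √(sin (y / 2)) * √(q y - 1)) * (√(sin (y / 2)))⁻¹
              = 4 * (√(sin a))⁻¹ * (1 / (2 * sin (y / 2) * √(q y - 1))) := by
                have := mul_self_sqrt hsy.le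
                have h5 := sqrt_pos.2 hsy
                have h6 := sqrt_pos.2 hsa
                have h7 := sqrt_pos.2 hq1
                field_simp
                rw [sq_sqrt hsy.le]
            _ ≤ _ := by gcongr
        · rw [indicator_of_notMem (fun hh => h hh.2), K1, if_neg, zero_mul, ENNReal.ofReal_zero]
          rw [hF]
          have : 0 < 4 * sin a * sin (y / 2) := by positivity
          nlinarith
    _ ≤ ENNReal.ofReal (4 * (√(sin a))⁻¹) *
          ∫⁻ y in S, ENNReal.ofReal |q' y / (q y * √(q y - 1))| := by
        rw [setLIntegral_indicator hSm, lintegral_const_mul' _ _ ENNReal.ofReal_ne_top]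
        gcongr
        exact inter_subset_left
    _ ≤ ENNReal.ofReal (4 * (√(sin a))⁻¹) * ENNReal.ofReal π := by
        rw [← hvol]; gcongr
    _ = _ := by
        rw [← ENNReal.ofReal_mul (by positivity), dispersion_eq hx, rpow_neg hsa.le,
          ← sqrt_eq_rpow]
        congr 1; ring

/-- The half y > 2π - x is the reflected half for 2π - x. The power -1/2 is reproduced exactly,
without loss; this is used for the perturbation applied to the relaxation term. -/
theorem lintegral_K1_weight_le {x : ℝ} (hx : x ∈ Ioo 0 (2 * π)) :
    ∫⁻ y, ENNReal.ofReal (K1 x y * dispersion y ^ (-(1 / 2) : ℝ)) ∂cellMeasure ≤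
      ENNReal.ofReal (8 * π * dispersion x ^ (-(1 / 2) : ℝ)) := by
  have h1 := lintegral_K1_weight_half hx
  have h2 := lintegral_K1_weight_half (reflect_mem.2 hx)
  rw [dispersion_reflect, sub_sub_cancel] at h2
  have h3 : ∫⁻ y in Ioo 0 x, ENNReal.ofReal (K1 (2 * π - x) y * dispersion y ^ (-(1 / 2) : ℝ))
      = ∫⁻ y in Ioo (2 * π - x) (2 * π), ENNReal.ofReal (K1 x y * dispersion y ^ (-(1 / 2) : ℝ)) := by
    have := measurePreserving_reflect.setLIntegral_comp_preimage_emb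
      (Homeomorph.subLeft (2 * π)).measurableEmbedding
      (fun y => ENNReal.ofReal (K1 x y * dispersion y ^ (-(1 / 2) : ℝ))) (Ioo (2 * π - x) (2 * π))
    rw [← this]
    simp only [preimage_const_sub_Ioo, sub_self, sub_sub_cancel]
    refine lintegral_congr fun y => ?_
    rw [dispersion_reflect, ← K1_reflect, sub_sub_cancel]
  rw [h3] at h2
  have hpi := pi_pos
  have hd := rpow_nonneg (dispersion_nonneg x) (-(1 / 2) : ℝ)
  rw [cellMeasure_eq_Ioo, ← Ioo_union_Ico_eq_Ioo (a := 0) (b := 2 * π - x) (c := 2 * π)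
    (by linarith [hx.2]) (by linarith [hx.1])]
  refine (lintegral_union_le _ _ _).trans ?_
  rw [setLIntegral_congr (Ioo_ae_eq_Ico (a := 2 * π - x)).symm]
  refine (add_le_add h1 h2).trans ?_
  rw [← ENNReal.ofReal_add (by positivity) (by positivity)]
  apply ENNReal.ofReal_le_ofReal
  linarith

end FPU
end

noncomputable section

namespace FPU

open Real Set
open scoped ENNReal NNReal

/-! ### Splitting the gain kernel near its singularity -/

open Classical in
/-- The part of `K₁` away from the curve `F₋ = 0`. -/
def K1far (x y : ℝ) : ℝ := if 4 * (dispersion x * dispersion y) ≤ Fminus x y then K1 x y else 0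

/-- The part of `K₁` near the curve `F₋ = 0`. -/
def K1near (x y : ℝ) : ℝ := K1 x y - K1far x y

lemma Fminus_comm (x y : ℝ) : Fminus x y = Fminus y x := by simp only [Fminus]; ring

lemma measurable_Fminus : Measurable fun q : ℝ × ℝ => Fminus q.1 q.2 := by
  unfold Fminus; fun_prop

lemma K1far_comm (x y : ℝ) : K1far x y = K1far y x := by
  simp only [K1far, Fminus_comm x y, K1_comm x y, mul_comm (dispersion x)]

lemma K1far_nonneg (x y : ℝ) : 0 ≤ K1far x y := by
  unfold K1far; split_ifs
  exacts [K1_nonneg x y, le_rfl]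

lemma K1far_le (x y : ℝ) : K1far x y ≤ K1 x y := by
  unfold K1far; split_ifs
  exacts [le_rfl, K1_nonneg x y]

lemma K1near_nonneg (x y : ℝ) : 0 ≤ K1near x y := sub_nonneg.2 (K1far_le x y)

lemma K1near_le (x y : ℝ) : K1near x y ≤ K1 x y := sub_le_self _ (K1far_nonneg x y)

lemma K1near_comm (x y : ℝ) : K1near x y = K1near y x := by
  rw [K1near, K1near, K1_comm, K1far_comm]

lemma K1far_reflect (x y : ℝ) : K1far (2 * π - x) (2 * π - y) = K1far x y := by
  simp only [K1far, Fminus_reflect, K1_reflect, dispersion_reflect]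

lemma measurable_K1far : Measurable fun q : ℝ × ℝ => K1far q.1 q.2 := by
  unfold K1far
  have := measurable_dispersion
  refine Measurable.ite (measurableSet_le (by fun_prop) measurable_Fminus) measurable_K1
    measurable_const

lemma measurable_K1near : Measurable fun q : ℝ × ℝ => K1near q.1 q.2 :=
  measurable_K1.sub measurable_K1far

lemma Dominated.mono {k k' : ℝ → ℝ → ℝ} (hk : Dominated k)
    (hm : Measurable fun q : ℝ × ℝ => k' q.1 q.2) (hc : ∀ x y, k' x y = k' y x)
    (hle : ∀ x y, |k' x y| ≤ |k x y|) : Dominated k' where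
  measurable := hm
  comm := hc
  row_le := by
    filter_upwards [hk.row_le] with x hx
    refine le_trans (lintegral_mono fun y => ?_) hx
    exact enorm_le_iff_norm_le.2 (hle x y)

lemma dominated_K1far : Dominated K1far :=
  dominated_K1.mono measurable_K1far K1far_comm fun x y => by
    rw [abs_of_nonneg (K1far_nonneg x y), abs_of_nonneg (K1_nonneg x y)]; exact K1far_le x y

lemma dominated_K1near : Dominated K1near :=
  dominated_K1.mono measurable_K1near K1near_comm fun x y => by
    rw [abs_of_nonneg (K1near_nonneg x y), abs_of_nonneg (K1_nonneg x y)]; exact K1near_le x y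

/-- Away from the curve, F₋ ≥ 4ω(x)ω(y), so this part obeys the same kind of product bound as `K2`.
-/
lemma K1far_le_rpow {x y : ℝ} (hx : x ∈ Ioo 0 (2 * π)) (hy : y ∈ Ioo 0 (2 * π)) :
    K1far x y ≤ 2 * (dispersion x ^ (-(1 / 2) : ℝ) * dispersion y ^ (-(1 / 2) : ℝ)) := by
  have h1 := dispersion_pos hx
  have h2 := dispersion_pos hy
  rw [← mul_rpow h1.le h2.le, rpow_neg (by positivity), ← sqrt_eq_rpow]
  unfold K1far
  split_ifs with h
  · have h0 : 0 < Fminus x y := lt_of_lt_of_le (by positivity) h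
    rw [K1, if_pos h0]
    have h3 : 2 * √(dispersion x * dispersion y) ≤ √(Fminus x y) := by
      apply le_sqrt_of_sq_le
      rw [mul_pow, sq_sqrt (by positivity)]
      linarith
    have h4 : 0 < √(dispersion x * dispersion y) := by positivity
    rw [← div_eq_mul_inv, div_le_div_iff₀ (by linarith) h4]
    linarith
  · positivity

lemma K1far_ge {x y X : ℝ} (hX : 0 < X) (hx : x ∈ Ioo 0 (2 * π)) (hy : y ∈ Ioo 0 (2 * π))
    (h1 : |cos (x / 2) + cos (y / 2)| ≤ X)
    (h2 : 8 * (sin (x / 2) * sin (y / 2)) ≤ (cos (x / 2) + cos (y / 2)) ^ 2) :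
    4 / X ≤ K1far x y := by
  have hsx := sin_half_pos hx
  have hsy := sin_half_pos hy
  have hss := mul_pos hsx hsy
  have hF : 4 * (dispersion x * dispersion y) ≤ Fminus x y := by
    rw [dispersion_eq hx, dispersion_eq hy, Fminus]; linarith
  have hF0 : 0 < Fminus x y := lt_of_lt_of_le (by rw [dispersion_eq hx, dispersion_eq hy]; positivity) hF
  rw [K1far, if_pos hF, K1, if_pos hF0]
  gcongr
  refine sqrt_le_iff.2 ⟨hX.le, ?_⟩
  calc Fminus x y ≤ (cos (x / 2) + cos (y / 2)) ^ 2 := by rw [Fminus]; linarith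
    _ ≤ X ^ 2 := by rw [← sq_abs]; gcongr

lemma lintegral_ge_of_Ioo {g : ℝ → ℝ} {u v m : ℝ} (hm : 0 ≤ m) (hu : 0 ≤ u) (hv : v ≤ 2 * π)
    (h : ∀ y ∈ Ioo u v, m ≤ g y) :
    ENNReal.ofReal (m * (v - u)) ≤ ∫⁻ y, ENNReal.ofReal (g y) ∂cellMeasure := by
  rw [cellMeasure_eq_Ioo]
  calc _ = ∫⁻ _ in Ioo u v, ENNReal.ofReal m := by
        rw [setLIntegral_const, Real.volume_Ioo, ENNReal.ofReal_mul hm]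
    _ ≤ ∫⁻ y in Ioo u v, ENNReal.ofReal (g y) :=
        setLIntegral_mono' measurableSet_Ioo fun y hy => ENNReal.ofReal_le_ofReal (h y hy)
    _ ≤ _ := lintegral_mono_set (Ioo_subset_Ioo hu hv)

/-- For y < 1/9 one has cos(y/2) ≥ 9/10 and sin(y/2) ≤ 1/18. The cosine sum is then large enough to
be in the far region, and it is at most 2. -/
lemma K1far_row_ge_bulk {x : ℝ} (hx : x ∈ Ioc 0 π) :
    ENNReal.ofReal (2 / 9) ≤ ∫⁻ y, ENNReal.ofReal (K1far x y) ∂cellMeasure := by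
  have hpi := pi_gt_three
  refine le_trans (ENNReal.ofReal_le_ofReal ?_) (lintegral_ge_of_Ioo (m := 2) (u := 0) (v := 1 / 9)
    (by norm_num) le_rfl (by linarith) fun y hy => ?_)
  · norm_num
  · have h0 : 0 ≤ cos (x / 2) := cos_nonneg_of_mem_Icc ⟨by linarith [hx.1], by linarith [hx.2]⟩
    have h1 := cos_le_one (x / 2)
    have h2 := cos_le_one (y / 2)
    have h3 := one_sub_sq_div_two_le_cos (x := y / 2)
    have h4 := sin_le (x := y / 2) (by linarith [hy.1])
    have h5 := sin_le_one (x / 2)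
    have hxI : x ∈ Ioo 0 (2 * π) := ⟨hx.1, by linarith [hx.2]⟩
    have hyI : y ∈ Ioo 0 (2 * π) := ⟨hy.1, by linarith [hy.2]⟩
    have h6 := sin_half_pos hxI
    have h7 := sin_half_pos hyI
    have h8 : 9 / 10 ≤ cos (y / 2) := by
      have := hy.1; have := hy.2
      nlinarith
    refine le_trans (by norm_num) (K1far_ge two_pos hxI hyI ?_ ?_)
    · rw [abs_of_nonneg (by linarith)]; linarith
    · have h9 : sin (x / 2) * sin (y / 2) ≤ 1 * (1 / 18) := by
        gcongr; linarith [hy.2]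
      nlinarith

/-- The row near x = 2β³ is tested on a window of length of order β at distance of order β from the
opposite end, where `K1far` has size of order β⁻². -/
lemma K1far_row_ge_end {β : ℝ} (hβ : 0 < β) (hβ2 : β ≤ 1 / 10) :
    ENNReal.ofReal (2 / 5 * β⁻¹) ≤ ∫⁻ y, ENNReal.ofReal (K1far (2 * β ^ 3) y) ∂cellMeasure := by
  have hpi := pi_gt_three
  have hpi2 : π < 3.15 := pi_lt_d2
  have hβ3 : β ^ 3 ≤ β / 100 := by
    have : β ^ 2 ≤ 1 / 100 := by nlinarith
    nlinarith
  have hβ30 : 0 < β ^ 3 := by positivity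
  have hxI : 2 * β ^ 3 ∈ Ioo 0 (2 * π) := ⟨by positivity, by linarith⟩
  -- In the window 10β < γ < 20β the cosine difference is at most γ²/2 ≤ 200β². The far condition
  -- follows from (γ²/π²)² ≥ 8β³γ, which holds because γ³ ≥ 1000β³ and π⁴ ≤ 100.
  refine le_trans (ENNReal.ofReal_le_ofReal ?_) (lintegral_ge_of_Ioo (m := 4 / (200 * β ^ 2))
    (u := 2 * π - 40 * β) (v := 2 * π - 20 * β)
    (by positivity) (by linarith) (by linarith) fun y hy => ?_)
  · apply le_of_eq; field_simp; ring
  · obtain ⟨γ, rfl⟩ : ∃ γ, y = 2 * π - 2 * γ := ⟨π - y / 2, by ring⟩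
    have hγ1 : 10 * β < γ := by linarith [hy.2]
    have hγ2 : γ < 20 * β := by linarith [hy.1]
    have hγ0 : 0 < γ := by linarith
    have hyI : 2 * π - 2 * γ ∈ Ioo 0 (2 * π) := ⟨by linarith, by linarith⟩
    have hge := cos_sub_cos_ge hβ30 (γ := γ) (by linarith) (by linarith)
    have e1 : 2 * β ^ 3 / 2 = β ^ 3 := by ring
    have e2 : (2 * π - 2 * γ) / 2 = π - γ := by ring
    have hlt := one_sub_sq_div_two_le_cos (x := γ)
    have hc1 := cos_le_one (β ^ 3)
    have h0 : 0 < γ ^ 2 / π ^ 2 := by positivity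
    refine K1far_ge (by positivity) hxI hyI ?_ ?_ <;>
      rw [e1, e2, cos_pi_sub, ← sub_eq_add_neg]
    · rw [abs_of_nonneg (by linarith)]
      nlinarith
    · rw [sin_pi_sub]
      have hs1 := sin_le hβ30.le
      have hs2 := sin_le hγ0.le
      have hs3 : 0 ≤ sin γ := sin_nonneg_of_nonneg_of_le_pi hγ0.le (by linarith)
      calc 8 * (sin (β ^ 3) * sin γ) ≤ 8 * (β ^ 3 * γ) := by gcongr
        _ ≤ (γ ^ 2 / π ^ 2) ^ 2 := by
          have h4 : π ^ 4 ≤ 100 := by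
            calc π ^ 4 ≤ 3.15 ^ 4 := by gcongr
              _ ≤ 100 := by norm_num
          have h5 : (10 * β) ^ 3 ≤ γ ^ 3 := by gcongr
          rw [div_pow, le_div_iff₀ (by positivity), ← pow_mul, ← pow_mul]
          calc 8 * (β ^ 3 * γ) * π ^ (2 * 2) ≤ 8 * (β ^ 3 * γ) * 100 := by gcongr
            _ ≤ (10 * β) ^ 3 * γ := by nlinarith [mul_pos hβ30 hγ0]
            _ ≤ γ ^ 3 * γ := by gcongr
            _ = _ := by ring
        _ ≤ _ := by gcongr

/-- The far part of the gain kernel carries the full order of the collision frequency. -/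
theorem exists_le_K1far_row : ∃ c : ℝ, 0 < c ∧ ∀ x ∈ Ioo 0 (2 * π),
    ENNReal.ofReal (c * dispersion x ^ (-(1 / 3) : ℝ))
      ≤ ∫⁻ y, ENNReal.ofReal (K1far x y) ∂cellMeasure := by
  have hpi := pi_pos
  have key : ∀ x ∈ Ioc 0 π, ENNReal.ofReal (1 / 100 * dispersion x ^ (-(1 / 3) : ℝ))
      ≤ ∫⁻ y, ENNReal.ofReal (K1far x y) ∂cellMeasure := fun x hx => by
    have hxI : x ∈ Ioo 0 (2 * π) := ⟨hx.1, by linarith [hx.2]⟩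
    have hx2 : 0 < x / 2 := by linarith [hx.1]
    set β := (x / 2) ^ (1 / 3 : ℝ) with hβdef
    have hβ : 0 < β := rpow_pos_of_pos hx2 _
    have hβ3 : β ^ 3 = x / 2 := by
      rw [hβdef, ← rpow_natCast, ← rpow_mul hx2.le]; norm_num
    have hsin : β ^ 3 / 8 ≤ dispersion x := by
      rw [dispersion_eq hxI, hβ3]
      refine le_trans ?_ (mul_le_sin hx2.le (by linarith [hx.2]))
      have : 1 / 8 ≤ 2 / π := by
        rw [div_le_div_iff₀ (by norm_num) hpi]; linarith [pi_lt_four]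
      nlinarith
    have h3 : dispersion x ^ (-(1 / 3) : ℝ) ≤ 2 * β⁻¹ := by
      calc _ ≤ ((β / 2) ^ 3) ^ (-(1 / 3) : ℝ) := by
            refine rpow_le_rpow_of_nonpos (by positivity) ?_ (by norm_num)
            rw [div_pow]; linarith
        _ = _ := by
            rw [← rpow_natCast, ← rpow_mul (by positivity)]
            norm_num
            rw [rpow_neg_one, inv_div]; ring
    -- The weight is at most 2β⁻¹. With the constant 1/100 this lies below 2β⁻¹/5 for small β, and
    -- below 2/9 as soon as β⁻¹ ≤ 10.
    rcases le_total β (1 / 10) with h | h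
    · refine le_trans (ENNReal.ofReal_le_ofReal ?_)
        ((K1far_row_ge_end hβ h).trans_eq (by rw [hβ3, mul_div_cancel₀ x two_ne_zero]))
      have : 0 < β⁻¹ := by positivity
      linarith
    · refine le_trans (ENNReal.ofReal_le_ofReal ?_) (K1far_row_ge_bulk hx)
      have : β⁻¹ ≤ 10 := by
        rw [inv_le_comm₀ hβ (by norm_num)]; linarith
      linarith
  refine ⟨1 / 100, by norm_num, fun x hx => ?_⟩
  rcases le_or_gt x π with h | h
  · exact key x ⟨hx.1, h⟩
  · have := key (2 * π - x) ⟨by linarith [hx.2], by linarith⟩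
    rw [dispersion_reflect] at this
    refine this.trans_eq ?_
    rw [← lintegral_reflect]
    simp only [K1far_reflect]

/-! ### Lower bounds for `V` and `W`. -/

lemma two_thirds_le_K2 {x y : ℝ} (hx : x ∈ Ioo 0 (2 * π)) (hy : y ∈ Ioo 0 (2 * π)) :
    2 / 3 ≤ K2 x y := by
  have h0 : 0 < Fplus x y := by
    have := mul_pos (sin_half_pos hx) (sin_half_pos hy)
    rw [Fplus]
    nlinarith [sq_nonneg (cos (x / 2) + cos (y / 2))]
  rw [K2]
  refine div_le_div_of_nonneg_left two_pos.le (sqrt_pos.2 h0) (sqrt_le_iff.2 ⟨by norm_num, ?_⟩)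
  have h1 := abs_le.1 (abs_cos_le_one (x / 2))
  have h2 := abs_le.1 (abs_cos_le_one (y / 2))
  have h3 := abs_le.1 (abs_sin_le_one (x / 2))
  have h4 := abs_le.1 (abs_sin_le_one (y / 2))
  rw [Fplus]
  nlinarith

lemma four_le_V {x : ℝ} (hx : x ∈ Ioo 0 (2 * π)) : 4 ≤ V x := by
  have hpi := pi_gt_three
  calc (4 : ℝ) ≤ ∫ _, (2 / 3 : ℝ) ∂cellMeasure := by
        rw [integral_const, cellMeasure_eq_Ioo, measureReal_restrict_apply_univ, Real.volume_real_Ioo,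
          max_eq_left (by linarith), smul_eq_mul]
        linarith
    _ ≤ V x := integral_mono_ae (integrable_const _) (integrable_K2 hx) (by
        filter_upwards [cell_ae] with y hy using two_thirds_le_K2 hx hy)

/-- The collision frequency is bounded below by its order at the ends of the cell. -/
theorem exists_le_V : ∃ c : ℝ, 0 < c ∧ c ≤ 1 ∧
    ∀ x ∈ Ioo 0 (2 * π), c * dispersion x ^ (-(1 / 3) : ℝ) ≤ V x := by
  have hpi := pi_pos
  have hw := w0_pos
  -- Below the threshold b the limit of βV gives V ≥ w₀/(2β), while for β ≥ b the uniform bound V ≥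
  -- 4 suffices. This explains the three entries of the minimum; the entry 1 only serves the later
  -- normalisation c ≤ 1.
  obtain ⟨b, hb, hsub⟩ := mem_nhdsGT_iff_exists_Ioo_subset.1
    (tendsto_V_end.eventually_const_lt (by linarith : w0 / 2 < w0))
  have hb : 0 < b := hb
  have key : ∀ x ∈ Ioc 0 π, min 1 (min (w0 / 4) b) * dispersion x ^ (-(1 / 3) : ℝ) ≤ V x :=
    fun x hx => by
    have hxI : x ∈ Ioo 0 (2 * π) := ⟨hx.1, by linarith [hx.2]⟩
    have hx2 : 0 < x / 2 := by linarith [hx.1]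
    set β := (x / 2) ^ (1 / 3 : ℝ) with hβdef
    have hβ : 0 < β := rpow_pos_of_pos hx2 _
    have hβ3 : β ^ 3 = x / 2 := by
      rw [hβdef, ← rpow_natCast, ← rpow_mul hx2.le]; norm_num
    have hsin : (β / 2) ^ 3 ≤ dispersion x := by
      rw [dispersion_eq hxI, div_pow, hβ3]
      refine le_trans ?_ (mul_le_sin hx2.le (by linarith [hx.2]))
      have : 1 / 8 ≤ 2 / π := by
        rw [div_le_div_iff₀ (by norm_num) hpi]; linarith [pi_lt_four]
      nlinarith
    have h3 : dispersion x ^ (-(1 / 3) : ℝ) ≤ 2 * β⁻¹ := by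
      calc _ ≤ ((β / 2) ^ 3) ^ (-(1 / 3) : ℝ) :=
            rpow_le_rpow_of_nonpos (by positivity) hsin (by norm_num)
        _ = _ := by
            rw [← rpow_natCast, ← rpow_mul (by positivity)]
            norm_num
            rw [rpow_neg_one, inv_div]; ring
    have hm : 0 < min 1 (min (w0 / 4) b) := by positivity
    have hd := rpow_nonneg (dispersion_nonneg x) (-(1 / 3) : ℝ)
    rcases lt_or_ge β b with h | h
    · have h4 : w0 / 2 < β * V (2 * β ^ 3) := hsub ⟨hβ, h⟩
      rw [hβ3, mul_div_cancel₀ x two_ne_zero] at h4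
      have hm2 : min 1 (min (w0 / 4) b) ≤ w0 / 4 := (min_le_right _ _).trans (min_le_left _ _)
      calc _ ≤ w0 / 4 * (2 * β⁻¹) := by gcongr
        _ = w0 / 2 * β⁻¹ := by ring
        _ ≤ (β * V x) * β⁻¹ := by gcongr
        _ = V x := by field_simp
    · have hm2 : min 1 (min (w0 / 4) b) ≤ b := (min_le_right _ _).trans (min_le_right _ _)
      calc _ ≤ b * (2 * β⁻¹) := by gcongr
        _ ≤ β * (2 * β⁻¹) := by gcongr
        _ = 2 := by field_simp
        _ ≤ V x := by linarith [four_le_V hxI]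
  refine ⟨min 1 (min (w0 / 4) b), by positivity, min_le_left _ _, fun x hx => ?_⟩
  rcases le_or_gt x π with h | h
  · exact key x ⟨hx.1, h⟩
  · have := key (2 * π - x) ⟨by linarith [hx.2], by linarith⟩
    rwa [dispersion_reflect, V_reflect] at this

lemma exists_le_W : ∃ c : ℝ, 0 < c ∧ c ≤ 1 ∧
    ∀ x ∈ Ioo 0 (2 * π), c * dispersion x ^ (5 / 3 : ℝ) ≤ W x := by
  obtain ⟨c, hc, hc1, h⟩ := exists_le_V
  refine ⟨c, hc, hc1, fun x hx => ?_⟩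
  have hs := dispersion_pos hx
  calc c * dispersion x ^ (5 / 3 : ℝ)
      = dispersion x ^ 2 * (c * dispersion x ^ (-(1 / 3) : ℝ)) := by
        rw [mul_left_comm, ← rpow_natCast, ← rpow_add hs]; norm_num
    _ ≤ _ := by rw [W]; gcongr; exact h x hx

end FPU
end

noncomputable section

namespace FPU

open Real Set
open scoped ENNReal NNReal

/-! ### Fibre integration of the resonance relation -/

/-- The weight `|cos(c/2) - cos(d/2)|` on the resonant manifold in terms of `a` and `c`. -/
def gapWeight (x z : ℝ) : ℝ :=
  |cos (z / 2) - (√(Fplus x z) - tan ((x - z) / 4) * (sin (x / 2) - sin (z / 2))) / 2|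

lemma sqrt_Fplus_pa_pc {p : ℝ × ℝ} (hp : p ∈ square) :
    √(Fplus (pa p) (pc p)) = cos (pd p / 2) - cos (pb p / 2) := by
  have hr := radius_pos hp
  have h1 : 1 ≤ radius p ^ 2 := by
    rw [radius, sq_sqrt] <;>
      nlinarith [mul_pos (cos_pos_of_mem_Ioo hp.1) (cos_pos_of_mem_Ioo hp.2)]
  rw [Fplus_pa_pc hp, sqrt_sq (div_nonneg (by linarith [sin_le_one p.1]) hr.le), cos_pd hp,
    cos_pb hp, radius_sq, sin_sub_half]
  ring

lemma sin_pa_sub_sin_pc {p : ℝ × ℝ} (hp : p ∈ square) :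
    sin (pa p / 2) - sin (pc p / 2) = sin (pd p / 2) - sin (pb p / 2) := by
  rw [sin_pa hp, sin_pb hp, sin_pc hp, sin_pd hp]; ring

/-- The square root of F₊ is cos(d/2) - cos(b/2), and this expression is minus their sum. Together
they recover cos(d/2) from a and c alone, which is how `gapWeight` is built. -/
lemma tan_mul_sin_sub {p : ℝ × ℝ} (hp : p ∈ square) :
    tan ((pa p - pc p) / 4) * (sin (pa p / 2) - sin (pc p / 2))
      = -(cos (pd p / 2) + cos (pb p / 2)) := by
  have h1 := hp.1.1
  have h2 := hp.1.2
  have e1 : (pa p - pc p) / 4 = (p.1 / 2 - π / 4) + π / 2 := by rw [pa, pc]; ring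
  have e2 : (pd p / 2 - pb p / 2) / 2 = p.1 / 2 - π / 4 := by rw [pd, pb]; ring
  have hs : sin (p.1 / 2 - π / 4) ≠ 0 :=
    (sin_neg_of_neg_of_neg_pi_lt (by linarith) (by linarith [pi_pos])).ne
  rw [sin_pa_sub_sin_pc hp, sin_sub_sin, cos_add_cos, e1, e2, tan_eq_sin_div_cos, sin_add_pi_div_two,
    cos_add_pi_div_two]
  generalize p.1 / 2 - π / 4 = t at *
  field_simp

lemma gapWeight_pa_pc {p : ℝ × ℝ} (hp : p ∈ square) :
    gapWeight (pa p) (pc p) = |cos (pc p / 2) - cos (pd p / 2)| := by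
  rw [gapWeight, sqrt_Fplus_pa_pc hp, tan_mul_sin_sub hp]
  congr 2; ring

/-- The weight |cos(c/2) - cos(d/2)| is a function of (a, c) and also of (a, b). In the second form
it cancels the singularity of `K1`. -/
lemma sqrt_Fminus_pa_pb {p : ℝ × ℝ} (hp : p ∈ square) :
    √(Fminus (pa p) (pb p)) = |cos (pc p / 2) - cos (pd p / 2)| := by
  rw [Fminus_pa_pb hp, sqrt_sq_eq_abs, ← abs_neg, cos_pc hp, cos_pd hp]
  congr 1; ring

lemma measurable_gapWeight : Measurable fun q : ℝ × ℝ => gapWeight q.1 q.2 := by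
  unfold gapWeight Fplus
  simp only [tan_eq_sin_div_cos]
  fun_prop

open Classical in
/-- The kernel of the distribution of `(a, c)` on the resonant manifold. -/
def K2half (x z : ℝ) : ℝ := if z < x then K2 x z else 0

open Classical in
/-- The kernel of the distribution of `(a, b)` on the resonant manifold. -/
def K1half (x y : ℝ) : ℝ := if 2 * π < x + y then K1 x y else 0

lemma K2half_nonneg (x z : ℝ) : 0 ≤ K2half x z := by
  unfold K2half; split_ifs; exacts [K2_nonneg x z, le_rfl]

lemma K1half_nonneg (x z : ℝ) : 0 ≤ K1half x z := by
  unfold K1half; split_ifs; exacts [K1_nonneg x z, le_rfl]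

lemma measurable_K2half : Measurable fun q : ℝ × ℝ => K2half q.1 q.2 :=
  Measurable.ite (measurableSet_lt measurable_snd measurable_fst) measurable_K2 measurable_const

lemma measurable_K1half : Measurable fun q : ℝ × ℝ => K1half q.1 q.2 :=
  Measurable.ite (measurableSet_lt measurable_const (by fun_prop)) measurable_K1 measurable_const

lemma cellMeasure_prod_Ioo : cellMeasure.prod cellMeasure
    = volume.restrict (Ioo 0 (2 * π) ×ˢ Ioo 0 (2 * π)) := by
  rw [cellMeasure_eq_Ioo, Measure.prod_restrict]; rfl

lemma map_pa_pc : resMeasure.map (fun p => (pa p, pc p)) =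
    (cellMeasure.prod cellMeasure).withDensity fun q => ENNReal.ofReal (K2half q.1 q.2) := by
  have hk := measurable_K2half
  refine Measure.ext_of_lintegral _ fun Φ hΦ => ?_
  rw [lintegral_map hΦ (measurable_pa.prodMk measurable_pc), lintegral_pa_pc hΦ,
    lintegral_withDensity_eq_lintegral_mul _ (by fun_prop) hΦ, cellMeasure_prod_Ioo,
    ← lintegral_indicator (measurableSet_Ioo.prod measurableSet_Ioo)]
  refine lintegral_congr fun q => ?_
  by_cases h : 0 < q.2 ∧ q.2 < q.1 ∧ q.1 < 2 * π
  · rw [indicator_of_mem (by exact h), indicator_of_mem (by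
      exact ⟨⟨h.1.trans h.2.1, h.2.2⟩, h.1, h.2.1.trans h.2.2⟩), Pi.mul_apply, K2half, if_pos h.2.1]
  · rw [indicator_of_notMem (by exact h)]
    by_cases h2 : q ∈ Ioo 0 (2 * π) ×ˢ Ioo 0 (2 * π)
    · rw [indicator_of_mem h2, Pi.mul_apply, K2half, if_neg, ENNReal.ofReal_zero, zero_mul]
      exact fun h3 => h ⟨h2.2.1, h3, h2.1.2⟩
    · rw [indicator_of_notMem h2]

lemma map_pa_pb : resMeasure.map (fun p => (pa p, pb p)) =
    (cellMeasure.prod cellMeasure).withDensity fun q => ENNReal.ofReal (K1half q.1 q.2) := by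
  have hk := measurable_K1half
  refine Measure.ext_of_lintegral _ fun Φ hΦ => ?_
  rw [lintegral_map hΦ (measurable_pa.prodMk measurable_pb), lintegral_pa_pb hΦ,
    lintegral_withDensity_eq_lintegral_mul _ (by fun_prop) hΦ, cellMeasure_prod_Ioo,
    ← lintegral_indicator (measurableSet_Ioo.prod measurableSet_Ioo)]
  refine lintegral_congr fun q => ?_
  by_cases h : 0 < q.1 ∧ q.1 < 2 * π ∧ 0 < q.2 ∧ q.2 < 2 * π ∧ 2 * π < q.1 + q.2
  · rw [indicator_of_mem (by exact h), indicator_of_mem (by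
      exact ⟨⟨h.1, h.2.1⟩, h.2.2.1, h.2.2.2.1⟩), Pi.mul_apply, K1half, if_pos h.2.2.2.2]
  · rw [indicator_of_notMem (by exact h)]
    by_cases h2 : q ∈ Ioo 0 (2 * π) ×ˢ Ioo 0 (2 * π)
    · rw [indicator_of_mem h2, Pi.mul_apply, K1half, if_neg, ENNReal.ofReal_zero, zero_mul]
      exact fun h3 => h ⟨h2.1.1, h2.1.2, h2.2.1, h2.2.2, h3⟩
    · rw [indicator_of_notMem h2]

lemma integrable_of_map {e : ℝ × ℝ → ℝ × ℝ} (he : Measurable e) {k : ℝ → ℝ → ℝ}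
    (hk : Measurable fun q : ℝ × ℝ => k q.1 q.2) (hk0 : ∀ x y, 0 ≤ k x y)
    (hmap : resMeasure.map e =
      (cellMeasure.prod cellMeasure).withDensity fun q => ENNReal.ofReal (k q.1 q.2))
    {Φ : ℝ × ℝ → ℝ} (hΦ : Measurable Φ) (hi : Integrable (fun p => Φ (e p)) resMeasure) :
    Integrable (fun q => k q.1 q.2 * Φ q) (cellMeasure.prod cellMeasure) := by
  have h := (integrable_map_measure hΦ.aestronglyMeasurable he.aemeasurable).2 hi
  rw [hmap, integrable_withDensity_iff_integrable_smul' (by fun_prop)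
    (Eventually.of_forall fun q => ENNReal.ofReal_lt_top)] at h
  simpa only [ENNReal.toReal_ofReal (hk0 _ _), smul_eq_mul] using h

lemma integral_of_map {e : ℝ × ℝ → ℝ × ℝ} (he : Measurable e) {k : ℝ → ℝ → ℝ}
    (hk : Measurable fun q : ℝ × ℝ => k q.1 q.2) (hk0 : ∀ x y, 0 ≤ k x y)
    (hmap : resMeasure.map e =
      (cellMeasure.prod cellMeasure).withDensity fun q => ENNReal.ofReal (k q.1 q.2))
    {Φ : ℝ × ℝ → ℝ} (hΦ : Measurable Φ) :
    ∫ p, Φ (e p) ∂resMeasure = ∫ q, k q.1 q.2 * Φ q ∂(cellMeasure.prod cellMeasure) := by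
  rw [← integral_map he.aemeasurable hΦ.aestronglyMeasurable, hmap,
    integral_withDensity_eq_integral_toReal_smul (by fun_prop)
      (Eventually.of_forall fun q => ENNReal.ofReal_lt_top)]
  simp only [ENNReal.toReal_ofReal (hk0 _ _), smul_eq_mul]

/-- The weighted kernels that express `f` through its integrals when `f` solves the resonance
relation. -/
def lossKernel (x z : ℝ) : ℝ := K2half x z * gapWeight x z

def gainKernel (x y : ℝ) : ℝ := K1half x y * √(Fminus x y)

lemma measurable_lossKernel : Measurable fun q : ℝ × ℝ => lossKernel q.1 q.2 :=
  measurable_K2half.mul measurable_gapWeight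

lemma measurable_gainKernel : Measurable fun q : ℝ × ℝ => gainKernel q.1 q.2 :=
  measurable_K1half.mul measurable_Fminus.sqrt

/-- Multiply the relation by |cos(c/2) - cos(d/2)| and by the indicator of a ∈ S, and integrate over
the manifold. The laws of (a, c) and (a, b) turn the terms into integrals of the loss and gain
kernels over S. As S is arbitrary, f(x) is expressed almost everywhere through integrals of f. -/
theorem ae_eq_of_defect {f : ℝ → ℝ} (hf : Measurable f) (hV : MemLp f 2 VMeasure)
    (h0 : ∀ᵐ p ∂resMeasure, f (pa p) + f (pb p) = f (pc p) + f (pd p)) :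
    ∀ᵐ x ∂cellMeasure, f x * ∫ z, lossKernel x z ∂cellMeasure
      = 2 * ∫ z, lossKernel x z * f z ∂cellMeasure - ∫ y, gainKernel x y * f y ∂cellMeasure := by
  have ha := measurable_pa
  have hb := measurable_pb
  have hc := measurable_pc
  have hd := measurable_pd
  have hw2 := measurable_gapWeight
  have hFm := measurable_Fminus
  have hac : Measurable fun p => (pa p, pc p) := ha.prodMk hc
  have hab : Measurable fun p => (pa p, pb p) := ha.prodMk hb
  set w : ℝ × ℝ → ℝ := fun p => |cos (pc p / 2) - cos (pd p / 2)| with hw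
  have hwm : Measurable w := by fun_prop
  have hwb : ∀ p, ‖w p‖ ≤ 2 := fun p => by
    rw [hw, norm_eq_abs, abs_abs, abs_le]
    constructor <;> linarith [cos_le_one (pc p / 2), cos_le_one (pd p / 2),
      neg_one_le_cos (pc p / 2), neg_one_le_cos (pd p / 2)]
  have hint : ∀ {e : ℝ × ℝ → ℝ}, MemLp (fun p => f (e p)) 2 resMeasure →
      Integrable (fun p => w p * f (e p)) resMeasure := fun he =>
    (he.integrable (by norm_num)).bdd_mul hwm.aestronglyMeasurable (Eventually.of_forall hwb)
  have iA := hint (memLp_comp_pa hV)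
  have iB := hint (memLp_comp_pb hV)
  have iC := hint (memLp_comp_pc hV)
  have iD := hint (memLp_comp_pd hV)
  have hwac : ∀ᵐ p ∂resMeasure, w p = gapWeight (pa p) (pc p) := by
    filter_upwards [resMeasure_ae_mem] with p hp using (gapWeight_pa_pc hp).symm
  have hwab : ∀ᵐ p ∂resMeasure, w p = √(Fminus (pa p) (pb p)) := by
    filter_upwards [resMeasure_ae_mem] with p hp using (sqrt_Fminus_pa_pb hp).symm
  -- integrability on the product
  have jA : Integrable (fun q : ℝ × ℝ => lossKernel q.1 q.2 * f q.1) (cellMeasure.prod cellMeasure) := by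
    have := integrable_of_map hac measurable_K2half K2half_nonneg map_pa_pc
      (Φ := fun q => gapWeight q.1 q.2 * f q.1) (by fun_prop)
      (iA.congr (by filter_upwards [hwac] with p hp; rw [hp]))
    simpa only [lossKernel, mul_assoc] using this
  have jC : Integrable (fun q : ℝ × ℝ => lossKernel q.1 q.2 * f q.2) (cellMeasure.prod cellMeasure) := by
    have := integrable_of_map hac measurable_K2half K2half_nonneg map_pa_pc
      (Φ := fun q => gapWeight q.1 q.2 * f q.2) (by fun_prop)
      (iC.congr (by filter_upwards [hwac] with p hp; rw [hp]))
    simpa only [lossKernel, mul_assoc] using this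
  have jB : Integrable (fun q : ℝ × ℝ => gainKernel q.1 q.2 * f q.2) (cellMeasure.prod cellMeasure) := by
    have := integrable_of_map hab measurable_K1half K1half_nonneg map_pa_pb
      (Φ := fun q => √(Fminus q.1 q.2) * f q.2) (by fun_prop)
      (iB.congr (by filter_upwards [hwab] with p hp; rw [hp]))
    simpa only [gainKernel, mul_assoc] using this
  have hmain : ∀ S, MeasurableSet S →
      ∫ x in S, (∫ z, lossKernel x z * f x ∂cellMeasure) ∂cellMeasure
        + ∫ x in S, (∫ y, gainKernel x y * f y ∂cellMeasure) ∂cellMeasure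
      = 2 * ∫ x in S, (∫ z, lossKernel x z * f z ∂cellMeasure) ∂cellMeasure := fun S hS => by
    have hSm : Measurable (S.indicator fun _ => (1 : ℝ)) := measurable_const.indicator hS
    have hSb : ∀ x, ‖S.indicator (fun _ => (1 : ℝ)) x‖ ≤ 1 := fun x => by
      by_cases hx : x ∈ S <;> simp [hx]
    have push : ∀ {G : ℝ × ℝ → ℝ}, Integrable G (cellMeasure.prod cellMeasure) →
        ∫ q, S.indicator (fun _ => (1 : ℝ)) q.1 * G q ∂(cellMeasure.prod cellMeasure)
        = ∫ x in S, (∫ z, G (x, z) ∂cellMeasure) ∂cellMeasure := fun {G} hG => by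
      rw [integral_prod _ (hG.bdd_mul (f := fun q => S.indicator (fun _ => (1 : ℝ)) q.1) (c := 1)
        (hSm.comp measurable_fst).aestronglyMeasurable (Eventually.of_forall fun q => hSb q.1)),
        ← integral_indicator hS]
      refine integral_congr_ae (Eventually.of_forall fun x => ?_)
      by_cases hx : x ∈ S <;> simp [hx]
    have sint : ∀ {e : ℝ × ℝ → ℝ}, Integrable (fun p => w p * f (e p)) resMeasure →
        Integrable (fun p => S.indicator (fun _ => (1 : ℝ)) (pa p) * (w p * f (e p))) resMeasure :=
      fun he => he.bdd_mul (c := 1) (hSm.comp ha).aestronglyMeasurable (Eventually.of_forall fun q => hSb _)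
    have tA : ∫ p, S.indicator (fun _ => (1 : ℝ)) (pa p) * (w p * f (pa p)) ∂resMeasure
        = ∫ x in S, (∫ z, lossKernel x z * f x ∂cellMeasure) ∂cellMeasure := by
      rw [← push jA]
      refine (integral_congr_ae (g := fun p => S.indicator (fun _ => (1 : ℝ)) (pa p) *
        (gapWeight (pa p) (pc p) * f (pa p))) ?_).trans ?_
      · filter_upwards [hwac] with p hp; rw [hp]
      · rw [integral_of_map hac measurable_K2half K2half_nonneg map_pa_pc
          (Φ := fun q => S.indicator (fun _ => (1 : ℝ)) q.1 * (gapWeight q.1 q.2 * f q.1))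
          (by fun_prop)]
        congr 1; ext q; rw [lossKernel]; ring
    have tC : ∫ p, S.indicator (fun _ => (1 : ℝ)) (pa p) * (w p * f (pc p)) ∂resMeasure
        = ∫ x in S, (∫ z, lossKernel x z * f z ∂cellMeasure) ∂cellMeasure := by
      rw [← push jC]
      refine (integral_congr_ae (g := fun p => S.indicator (fun _ => (1 : ℝ)) (pa p) *
        (gapWeight (pa p) (pc p) * f (pc p))) ?_).trans ?_
      · filter_upwards [hwac] with p hp; rw [hp]
      · rw [integral_of_map hac measurable_K2half K2half_nonneg map_pa_pc
          (Φ := fun q => S.indicator (fun _ => (1 : ℝ)) q.1 * (gapWeight q.1 q.2 * f q.2))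
          (by fun_prop)]
        congr 1; ext q; rw [lossKernel]; ring
    have tB : ∫ p, S.indicator (fun _ => (1 : ℝ)) (pa p) * (w p * f (pb p)) ∂resMeasure
        = ∫ x in S, (∫ z, gainKernel x z * f z ∂cellMeasure) ∂cellMeasure := by
      rw [← push jB]
      refine (integral_congr_ae (g := fun p => S.indicator (fun _ => (1 : ℝ)) (pa p) *
        (√(Fminus (pa p) (pb p)) * f (pb p))) ?_).trans ?_
      · filter_upwards [hwab] with p hp; rw [hp]
      · rw [integral_of_map hab measurable_K1half K1half_nonneg map_pa_pb
          (Φ := fun q => S.indicator (fun _ => (1 : ℝ)) q.1 * (√(Fminus q.1 q.2) * f q.2))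
          (by fun_prop)]
        congr 1; ext q; rw [gainKernel]; ring
    -- Exchanging u and v fixes a and the weight and exchanges c with d.
    have tD : ∫ p, S.indicator (fun _ => (1 : ℝ)) (pa p) * (w p * f (pd p)) ∂resMeasure
        = ∫ p, S.indicator (fun _ => (1 : ℝ)) (pa p) * (w p * f (pc p)) ∂resMeasure := by
      rw [← integral_comp_swap (Ψ := fun p => S.indicator (fun _ => (1 : ℝ)) (pa p) *
        (w p * f (pc p))) (by fun_prop)]
      simp only [hw, pa_swap, pc_swap, pd_swap, abs_sub_comm]
    have hsum : ∫ p, S.indicator (fun _ => (1 : ℝ)) (pa p) * (w p * f (pa p)) ∂resMeasure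
        + ∫ p, S.indicator (fun _ => (1 : ℝ)) (pa p) * (w p * f (pb p)) ∂resMeasure
        = ∫ p, S.indicator (fun _ => (1 : ℝ)) (pa p) * (w p * f (pc p)) ∂resMeasure
        + ∫ p, S.indicator (fun _ => (1 : ℝ)) (pa p) * (w p * f (pd p)) ∂resMeasure := by
      rw [← integral_add (sint iA) (sint iB), ← integral_add (sint iC) (sint iD)]
      refine integral_congr_ae ?_
      filter_upwards [h0] with p hp
      rw [← mul_add, ← mul_add, ← mul_add, ← mul_add, hp]
    rw [← tA, ← tB, ← tC, hsum, tD, two_mul]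
  have hae := Integrable.ae_eq_of_forall_setIntegral_eq _ _
    (jA.integral_prod_left.add jB.integral_prod_left) (jC.integral_prod_left.const_mul 2)
    (fun S hS _ => by
      have h1 := hmain S hS
      rw [← integral_add jA.integral_prod_left.integrableOn jB.integral_prod_left.integrableOn,
        ← integral_const_mul] at h1
      exact h1)
  filter_upwards [hae] with x hx
  simp only [Pi.add_apply] at hx
  rw [integral_mul_const] at hx
  linarith

end FPU
end

noncomputable section

namespace FPU

open Real Set
open scoped ENNReal NNReal

/-! ### Continuity of solutions of the resonance relation -/

lemma cell_ae_ne (x : ℝ) : ∀ᵐ z ∂cellMeasure, z ≠ x := by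
  rw [cellMeasure]; exact ae_restrict_of_ae (Measure.ae_ne volume x)

lemma Fplus_pos {x z : ℝ} (hx : x ∈ Ioo 0 (2 * π)) (hz : z ∈ Ioo 0 (2 * π)) : 0 < Fplus x z := by
  have := mul_pos (sin_half_pos hx) (sin_half_pos hz)
  rw [Fplus]
  nlinarith [sq_nonneg (cos (x / 2) + cos (z / 2))]

lemma continuousAt_gapWeight {x z : ℝ} (hx : x ∈ Ioo 0 (2 * π)) (hz : z ∈ Ioo 0 (2 * π)) :
    ContinuousAt (fun q : ℝ × ℝ => gapWeight q.1 q.2) (x, z) := by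
  have hc : cos ((x - z) / 4) ≠ 0 := (cos_pos_of_mem_Ioo ⟨by linarith [hx.1, hz.2, pi_pos],
    by linarith [hx.2, hz.1, pi_pos]⟩).ne'
  have ht : ContinuousAt (fun q : ℝ × ℝ => tan ((q.1 - q.2) / 4)) (x, z) :=
    (continuousAt_tan.2 hc).comp_of_eq (f := fun q : ℝ × ℝ => (q.1 - q.2) / 4) (by fun_prop) rfl
  have hF : Continuous fun q : ℝ × ℝ => √(Fplus q.1 q.2) := by unfold Fplus; fun_prop
  have h1 : Continuous fun q : ℝ × ℝ => cos (q.2 / 2) := by fun_prop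
  have h2 : Continuous fun q : ℝ × ℝ => sin (q.1 / 2) - sin (q.2 / 2) := by fun_prop
  exact (h1.continuousAt.sub ((hF.continuousAt.sub (ht.mul h2.continuousAt)).div_const 2)).abs

lemma continuousAt_gapWeight_left {x z : ℝ} (hx : x ∈ Ioo 0 (2 * π)) (hz : z ∈ Ioo 0 (2 * π)) :
    ContinuousAt (fun x => gapWeight x z) x :=
  ContinuousAt.comp (f := fun x => (x, z)) (continuousAt_gapWeight hx hz) (by fun_prop)

lemma continuousAt_gapWeight_right {x z : ℝ} (hx : x ∈ Ioo 0 (2 * π)) (hz : z ∈ Ioo 0 (2 * π)) :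
    ContinuousAt (fun z => gapWeight x z) z :=
  ContinuousAt.comp (f := fun z => (x, z)) (continuousAt_gapWeight hx hz) (by fun_prop)

lemma gapWeight_nonneg (x z : ℝ) : 0 ≤ gapWeight x z := abs_nonneg _

lemma lossKernel_nonneg (x z : ℝ) : 0 ≤ lossKernel x z :=
  mul_nonneg (K2half_nonneg x z) (gapWeight_nonneg x z)

/-- The tangent blows up only when x - z approaches 2π, hence the bound is uniform for x up to any b
< 2π. -/
lemma gapWeight_le {b x z : ℝ} (hb : b < 2 * π) (hxb : x ≤ b) (hz : 0 < z) (hzx : z < x) :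
    gapWeight x z ≤ 1 + (3 + tan (b / 4) * 2) / 2 := by
  have h1 : √(Fplus x z) ≤ 3 := by
    refine sqrt_le_iff.2 ⟨by norm_num, ?_⟩
    have h1 := abs_le.1 (abs_cos_le_one (x / 2))
    have h2 := abs_le.1 (abs_cos_le_one (z / 2))
    have h3 := abs_le.1 (abs_sin_le_one (x / 2))
    have h4 := abs_le.1 (abs_sin_le_one (z / 2))
    rw [Fplus]
    nlinarith
  have ht0 : 0 < tan ((x - z) / 4) := tan_pos_of_pos_of_lt_pi_div_two (by linarith) (by linarith)
  have ht : tan ((x - z) / 4) < tan (b / 4) :=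
    tan_lt_tan_of_nonneg_of_lt_pi_div_two (by linarith) (by linarith) (by linarith)
  have h2 : |tan ((x - z) / 4) * (sin (x / 2) - sin (z / 2))| ≤ tan (b / 4) * 2 := by
    rw [abs_mul, abs_of_pos ht0]
    refine mul_le_mul ht.le ?_ (abs_nonneg _) (by linarith)
    rw [abs_le]
    constructor <;> linarith [sin_le_one (x / 2), sin_le_one (z / 2), neg_one_le_sin (x / 2),
      neg_one_le_sin (z / 2)]
  have h3 := abs_le.1 h2
  have h4 := abs_le.1 (abs_cos_le_one (z / 2))
  have h5 := sqrt_nonneg (Fplus x z)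
  rw [gapWeight, abs_le]
  constructor <;> linarith

lemma continuousAt_lossKernel {x z : ℝ} (hx : x ∈ Ioo 0 (2 * π)) (hz : z ∈ Ioo 0 (2 * π))
    (hne : z ≠ x) : ContinuousAt (fun x => lossKernel x z) x := by
  refine ContinuousAt.mul ?_ (continuousAt_gapWeight_left hx hz)
  rcases lt_or_gt_of_ne hne with h | h
  · have h1 : ContinuousAt (fun x => K2 x z) x := by
      unfold K2
      refine continuousAt_const.div ?_ (sqrt_pos.2 (Fplus_pos hx hz)).ne'
      unfold Fplus; fun_prop
    refine h1.congr ?_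
    filter_upwards [lt_mem_nhds h] with t ht
    rw [K2half, if_pos ht]
  · refine continuousAt_const.congr (f := fun _ => (0 : ℝ)) ?_
    filter_upwards [gt_mem_nhds h] with t ht
    rw [K2half, if_neg (by exact not_lt.2 (le_of_lt ht))]

lemma exists_lossKernel_le {x₀ : ℝ} (hx : x₀ ∈ Ioo 0 (2 * π)) :
    ∃ C : ℝ, 0 ≤ C ∧ ∀ᶠ x in 𝓝 x₀, ∀ z ∈ Ioo 0 (2 * π),
      lossKernel x z ≤ C * dispersion z ^ (-(1 / 2) : ℝ) := by
  set b := (x₀ + 2 * π) / 2 with hb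
  have hb2 : b < 2 * π := by linarith [hx.2]
  have hd0 := dispersion_pos hx
  have hcont : ContinuousAt dispersion x₀ := by unfold dispersion; fun_prop
  have ht : 0 < tan (b / 4) :=
    tan_pos_of_pos_of_lt_pi_div_two (by linarith [hx.1, pi_pos]) (by linarith)
  refine ⟨(dispersion x₀ / 2) ^ (-(1 / 2) : ℝ) * (1 + (3 + tan (b / 4) * 2) / 2), by positivity, ?_⟩
  filter_upwards [Ioo_mem_nhds hx.1 (by linarith [hx.2] : x₀ < b),
    hcont.eventually_const_lt (by linarith : dispersion x₀ / 2 < dispersion x₀)] with x hxb hxd z hz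
  have hxI : x ∈ Ioo 0 (2 * π) := ⟨hxb.1, hxb.2.trans hb2⟩
  have hdz := rpow_pos_of_pos (dispersion_pos hz) (-(1 / 2) : ℝ)
  by_cases hzx : z < x
  · rw [lossKernel, K2half, if_pos hzx]
    calc K2 x z * gapWeight x z ≤ ((dispersion x₀ / 2) ^ (-(1 / 2) : ℝ) *
          dispersion z ^ (-(1 / 2) : ℝ)) * (1 + (3 + tan (b / 4) * 2) / 2) := by
          refine mul_le_mul ((K2_le hxI hz).trans ?_) (gapWeight_le hb2 hxb.2.le hz.1 hzx)
            (gapWeight_nonneg _ _) (by positivity)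
          refine mul_le_mul_of_nonneg_right ?_ hdz.le
          exact rpow_le_rpow_of_nonpos (by linarith) hxd.le (by norm_num)
      _ = _ := by ring
  · rw [lossKernel, K2half, if_neg hzx, zero_mul]
    positivity

/-- Dominated convergence: the loss kernel is locally bounded in x by a multiple of ω(z)^(-1/2) and
is discontinuous only on the diagonal. -/
lemma continuousOn_lossIntegral {f : ℝ → ℝ} (hf : Measurable f)
    (hi : Integrable (fun z => dispersion z ^ (-(1 / 2) : ℝ) * f z) cellMeasure) :
    ContinuousOn (fun x => ∫ z, lossKernel x z * f z ∂cellMeasure) (Ioo 0 (2 * π)) := by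
  intro x₀ hx
  refine ContinuousAt.continuousWithinAt ?_
  obtain ⟨C, hC, hle⟩ := exists_lossKernel_le hx
  have hm := measurable_lossKernel
  refine continuousAt_of_dominated (bound := fun z => C * ‖dispersion z ^ (-(1 / 2) : ℝ) * f z‖) ?_ ?_
    (hi.norm.const_mul C) ?_
  · exact Eventually.of_forall fun x => Measurable.aestronglyMeasurable
      ((hm.comp (measurable_const.prodMk measurable_id)).mul hf)
  · filter_upwards [hle] with x hx
    filter_upwards [cell_ae] with z hz
    rw [norm_mul, norm_mul, ← mul_assoc, norm_of_nonneg (lossKernel_nonneg x z),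
      norm_of_nonneg (rpow_nonneg (dispersion_nonneg z) _)]
    exact mul_le_mul_of_nonneg_right (hx z hz) (norm_nonneg _)
  · filter_upwards [cell_ae, cell_ae_ne x₀] with z hz hne
    exact (continuousAt_lossKernel hx hz hne).mul continuousAt_const

lemma integrable_lossKernel {x : ℝ} (hx : x ∈ Ioo 0 (2 * π)) :
    Integrable (fun z => lossKernel x z) cellMeasure := by
  obtain ⟨C, hC, hle⟩ := exists_lossKernel_le hx
  refine ((integrable_rpow_dispersion (r := -(1 / 2)) (by norm_num)).const_mul C).mono'
    (measurable_lossKernel.comp (measurable_const.prodMk measurable_id)).aestronglyMeasurable ?_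
  filter_upwards [cell_ae] with z hz
  rw [norm_of_nonneg (lossKernel_nonneg x z)]
  exact hle.self_of_nhds z hz

lemma gapWeight_self_pos {x : ℝ} (hx : x ∈ Ioo 0 (2 * π)) : 0 < gapWeight x x := by
  have h : √(Fplus x x) = 2 := by
    rw [show Fplus x x = 2 ^ 2 by rw [Fplus]; nlinarith [sin_sq_add_cos_sq (x / 2)],
      sqrt_sq two_pos.le]
  rw [gapWeight, h, sub_self, sub_self, mul_zero, abs_pos]
  intro h2
  have h3 : cos (x / 2) = 1 := by linarith
  have := (cos_lt_cos_of_nonneg_of_le_pi le_rfl (by linarith [hx.2]) (by linarith [hx.1] : 0 < x / 2))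
  rw [cos_zero] at this
  linarith

/-- On the diagonal the weight is 1 - cos(x/2) > 0, so the kernel is positive for z slightly below
x. This permits division by the integral. -/
lemma lossIntegral_pos {x : ℝ} (hx : x ∈ Ioo 0 (2 * π)) : 0 < ∫ z, lossKernel x z ∂cellMeasure := by
  rw [integral_pos_iff_support_of_nonneg (fun z => lossKernel_nonneg x z) (integrable_lossKernel hx)]
  have h1 : ∀ᶠ z in 𝓝[<] x, 0 < gapWeight x z ∧ z ∈ Ioo 0 (2 * π) :=
    nhdsWithin_le_nhds (((continuousAt_gapWeight_right hx hx).eventually_const_lt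
      (gapWeight_self_pos hx)).and (Ioo_mem_nhds hx.1 hx.2))
  obtain ⟨l, hl, hsub⟩ := mem_nhdsLT_iff_exists_Ioo_subset.1 h1
  have hl : l < x := hl
  have hsupp : Ioo l x ⊆ Function.support fun z => lossKernel x z := fun z hz => by
    obtain ⟨h2, h3⟩ := hsub hz
    rw [Function.mem_support, lossKernel, K2half, if_pos hz.2, K2]
    exact (mul_pos (div_pos two_pos (sqrt_pos.2 (Fplus_pos hx h3))) h2).ne'
  refine lt_of_lt_of_le ?_ (measure_mono hsupp)
  rw [cellMeasure_eq_Ioo, Measure.restrict_apply measurableSet_Ioo,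
    inter_eq_left.2 fun z hz => (hsub hz).2, Real.volume_Ioo]
  simpa using hl

/-- After the cancellation the gain kernel is 4 times an indicator. -/
lemma gainKernel_eq (x y : ℝ) :
    gainKernel x y = if 2 * π < x + y ∧ 0 < Fminus x y then 4 else 0 := by
  rw [gainKernel, K1half, K1]
  by_cases h1 : 2 * π < x + y <;> by_cases h2 : 0 < Fminus x y
  · rw [if_pos h1, if_pos h2, if_pos ⟨h1, h2⟩, div_mul_cancel₀ _ (sqrt_pos.2 h2).ne']
  all_goals simp [h1, h2]

/-- After reflection F₋ = 0 says that the strictly decreasing ratio of `ratio_injOn` equals 1. So,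
as x varies through a given point, the gain indicator jumps for only a null set of y. -/
lemma Fminus_zero_subsingleton {x : ℝ} (hx : x ∈ Ioo 0 (2 * π)) :
    {y | y ∈ Ioo 0 (2 * π) ∧ 2 * π < x + y ∧ Fminus x y = 0}.Subsingleton := by
  have ha : (2 * π - x) / 2 ∈ Ioo 0 π := ⟨by linarith [hx.2], by linarith [hx.1]⟩
  have hsa := sin_pos_of_mem_Ioo ha
  have key : ∀ y, y ∈ Ioo 0 (2 * π) → 2 * π < x + y → Fminus x y = 0 →
      2 * π - y ∈ Ioo 0 (2 * (π - (2 * π - x) / 2)) ∧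
      (cos ((2 * π - x) / 2) + cos ((2 * π - y) / 2)) ^ 2 /
        (4 * sin ((2 * π - x) / 2) * sin ((2 * π - y) / 2)) = 1 := fun y hy h1 h2 => by
    refine ⟨⟨by linarith [hy.2], by linarith⟩, ?_⟩
    have hsy := sin_half_pos (reflect_mem.2 hy)
    rw [← Fminus_reflect, Fminus] at h2
    rw [div_eq_one_iff_eq (by positivity)]
    linarith
  rintro y ⟨hy, h1, h2⟩ z ⟨hz, h3, h4⟩
  obtain ⟨m1, e1⟩ := key y hy h1 h2
  obtain ⟨m2, e2⟩ := key z hz h3 h4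
  have := (ratio_injOn ha).injOn m1 m2 (e1.trans e2.symm)
  linarith

lemma continuousOn_gainIntegral {f : ℝ → ℝ} (hf : Measurable f) (hi : Integrable f cellMeasure) :
    ContinuousOn (fun x => ∫ y, gainKernel x y * f y ∂cellMeasure) (Ioo 0 (2 * π)) := by
  intro x₀ hx
  refine ContinuousAt.continuousWithinAt ?_
  have hm := measurable_gainKernel
  refine continuousAt_of_dominated (bound := fun z => 4 * ‖f z‖) ?_ ?_ (hi.norm.const_mul 4) ?_
  · exact Eventually.of_forall fun x => Measurable.aestronglyMeasurable
      ((hm.comp (measurable_const.prodMk measurable_id)).mul hf)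
  · refine Eventually.of_forall fun x => Eventually.of_forall fun y => ?_
    rw [norm_mul]
    gcongr
    rw [gainKernel_eq]
    split_ifs <;> norm_num
  · have hnull : ∀ᵐ y ∂cellMeasure, ¬ (y ∈ Ioo 0 (2 * π) ∧ 2 * π < x₀ + y ∧ Fminus x₀ y = 0) := by
      rw [cellMeasure]
      refine ae_restrict_of_ae ?_
      rw [ae_iff]
      simp only [not_not]
      exact (Fminus_zero_subsingleton hx).measure_zero _
    filter_upwards [cell_ae, cell_ae_ne (2 * π - x₀), hnull] with y hy hne hF
    refine ContinuousAt.mul ?_ continuousAt_const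
    simp only [gainKernel_eq]
    have hcF : ContinuousAt (fun x => Fminus x y) x₀ := by unfold Fminus; fun_prop
    have hcs : ContinuousAt (fun x => x + y) x₀ := by fun_prop
    rcases lt_or_gt_of_ne (show x₀ + y ≠ 2 * π from fun h => hne (by linarith)) with h | h
    · refine continuousAt_const.congr (f := fun _ => (0 : ℝ)) ?_
      filter_upwards [hcs.eventually_lt_const h] with x hx
      rw [if_neg fun h => by linarith [h.1]]
    · rcases lt_or_gt_of_ne (show Fminus x₀ y ≠ 0 from fun h2 => hF ⟨hy, h, h2⟩) with h2 | h2
      · refine continuousAt_const.congr (f := fun _ => (0 : ℝ)) ?_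
        filter_upwards [hcF.eventually_lt_const h2] with x hx
        rw [if_neg fun h => by linarith [h.2]]
      · refine continuousAt_const.congr (f := fun _ => (4 : ℝ)) ?_
        filter_upwards [hcF.eventually_const_lt h2, hcs.eventually_const_lt h] with x hx1 hx2
        rw [if_pos ⟨hx2, hx1⟩]

/-- Solutions of the resonance relation are continuous in the open cell. -/
theorem exists_continuousOn_of_defect {f : ℝ → ℝ} (hf : Measurable f) (hV : MemLp f 2 VMeasure)
    (hi : Integrable (fun z => dispersion z ^ (-(1 / 2) : ℝ) * f z) cellMeasure)
    (h0 : ∀ᵐ p ∂resMeasure, f (pa p) + f (pb p) = f (pc p) + f (pd p)) :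
    ∃ g : ℝ → ℝ, ContinuousOn g (Ioo 0 (2 * π)) ∧ f =ᵐ[cellMeasure] g := by
  have hi1 : Integrable f cellMeasure := by
    refine hi.mono hf.aestronglyMeasurable ?_
    filter_upwards [cell_ae] with z hz
    have h1 := dispersion_pos hz
    have h2 : 1 ≤ dispersion z ^ (-(1 / 2) : ℝ) :=
      one_le_rpow_of_pos_of_le_one_of_nonpos h1 (dispersion_le_one z) (by norm_num)
    rw [norm_mul, norm_of_nonneg (r := dispersion z ^ (-(1 / 2) : ℝ)) (by linarith)]
    nlinarith [norm_nonneg (f z)]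
  have hc1 := continuousOn_lossIntegral (f := fun _ => 1) measurable_const
    (by simpa using integrable_rpow_dispersion (r := -(1 / 2)) (by norm_num))
  simp only [mul_one] at hc1
  refine ⟨fun x => (2 * ∫ z, lossKernel x z * f z ∂cellMeasure
    - ∫ y, gainKernel x y * f y ∂cellMeasure) / ∫ z, lossKernel x z ∂cellMeasure, ?_, ?_⟩
  · exact ((continuousOn_const.mul (continuousOn_lossIntegral hf hi)).sub
      (continuousOn_gainIntegral hf hi1)).div hc1 fun x hx => (lossIntegral_pos hx).ne'
  · filter_upwards [ae_eq_of_defect hf hV h0, cell_ae] with x hx hxI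
    rw [← hx, mul_div_cancel_right₀ _ (lossIntegral_pos hxI).ne']

end FPU
end

noncomputable section

namespace FPU

open Real Set
open scoped ENNReal NNReal ComplexConjugate

/-! ### There are no odd collision invariants -/

/-- A maximum principle. -/
lemma eq_zero_of_max_principle {g : ℝ → ℝ} (hc : ContinuousOn g (Ioo 0 (2 * π)))
    (h1 : ∀ x ∈ Ioo 0 (2 * π), g (2 * π - x) = -g x) (h2 : ∀ x ∈ Ioo 0 π, g (π - x) = -g x)
    (h3 : ∀ x ∈ Ioo 0 (π / 2), ∃ c ∈ Ioo 0 (2 * π), ∃ d ∈ Ioo 0 (2 * π), d < x ∧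
      -2 * g x = g c + g d) : ∀ x ∈ Ioo 0 (2 * π), g x = 0 := by
  have hpi := pi_pos
  have gpi : g π = 0 := by
    have := h1 π ⟨hpi, by linarith⟩
    rw [show 2 * π - π = π by ring] at this
    linarith
  have gpi2 : g (π / 2) = 0 := by
    have := h2 (π / 2) ⟨by linarith, by linarith⟩
    rw [show π - π / 2 = π / 2 by ring] at this
    linarith
  -- The two symmetries together give periodicity with period π. Control of g at the end 0, where
  -- continuity is not assumed, is thereby moved to the interior point π.
  have hper : ∀ x ∈ Ioo 0 π, g (π + x) = g x := fun x hx => by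
    have := h1 (π - x) ⟨by linarith [hx.2], by linarith [hx.1]⟩
    rw [show 2 * π - (π - x) = π + x by ring, h2 x hx, neg_neg] at this
    exact this
  obtain ⟨x₁, hx₁, hmax⟩ := (isCompact_Icc (a := π / 2) (b := π)).exists_isMaxOn
    (nonempty_Icc.2 (by linarith))
    ((hc.mono fun x hx => ⟨by linarith [hx.1], by linarith [hx.2]⟩).abs)
  have hle : ∀ x ∈ Ioo 0 (2 * π), |g x| ≤ |g x₁| := by
    have hA : ∀ x ∈ Ioc 0 π, |g x| ≤ |g x₁| := fun x hx => by
      rcases le_or_gt (π / 2) x with h | h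
      · exact hmax ⟨h, hx.2⟩
      · have := h2 x ⟨hx.1, by linarith⟩
        rw [← abs_neg, ← this]
        exact hmax ⟨by linarith, by linarith [hx.1]⟩
    intro x hx
    rcases le_or_gt x π with h | h
    · exact hA x ⟨hx.1, h⟩
    · rw [← abs_neg, ← h1 x hx]
      exact hA _ ⟨by linarith [hx.2], by linarith⟩
  suffices hM : |g x₁| = 0 from fun x hx => abs_eq_zero.1
    (le_antisymm ((hle x hx).trans_eq hM) (abs_nonneg _))
  by_contra hne
  have hM : 0 < |g x₁| := lt_of_le_of_ne (abs_nonneg _) (Ne.symm hne)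
  -- Near 0, g(x) = g(π + x) is close to g(π) = 0, so the maximum of |g| is not approached at 0 and
  -- a leftmost maximum point exists.
  obtain ⟨δ, hδ, hsmall⟩ : ∃ δ > 0, ∀ x ∈ Ioo 0 π, x < δ → |g x| < |g x₁| := by
    have hcp : ContinuousAt (fun x => |g x|) π :=
      (hc.continuousAt (Ioo_mem_nhds hpi (by linarith))).abs
    have := hcp.eventually_lt_const (u := |g x₁|) (by simpa [gpi] using hM)
    obtain ⟨δ, hδ, h⟩ := Metric.eventually_nhds_iff.1 this
    refine ⟨δ, hδ, fun x hx hxδ => ?_⟩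
    rw [← hper x hx]
    refine h ?_
    rw [dist_eq, add_sub_cancel_left, abs_of_pos hx.1]
    exact hxδ
  have hKc : IsCompact {x | x ∈ Icc (min δ (π / 2)) π ∧ |g x| = |g x₁|} := by
    have hcont : ContinuousOn (fun x => |g x|) (Icc (min δ (π / 2)) π) :=
      (hc.mono fun x hx => ⟨lt_of_lt_of_le (lt_min hδ (by linarith)) hx.1,
        by linarith [hx.2]⟩).abs
    exact isCompact_Icc.of_isClosed_subset
      (hcont.preimage_isClosed_of_isClosed isClosed_Icc isClosed_singleton) fun x hx => hx.1
  obtain ⟨x₀, ⟨hx₀, hg₀⟩, hmin⟩ := hKc.exists_isLeast ⟨x₁, ⟨(min_le_right _ _).trans hx₁.1, hx₁.2⟩, rfl⟩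
  have hx₀0 : 0 < x₀ := lt_of_lt_of_le (lt_min hδ (by linarith)) hx₀.1
  have hno : ∀ y ∈ Ioo 0 π, y < x₀ → |g y| ≠ |g x₁| := fun y hy hlt heq => by
    rcases lt_or_ge y (min δ (π / 2)) with h | h
    · exact (hsmall y hy (h.trans_le (min_le_left _ _))).ne heq
    · exact (hmin ⟨⟨h, hy.2.le⟩, heq⟩).not_gt hlt
  have hxpi : x₀ ≠ π := fun h => by rw [h, gpi, abs_zero] at hg₀; exact hM.ne hg₀
  have hx₀pi : x₀ < π := lt_of_le_of_ne hx₀.2 hxpi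
  have hx2 : x₀ ≠ π / 2 := fun h => by rw [h, gpi2, abs_zero] at hg₀; exact hM.ne hg₀
  have hlt : x₀ < π / 2 := by
    by_contra hcon
    have h4 : π / 2 < x₀ := lt_of_le_of_ne (not_lt.1 hcon) (Ne.symm hx2)
    refine hno (π - x₀) ⟨by linarith, by linarith⟩ (by linarith) ?_
    rw [h2 x₀ ⟨hx₀0, hx₀pi⟩, abs_neg, hg₀]
  -- At the leftmost maximum point, |g(c) + g(d)| is twice the maximum. Hence d < x₀ is a maximum
  -- point too, a contradiction.
  obtain ⟨c, hcI, d, hd, hdx, hrel⟩ := h3 x₀ ⟨hx₀0, hlt⟩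
  refine hno d ⟨hd.1, by linarith⟩ hdx (le_antisymm (hle d hd) ?_)
  have h5 : 2 * |g x₁| ≤ |g c| + |g d| := by
    rw [← hg₀, ← abs_two, ← abs_mul, ← abs_neg, ← neg_mul, hrel]
    exact abs_add_le _ _
  linarith [hle c hcI]

lemma continuousOn_phase : ContinuousOn phase square := by
  intro p hp
  have h := (cos_pos_of_mem hp).1.ne'
  refine ContinuousAt.continuousWithinAt ?_
  have : ContinuousAt (fun p : ℝ × ℝ => cos ((p.2 - p.1) / 2) / cos ((p.1 + p.2) / 2)) p :=
    ContinuousAt.div (by fun_prop) (by fun_prop) h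
  exact continuous_arctan.continuousAt.comp this

lemma ae_square_of_ae_resMeasure {P : ℝ × ℝ → Prop} (h : ∀ᵐ p ∂resMeasure, P p) :
    ∀ᵐ p ∂volume.restrict square, P p := by
  refine (withDensity_absolutelyContinuous' (μ := volume.restrict square)
    (f := fun p => ENNReal.ofReal (4 / radius p)) ?_ ?_).ae_le h
  · have := measurable_radius
    exact Measurable.aemeasurable (by fun_prop)
  · filter_upwards [ae_restrict_mem measurableSet_square] with p hp
    have := radius_pos hp
    simp only [ne_eq, ENNReal.ofReal_eq_zero, not_le]
    positivity

lemma ae_comp_of_ae_cell {e : ℝ × ℝ → ℝ} (he : Measurable e) (hle : resMeasure.map e ≤ VMeasure)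
    {P : ℝ → Prop} (h : ∀ᵐ x ∂cellMeasure, P x) : ∀ᵐ p ∂resMeasure, P (e p) := by
  refine ae_of_ae_map he.aemeasurable ?_
  exact (Measure.absolutelyContinuous_of_le hle).ae_le
    ((withDensity_absolutelyContinuous _ _).ae_le h)

/-- The continuous representative satisfies the relation at every point of the square, so it can be
evaluated on curves. The lines v = 0 and u = -v supply the hypotheses of the maximum principle. -/
theorem ae_eq_zero_of_odd_of_defect {f : ℝ → ℝ} (hf : Measurable f) (hV : MemLp f 2 VMeasure)
    (hi : Integrable (fun z => dispersion z ^ (-(1 / 2) : ℝ) * f z) cellMeasure)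
    (h0 : ∀ᵐ p ∂resMeasure, f (pa p) + f (pb p) = f (pc p) + f (pd p))
    (hodd : ∀ᵐ x ∂cellMeasure, f (2 * π - x) = -f x) : ∀ᵐ x ∂cellMeasure, f x = 0 := by
  have hpi := pi_pos
  obtain ⟨g, hg, hfg⟩ := exists_continuousOn_of_defect hf hV hi h0
  have hgodd : ∀ x ∈ Ioo 0 (2 * π), g (2 * π - x) = -g x := by
    have hae : (fun x => g (2 * π - x)) =ᵐ[volume.restrict (Ioo 0 (2 * π))] fun x => -g x := by
      rw [← cellMeasure_eq_Ioo]
      filter_upwards [hfg, measurePreserving_reflect_cell.quasiMeasurePreserving.ae hfg, hodd]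
        with x e1 e2 e3
      rw [← e1, ← e2, e3]
    exact Measure.eqOn_open_of_ae_eq hae isOpen_Ioo
      (hg.comp (by fun_prop) fun x hx => reflect_mem.2 hx) hg.neg
  have hgres : ∀ p ∈ square, g (pa p) + g (pb p) = g (pc p) + g (pd p) := by
    have hae : (fun p => g (pa p) + g (pb p)) =ᵐ[volume.restrict square]
        fun p => g (pc p) + g (pd p) := by
      refine ae_square_of_ae_resMeasure ?_
      filter_upwards [h0, ae_comp_of_ae_cell measurable_pa map_pa_le hfg,
        ae_comp_of_ae_cell measurable_pb (map_pb.trans_le map_pa_le) hfg,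
        ae_comp_of_ae_cell measurable_pc map_pc_le hfg,
        ae_comp_of_ae_cell measurable_pd (map_pd.trans_le map_pc_le) hfg] with p e0 e1 e2 e3 e4
      rw [← e1, ← e2, ← e3, ← e4, e0]
    have hph := continuousOn_phase
    refine Measure.eqOn_open_of_ae_eq hae isOpen_square
      ((hg.comp ?_ fun p => pa_mem).add (hg.comp ?_ fun p => pb_mem))
      ((hg.comp ?_ fun p => pc_mem).add (hg.comp ?_ fun p => pd_mem))
    · unfold pa; fun_prop
    · unfold pb; fun_prop
    · unfold pc; fun_prop
    · unfold pd; fun_prop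
  have hzero : ∀ x ∈ Ioo 0 (2 * π), g x = 0 := by
    refine eq_zero_of_max_principle hg hgodd (fun x hx => ?_) fun x hx => ?_
    -- For v = 0 the phase is π/4 and (a, b, c, d) = (2π - x, π + x, x, π - x). Oddness then gives
    -- g(π - x) = -g(x).
    · have hu : (π / 2 - x, (0 : ℝ)) ∈ square :=
        ⟨⟨by simp only; linarith [hx.2], by simp only; linarith [hx.1]⟩, by
          simp only; constructor <;> linarith⟩
      have hph : phase (π / 2 - x, 0) = π / 4 := by
        have hcp := (cos_pos_of_mem hu).1
        simp only [add_zero] at hcp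
        rw [phase]
        simp only [zero_sub, add_zero, neg_div, cos_neg]
        rw [div_self hcp.ne', arctan_one]
      have h := hgres _ hu
      simp only [pa, pb, pc, pd, hph] at h
      have e1 := hgodd x ⟨hx.1, by linarith [hx.2]⟩
      have e2 := hgodd (π - x) ⟨by linarith [hx.2], by linarith [hx.1]⟩
      ring_nf at h e1 e2 ⊢
      linarith
    · set θ := x / 2 with hθ
      have hθ0 : 0 < θ := by linarith [hx.1]
      have hθ4 : θ < π / 4 := by linarith [hx.2]
      have ht0 : 0 < tan θ := tan_pos_of_pos_of_lt_pi_div_two hθ0 (by linarith)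
      have ht1 : tan θ < 1 := by
        rw [← tan_pi_div_four]
        exact tan_lt_tan_of_nonneg_of_lt_pi_div_two hθ0.le (by linarith) hθ4
      -- On u = -v the phase is arctan(cos v), and this choice makes it θ = x/2. Then a = b = 2π -
      -- x, and d = π - x - 2v is less than x because tan θ < sin 2θ for 0 < θ < π/4.
      set v := arccos (tan θ) with hv
      have hv0 : 0 ≤ v := arccos_nonneg _
      have hv2 : v < π / 2 := arccos_lt_pi_div_two.2 ht0
      have hcv : cos v = tan θ := cos_arccos (by linarith) ht1.le
      have hmem : (-v, v) ∈ square :=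
        ⟨⟨by simp only; linarith, by simp only; linarith⟩, by
          simp only; constructor <;> linarith⟩
      have hph : phase (-v, v) = θ := by
        rw [phase]
        simp only [neg_add_cancel, zero_div, cos_zero, div_one, sub_neg_eq_add, add_self_div_two]
        rw [hcv, arctan_tan (by linarith) (by linarith)]
      refine ⟨pc (-v, v), pc_mem hmem, pd (-v, v), pd_mem hmem, ?_, ?_⟩
      · have h2 : sin (π / 2 - v) < sin (2 * θ) := by
          rw [sin_pi_div_two_sub, hcv, sin_two_mul, tan_eq_sin_div_cos]
          have hs : 0 < sin θ := sin_pos_of_pos_of_lt_pi hθ0 (by linarith)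
          have hc : 0 < cos θ := cos_pos_of_mem_Ioo ⟨by linarith, by linarith⟩
          have hcs : sin θ < cos θ := by
            rw [tan_eq_sin_div_cos, div_lt_one hc] at ht1; exact ht1
          rw [div_lt_iff₀ hc]
          have h5 : 1 < 2 * cos θ * cos θ := by nlinarith [sin_sq_add_cos_sq θ]
          nlinarith
        have h3 : π / 2 - v < 2 * θ := by
          by_contra hcon
          exact h2.not_ge (sin_le_sin_of_le_of_le_pi_div_two (by linarith) (by linarith)
            (not_lt.1 hcon))
        rw [pd, hph]
        simp only
        linarith
      · have h := hgres _ hmem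
        have e1 := hgodd x ⟨hx.1, by linarith [hx.2]⟩
        have e2 : pa (-v, v) = 2 * π - x := by rw [pa, hph]; simp only; rw [hθ]; ring
        have e3 : pb (-v, v) = 2 * π - x := by rw [pb, hph]; simp only; rw [hθ]; ring
        rw [e2, e3, e1] at h
        linarith
  filter_upwards [hfg, cell_ae] with x e1 e2
  rw [e1, hzero x e2]

end FPU
end

noncomputable section

namespace FPU

open Real Set
open scoped ENNReal NNReal ComplexConjugate

/-! ### A spectral gap criterion -/

section Gap

variable {H : Type*} [NormedAddCommGroup H] [InnerProductSpace ℂ H] [CompleteSpace H]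
  [TopologicalSpace.SeparableSpace H]

lemma exists_weak_subseq (x : ℕ → H) (hx : ∀ n, ‖x n‖ ≤ 1) : ∃ z : H, ∃ φ : ℕ → ℕ, StrictMono φ ∧
    ∀ y : H, Tendsto (fun n => inner ℂ (x (φ n)) y) atTop (𝓝 (inner ℂ z y)) := by
  have hmem : ∀ n, StrongDual.toWeakDual (InnerProductSpace.toDual ℂ H (x n)) ∈
      WeakDual.toStrongDual ⁻¹' Metric.closedBall (0 : StrongDual ℂ H) 1 := fun n => by
    rw [mem_preimage, mem_closedBall_zero_iff]
    change ‖InnerProductSpace.toDual ℂ H (x n)‖ ≤ 1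
    rw [LinearIsometryEquiv.norm_map]
    exact hx n
  obtain ⟨l, -, φ, hφ, hl⟩ := WeakDual.isSeqCompact_closedBall ℂ H 0 1 hmem
  refine ⟨(InnerProductSpace.toDual ℂ H).symm (WeakDual.toStrongDual l), φ, hφ, fun y => ?_⟩
  have h := ((WeakDual.eval_continuous y).tendsto l).comp hl
  rw [InnerProductSpace.toDual_symm_apply]
  exact h

/-- If there is no gap, normalised odd vectors u with ⟨u, Su⟩ → 0 have a weak limit z. It is odd
and, by weak lower semicontinuity of the form, a null vector, so z = 0. Then the completely
continuous part C tends to 0 along u, and the coercive part forces c ≤ 0. -/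
theorem exists_gap {S C R : H →L[ℂ] H} (hsymm : ∀ x y, inner ℂ (S x) y = inner ℂ x (S y))
    (hnonneg : ∀ x, 0 ≤ (inner ℂ x (S x)).re) {c : ℝ} (hc : 0 < c)
    (hle : ∀ x, c * ‖x‖ ^ 2 + (inner ℂ x (C x)).re ≤ (inner ℂ x (S x)).re)
    (hC : ∀ x : ℕ → H, (∀ n, ‖x n‖ ≤ 1) → (∀ y, Tendsto (fun n => inner ℂ (x n) y) atTop (𝓝 0)) →
      Tendsto (fun n => C (x n)) atTop (𝓝 0))
    (hR : ∀ x y, inner ℂ (R x) y = inner ℂ x (R y))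
    (hker : ∀ x, R x = -x → (inner ℂ x (S x)).re = 0 → x = 0) :
    ∃ c' : ℝ, 0 < c' ∧ ∀ x, R x = -x → c' * ‖x‖ ^ 2 ≤ (inner ℂ x (S x)).re := by
  by_contra! hcon
  have hex : ∀ n : ℕ, ∃ u : H, ‖u‖ = 1 ∧ R u = -u ∧ (inner ℂ u (S u)).re < 1 / ((n : ℝ) + 1) := by
    intro n
    obtain ⟨x, hRx, hx⟩ := hcon (1 / ((n : ℝ) + 1)) (by positivity)
    have hx0 : x ≠ 0 := fun h => by simp [h] at hx
    have hxn : 0 < ‖x‖ := norm_pos_iff.2 hx0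
    refine ⟨((‖x‖⁻¹ : ℝ) : ℂ) • x, ?_, ?_, ?_⟩
    · rw [norm_smul, Complex.norm_real, norm_inv, norm_norm, inv_mul_cancel₀ hxn.ne']
    · rw [map_smul, hRx, smul_neg]
    · rw [map_smul, inner_smul_left, inner_smul_right, Complex.conj_ofReal, Complex.re_ofReal_mul,
        Complex.re_ofReal_mul, ← mul_assoc, ← sq, inv_pow, inv_mul_lt_iff₀ (by positivity), mul_comm]
      exact hx
  choose u hu1 hRu hSu using hex
  obtain ⟨z, φ, hφ, hz⟩ := exists_weak_subseq u fun n => (hu1 n).le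
  have hSlim : Tendsto (fun n => (inner ℂ (u (φ n)) (S (u (φ n)))).re) atTop (𝓝 0) := by
    refine squeeze_zero (fun n => hnonneg _) (fun n => (hSu (φ n)).le) ?_
    exact tendsto_one_div_add_atTop_nhds_zero_nat.comp hφ.tendsto_atTop
  have hRz : R z = -z := by
    refine ext_inner_right ℂ fun y => ?_
    have h1 := hz (R y)
    have h2 := (hz y).neg
    rw [hR, inner_neg_left]
    refine tendsto_nhds_unique h1 (h2.congr fun n => ?_)
    rw [← hR, hRu, inner_neg_left]
  have hSz : (inner ℂ z (S z)).re = 0 := by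
    refine le_antisymm ?_ (hnonneg z)
    -- Expand 0 ≤ ⟨u - z, S(u - z)⟩ and pass to the limit; the result is 0 ≤ -⟨z, Sz⟩.
    have h1 := (hSlim.sub (((Complex.continuous_re.tendsto _).comp (hz (S z))).const_mul 2)).add_const
      (inner ℂ z (S z)).re
    have h2 : 0 ≤ 0 - 2 * (inner ℂ z (S z)).re + (inner ℂ z (S z)).re := by
      refine ge_of_tendsto' h1 fun n => ?_
      have h3 := hnonneg (u (φ n) - z)
      have h4 : (inner ℂ z (S (u (φ n)))).re = (inner ℂ (u (φ n)) (S z)).re := by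
        rw [← hsymm, ← inner_conj_symm, Complex.conj_re]
      rw [map_sub, inner_sub_left, inner_sub_right, inner_sub_right, Complex.sub_re, Complex.sub_re,
        Complex.sub_re, h4] at h3
      simp only [Function.comp_apply]
      linarith
    linarith
  have hz0 := hker z hRz hSz
  have hCu := hC (fun n => u (φ n)) (fun n => (hu1 _).le) fun y => by
    have := hz y
    rwa [hz0, inner_zero_left] at this
  have h5 : Tendsto (fun n => (inner ℂ (u (φ n)) (C (u (φ n)))).re) atTop (𝓝 0) := by
    refine squeeze_zero_norm (fun n => ?_) (tendsto_zero_iff_norm_tendsto_zero.1 hCu)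
    calc _ ≤ ‖inner ℂ (u (φ n)) (C (u (φ n)))‖ := Complex.abs_re_le_norm _
      _ ≤ ‖u (φ n)‖ * ‖C (u (φ n))‖ := norm_inner_le_norm _ _
      _ = _ := by rw [hu1, one_mul]
  have h6 : c ≤ 0 := by
    have h7 := hSlim.sub h5
    rw [sub_zero] at h7
    refine ge_of_tendsto' h7 fun n => ?_
    have := hle (u (φ n))
    rw [hu1] at this
    linarith
  linarith

end Gap

/-! ### The reflection -/

/-- The reflection `f ↦ f(2π - ·)` on `L²(I)`. -/
def reflectL2 : L2 →L[ℂ] L2 :=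
  (Lp.compMeasurePreservingₗᵢ ℂ (fun x : ℝ => 2 * π - x)
    measurePreserving_reflect_cell).toContinuousLinearMap

lemma reflectL2_coeFn (f : L2) : reflectL2 f =ᵐ[cellMeasure] fun x => f (2 * π - x) :=
  Lp.coeFn_compMeasurePreserving f measurePreserving_reflect_cell

lemma reflectL2_symm (f g : L2) : inner ℂ (reflectL2 f) g = inner ℂ f (reflectL2 g) := by
  rw [inner_L2_eq, inner_L2_eq, ← integral_reflect]
  refine integral_congr_ae ?_
  filter_upwards [reflectL2_coeFn g,
    measurePreserving_reflect_cell.quasiMeasurePreserving.ae (reflectL2_coeFn f)] with x h1 h2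
  rw [h1, h2, sub_sub_cancel]

/-- Odd functions with respect to the midpoint of the cell. -/
def IsOdd (f : L2) : Prop := reflectL2 f = -f

lemma isOdd_iff {f : L2} : IsOdd f ↔ ∀ᵐ x ∂cellMeasure, f (2 * π - x) = -f x := by
  constructor
  · intro h
    have h1 := reflectL2_coeFn f
    rw [h] at h1
    filter_upwards [h1, Lp.coeFn_neg f] with x h2 h3
    rw [← h2, h3, Pi.neg_apply]
  · intro h
    refine Lp.ext ?_
    filter_upwards [h, reflectL2_coeFn f, Lp.coeFn_neg f] with x h1 h2 h3
    rw [h2, h1, h3, Pi.neg_apply]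

/-! ### Square integrable kernels -/

instance : TopologicalSpace.SeparableSpace L2 := by
  have : SFinite cellMeasure := by unfold cellMeasure; infer_instance
  have : Fact ((2 : ℝ≥0∞) ≠ ⊤) := ⟨by norm_num⟩
  have := Lp.SecondCountableTopology (μ := cellMeasure) (E := ℂ) (p := 2)
  infer_instance

lemma norm_sq_eq_integral (f : L2) : ‖f‖ ^ 2 = ∫ x, ‖f x‖ ^ 2 ∂cellMeasure := by
  have h := inner_L2_eq f f
  rw [inner_self_eq_norm_sq_to_K] at h
  have h2 : ∫ x, conj (f x) * f x ∂cellMeasure = ((∫ x, ‖f x‖ ^ 2 ∂cellMeasure : ℝ) : ℂ) := by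
    refine Eq.trans ?_ integral_ofReal
    refine integral_congr_ae (Eventually.of_forall fun x => ?_)
    simp only [RCLike.ofReal_eq_complex_ofReal]
    rw [Complex.conj_mul']
    push_cast; ring
  rw [h2] at h
  simpa [← Complex.ofReal_pow] using congrArg Complex.re h

/-- An integral operator with a kernel of product type maps weakly null sequences to null
sequences. -/
theorem tendsto_kernel_of_weak {k : ℝ → ℝ → ℝ} (hk : Measurable fun q : ℝ × ℝ => k q.1 q.2)
    {a : ℝ → ℝ} (ha : MemLp a 2 cellMeasure)
    (hle : ∀ x ∈ Ioo 0 (2 * π), ∀ y ∈ Ioo 0 (2 * π), |k x y| ≤ a x * a y)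
    {C : L2 →L[ℂ] L2} (hC : ∀ f : L2, C f =ᵐ[cellMeasure] fun x => ∫ y, (k x y : ℂ) * f y ∂cellMeasure)
    (u : ℕ → L2) (hu : ∀ n, ‖u n‖ ≤ 1)
    (hw : ∀ y, Tendsto (fun n => inner ℂ (u n) y) atTop (𝓝 0)) :
    Tendsto (fun n => C (u n)) atTop (𝓝 0) := by
  have hmem : ∀ x ∈ Ioo 0 (2 * π), MemLp (fun y => (k x y : ℂ)) 2 cellMeasure := fun x hx => by
    refine (ha.const_mul (a x)).mono
      (Complex.measurable_ofReal.comp (hk.comp (measurable_const.prodMk measurable_id))).aestronglyMeasurable ?_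
    filter_upwards [cell_ae] with y hy
    rw [Complex.norm_real, norm_eq_abs]
    exact (hle x hx y hy).trans (le_abs_self _)
  have hinner : ∀ x (hx : x ∈ Ioo 0 (2 * π)) (f : L2),
      ∫ y, (k x y : ℂ) * f y ∂cellMeasure = inner ℂ ((hmem x hx).toLp _) f := fun x hx f => by
    rw [inner_L2_eq]
    refine integral_congr_ae ?_
    filter_upwards [(hmem x hx).coeFn_toLp] with y hy
    rw [hy, Complex.conj_ofReal]
  set A := ‖ha.toLp a‖ with hA
  have hnorm : ∀ x (hx : x ∈ Ioo 0 (2 * π)), ‖(hmem x hx).toLp _‖ ≤ |a x| * A := fun x hx => by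
    refine Lp.norm_le_mul_norm_of_ae_le_mul ?_
    filter_upwards [(hmem x hx).coeFn_toLp, ha.coeFn_toLp, cell_ae] with y h1 h2 hy
    rw [h1, h2, Complex.norm_real, norm_eq_abs, norm_eq_abs, ← abs_mul]
    exact (hle x hx y hy).trans (le_abs_self _)
  have hsq : Tendsto (fun n => ∫ x, ‖C (u n) x‖ ^ 2 ∂cellMeasure) atTop (𝓝 0) := by
    have hdct := tendsto_integral_of_dominated_convergence (μ := cellMeasure)
      (F := fun n x => ‖C (u n) x‖ ^ 2) (f := fun _ => (0 : ℝ)) (fun x => A ^ 2 * ‖a x‖ ^ 2)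
      (fun n => ((L2_measurable (C (u n))).norm.pow_const 2).aestronglyMeasurable)
      ((ha.integrable_norm_pow (p := 2) two_ne_zero).const_mul _) ?_ ?_
    · simpa using hdct
    · intro n
      filter_upwards [hC (u n), cell_ae] with x h1 hx
      rw [h1, hinner x hx, norm_of_nonneg (by positivity)]
      calc _ ≤ (‖(hmem x hx).toLp _‖ * ‖u n‖) ^ 2 := by gcongr; exact norm_inner_le_norm _ _
        _ ≤ (|a x| * A * 1) ^ 2 := by
          gcongr
          · exact hnorm x hx
          · exact hu n
        _ = _ := by rw [norm_eq_abs]; ring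
    · filter_upwards [ae_all_iff.2 fun n => hC (u n), cell_ae] with x h1 hx
      have h2 : ∀ n, ‖C (u n) x‖ ^ 2 = ‖inner ℂ (u n) ((hmem x hx).toLp _)‖ ^ 2 := fun n => by
        rw [h1, hinner x hx, norm_inner_symm]
      simp only [h2]
      simpa using (hw ((hmem x hx).toLp _)).norm.pow 2
  rw [tendsto_zero_iff_norm_tendsto_zero]
  have h3 := hsq.sqrt
  rw [sqrt_zero] at h3
  refine h3.congr fun n => ?_
  rw [← norm_sq_eq_integral, sqrt_sq (norm_nonneg _)]

end FPU
end

noncomputable section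

namespace FPU

open Real Set
open scoped ENNReal NNReal ComplexConjugate

/-! ### The spectral gap on odd functions -/

/-- The weight `ω^(1/6)`, for which `p L p` is bounded and has a spectral gap. -/
def gapPower (x : ℝ) : ℝ := dispersion x ^ (1 / 6 : ℝ)

lemma measurable_gapPower : Measurable gapPower := measurable_dispersion.pow_const _

lemma gapPower_ne_zero {x : ℝ} (hx : x ∈ Ioo 0 (2 * π)) : gapPower x ≠ 0 :=
  (rpow_pos_of_pos (dispersion_pos hx) _).ne'

lemma gapPower_nonneg (x : ℝ) : 0 ≤ gapPower x := rpow_nonneg (dispersion_nonneg x) _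

lemma gapPower_sq (x : ℝ) : gapPower x ^ 2 = dispersion x ^ (1 / 3 : ℝ) := by
  rw [gapPower, ← rpow_natCast, ← rpow_mul (dispersion_nonneg x)]; norm_num

lemma exists_admissible_gapPower : ∃ C : ℝ, Admissible gapPower C := by
  obtain ⟨C, hC, hV⟩ := exists_V_le_rpow
  exact ⟨C, admissible_of_rpow measurable_gapPower (r := 1 / 6) (by norm_num) hC.le
    (fun x _ => rfl) hV⟩

lemma Dominated.integrable_mul_sq {k : ℝ → ℝ → ℝ} (hk : Dominated k) {F : ℝ → ℂ}
    (hFm : Measurable F) (hF : MemLp F 2 VMeasure) :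
    Integrable (fun q : ℝ × ℝ => k q.1 q.2 * ‖F q.1‖ ^ 2) (cellMeasure.prod cellMeasure) := by
  have hkm := hk.measurable
  have hm : Measurable fun q : ℝ × ℝ => k q.1 q.2 * ‖F q.1‖ ^ 2 := by fun_prop
  refine ⟨hm.aestronglyMeasurable, ?_⟩
  rw [hasFiniteIntegral_iff_enorm, lintegral_prod _ (by fun_prop)]
  refine lt_of_le_of_lt (lintegral_mono_ae ?_) (memLp_VMeasure_lintegral hFm hF)
  filter_upwards [hk.row_le] with x hx
  have hkx : Measurable fun y => ‖k x y‖ₑ :=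
    (hkm.comp (measurable_const.prodMk measurable_id)).enorm
  simp only [enorm_mul, enorm_pow, enorm_norm]
  rw [lintegral_mul_const _ hkx]
  gcongr

lemma Dominated.row_integrable {k : ℝ → ℝ → ℝ} (hk : Dominated k) :
    ∀ᵐ x ∂cellMeasure, Integrable (fun y => k x y) cellMeasure := by
  filter_upwards [hk.row_le] with x hx
  refine ⟨(hk.measurable.comp (measurable_const.prodMk measurable_id)).aestronglyMeasurable, ?_⟩
  rw [hasFiniteIntegral_iff_enorm]
  exact hx.trans_lt ENNReal.ofReal_lt_top

/-- The quadratic form of a kernel. -/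
def kernelForm (k : ℝ → ℝ → ℝ) (F : ℝ → ℂ) : ℂ :=
  ∫ q : ℝ × ℝ, conj (F q.1) * ((k q.1 q.2 : ℂ) * F q.2) ∂(cellMeasure.prod cellMeasure)

lemma kernelForm_K1 {F : ℝ → ℂ} (hFm : Measurable F) (hF : MemLp F 2 VMeasure) :
    kernelForm K1 F = kernelForm K1far F + kernelForm K1near F := by
  rw [kernelForm, kernelForm, kernelForm, ← integral_add
    (dominated_K1far.integrable_prod hFm hF hFm hF) (dominated_K1near.integrable_prod hFm hF hFm hF)]
  congr 1; ext q
  rw [K1near]; push_cast; ring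

/-- Pointwise, Re(conj F(x) · F(y)) ≥ -(|F(x)|² + |F(y)|²)/2, and the kernel is symmetric. -/
lemma re_kernelForm_ge {k : ℝ → ℝ → ℝ} (hk : Dominated k) (hk0 : ∀ x y, 0 ≤ k x y) {F : ℝ → ℂ}
    (hFm : Measurable F) (hF : MemLp F 2 VMeasure) :
    -∫ x, (∫ y, k x y ∂cellMeasure) * ‖F x‖ ^ 2 ∂cellMeasure ≤ (kernelForm k F).re := by
  have hi := hk.integrable_mul_sq hFm hF
  have h1 : ∫ q : ℝ × ℝ, k q.1 q.2 * ‖F q.1‖ ^ 2 ∂(cellMeasure.prod cellMeasure)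
      = ∫ x, (∫ y, k x y ∂cellMeasure) * ‖F x‖ ^ 2 ∂cellMeasure := by
    rw [integral_prod _ hi]
    simp only [integral_mul_const]
  have hi2 : Integrable (fun q : ℝ × ℝ => k q.1 q.2 * ‖F q.2‖ ^ 2)
      (cellMeasure.prod cellMeasure) := by
    refine hi.swap.congr (Eventually.of_forall fun q => ?_)
    simp only [Function.comp_apply, Prod.fst_swap, Prod.snd_swap, hk.comm q.2 q.1]
  have h2 : ∫ q : ℝ × ℝ, k q.1 q.2 * ‖F q.2‖ ^ 2 ∂(cellMeasure.prod cellMeasure)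
      = ∫ q : ℝ × ℝ, k q.1 q.2 * ‖F q.1‖ ^ 2 ∂(cellMeasure.prod cellMeasure) := by
    rw [← integral_prod_swap]
    simp only [Prod.fst_swap, Prod.snd_swap, hk.comm]
  have h3 := integral_re (𝕜 := ℂ) (hk.integrable_prod hFm hF hFm hF)
  simp only [RCLike.re_to_complex] at h3
  rw [kernelForm, ← h3, neg_le_iff_add_nonneg, ← h1]
  have h4 : ∫ q : ℝ × ℝ, k q.1 q.2 * ‖F q.1‖ ^ 2 ∂(cellMeasure.prod cellMeasure)
      = ∫ q : ℝ × ℝ, (1 / 2) * (k q.1 q.2 * ‖F q.1‖ ^ 2 + k q.1 q.2 * ‖F q.2‖ ^ 2)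
        ∂(cellMeasure.prod cellMeasure) := by
    rw [integral_const_mul, integral_add hi hi2, h2]; ring
  rw [h4]
  refine le_of_le_of_eq (integral_nonneg fun q => ?_)
    (integral_add (hk.integrable_prod hFm hF hFm hF).re ((hi.add hi2).const_mul (1 / 2)))
  simp only [Pi.zero_apply]
  rw [mul_left_comm, Complex.re_ofReal_mul]
  have h5 : -(1 / 2 * (‖F q.1‖ ^ 2 + ‖F q.2‖ ^ 2)) ≤ (conj (F q.1) * F q.2).re := by
    have h6 : |(conj (F q.1) * F q.2).re| ≤ ‖F q.1‖ * ‖F q.2‖ := by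
      refine (Complex.abs_re_le_norm _).trans_eq ?_
      rw [norm_mul, RCLike.norm_conj]
    nlinarith [neg_le_of_abs_le h6, sq_nonneg (‖F q.1‖ - ‖F q.2‖)]
  nlinarith [hk0 q.1 q.2]

/-- The full row of `K1` integrates to `V` almost everywhere, and its far part already takes a share
of order ω^(-1/3). -/
lemma exists_K1near_row_le : ∃ c : ℝ, 0 < c ∧ ∀ᵐ x ∂cellMeasure,
    ∫ y, K1near x y ∂cellMeasure ≤ V x - c * dispersion x ^ (-(1 / 3) : ℝ) := by
  obtain ⟨c, hc, h⟩ := exists_le_K1far_row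
  refine ⟨c, hc, ?_⟩
  filter_upwards [cell_ae, lintegral_K1_ae, dominated_K1.row_integrable,
    dominated_K1far.row_integrable] with x hx h1 h2 h3
  have h4 := h x hx
  have hd := rpow_nonneg (dispersion_nonneg x) (-(1 / 3) : ℝ)
  rw [← ofReal_integral_eq_lintegral_ofReal h3 (Eventually.of_forall fun y => K1far_nonneg x y),
    ENNReal.ofReal_le_ofReal_iff (integral_nonneg fun y => K1far_nonneg x y)] at h4
  rw [← ofReal_integral_eq_lintegral_ofReal h2 (Eventually.of_forall fun y => K1_nonneg x y),
    ENNReal.ofReal_eq_ofReal_iff (integral_nonneg fun y => K1_nonneg x y) (V_nonneg x)] at h1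
  simp only [K1near]
  rw [integral_sub h2 h3]
  linarith

lemma kernelForm_eq_inner {k : ℝ → ℝ → ℝ} (hk : Dominated k) {p : ℝ → ℝ} {C : ℝ}
    (hp : Admissible p C) {T : L2 →L[ℂ] L2} (hT : ∀ f : L2, T f =ᵐ[cellMeasure] kernelFun k p f)
    (f : L2) : inner ℂ f (T f) = kernelForm k fun x => (p x : ℂ) * f x :=
  inner_kernelOperator hk hp hT f f

/-- Multiplication by p²V and the near part of `K1` together are at least p² c ω^(-1/3) as a form.
For p = ω^(1/6) this is exactly the constant c; the far part of `K1` and `K2` are left over. -/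
theorem exists_form_ge : ∃ c : ℝ, 0 < c ∧ ∀ {S M T1 T2 F1 : L2 →L[ℂ] L2},
    IsCollision gapPower S M T1 T2 → (∀ f : L2, F1 f =ᵐ[cellMeasure] kernelFun K1far gapPower f) →
    ∀ f : L2, c * ‖f‖ ^ 2 + (inner ℂ f ((F1 - (2 : ℂ) • T2) f)).re ≤ (inner ℂ f (S f)).re := by
  obtain ⟨c, hc, hrow⟩ := exists_K1near_row_le
  obtain ⟨C, hC⟩ := exists_admissible_gapPower
  refine ⟨c, hc, fun {S M T1 T2 F1} hS hF1 f => ?_⟩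
  have hpm := measurable_gapPower
  have hfm := L2_measurable f
  have hVm := measurable_V
  have hFm : Measurable fun x => (gapPower x : ℂ) * f x := by fun_prop
  have hF := hC.memLp f
  have h1 := kernelForm_eq_inner dominated_K1 hC hS.fst f
  have h2 := kernelForm_eq_inner dominated_K1far hC hF1 f
  rw [kernelForm_K1 hFm hF, ← h2] at h1
  rw [hS.eq, sub_apply, sub_apply, add_apply, inner_sub_right, inner_sub_right, inner_add_right, h1,
    Complex.sub_re, Complex.sub_re, Complex.add_re, Complex.add_re]
  suffices h : c * ‖f‖ ^ 2 ≤ (inner ℂ f (M f)).re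
      + (kernelForm K1near fun x => (gapPower x : ℂ) * f x).re by linarith
  have h3 := re_kernelForm_ge dominated_K1near K1near_nonneg hFm hF
  have hf2 : Integrable (fun x => ‖f x‖ ^ 2) cellMeasure :=
    (Lp.memLp f).integrable_norm_pow (p := 2) two_ne_zero
  have hint : Integrable (fun x => gapPower x ^ 2 * V x * ‖f x‖ ^ 2) cellMeasure := by
    refine (hf2.const_mul C).mono' (Measurable.aestronglyMeasurable (by fun_prop)) ?_
    filter_upwards [cell_ae] with x hx
    rw [norm_of_nonneg (mul_nonneg (mul_nonneg (sq_nonneg _) (V_nonneg x)) (sq_nonneg _))]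
    gcongr
    exact hC.le x hx
  have h4 : ∫ x, (∫ y, K1near x y ∂cellMeasure) * ‖(gapPower x : ℂ) * f x‖ ^ 2 ∂cellMeasure
      ≤ ∫ x, (gapPower x ^ 2 * V x * ‖f x‖ ^ 2 - c * ‖f x‖ ^ 2) ∂cellMeasure := by
    refine integral_mono_of_nonneg (Eventually.of_forall fun x => mul_nonneg
      (integral_nonneg fun y => K1near_nonneg x y) (sq_nonneg _)) (hint.sub (hf2.const_mul c)) ?_
    filter_upwards [hrow, cell_ae] with x hx hxI
    have hs := dispersion_pos hxI
    have e : dispersion x ^ (-(1 / 3) : ℝ) * gapPower x ^ 2 = 1 := by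
      rw [gapPower_sq, ← rpow_add hs]; norm_num
    rw [norm_mul, mul_pow, Complex.norm_real, norm_eq_abs, sq_abs]
    calc _ ≤ (V x - c * dispersion x ^ (-(1 / 3) : ℝ)) * (gapPower x ^ 2 * ‖f x‖ ^ 2) := by gcongr
      _ = gapPower x ^ 2 * V x * ‖f x‖ ^ 2
          - c * (dispersion x ^ (-(1 / 3) : ℝ) * gapPower x ^ 2) * ‖f x‖ ^ 2 := by ring
      _ = _ := by rw [e, mul_one]
  rw [integral_sub hint (hf2.const_mul c), integral_const_mul, ← norm_sq_eq_integral] at h4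
  rw [inner_self_multiplication hS.mult, Complex.ofReal_re]
  linarith

lemma memLp_rpow_dispersion {r : ℝ} (hr : -1 < 2 * r) :
    MemLp (fun x => dispersion x ^ r) 2 cellMeasure := by
  rw [memLp_two_iff_integrable_sq (measurable_dispersion.pow_const r).aestronglyMeasurable]
  refine (integrable_rpow_dispersion hr).congr (Eventually.of_forall fun x => ?_)
  simp only
  rw [← rpow_natCast, ← rpow_mul (dispersion_nonneg x), mul_comm]; norm_num

/-- The exponent -1/2 + 1/6 = -1/3 makes the bounding factor square integrable. The weight ω^(1/6)
thus gives complete continuity and still matches the order of `V`. -/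
lemma farKernel_le {x y : ℝ} (hx : x ∈ Ioo 0 (2 * π)) (hy : y ∈ Ioo 0 (2 * π)) :
    |gapPower x * (K1far x y - 2 * K2 x y) * gapPower y|
      ≤ (2 * dispersion x ^ (-(1 / 3) : ℝ)) * (2 * dispersion y ^ (-(1 / 3) : ℝ)) := by
  have h1 := K1far_le_rpow hx hy
  have h2 := K2_le hx hy
  have h3 := K1far_nonneg x y
  have h4 := K2_nonneg x y
  have hsx := dispersion_pos hx
  have hsy := dispersion_pos hy
  have h5 : |K1far x y - 2 * K2 x y|
      ≤ 4 * (dispersion x ^ (-(1 / 2) : ℝ) * dispersion y ^ (-(1 / 2) : ℝ)) := by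
    have : 0 ≤ dispersion x ^ (-(1 / 2) : ℝ) * dispersion y ^ (-(1 / 2) : ℝ) := by positivity
    rw [abs_le]; constructor <;> linarith
  have e : ∀ {t : ℝ}, 0 < t → t ^ (1 / 6 : ℝ) * t ^ (-(1 / 2) : ℝ) = t ^ (-(1 / 3) : ℝ) :=
    fun ht => by rw [← rpow_add ht]; norm_num
  rw [abs_mul, abs_mul, abs_of_nonneg (gapPower_nonneg x), abs_of_nonneg (gapPower_nonneg y)]
  calc _ ≤ gapPower x * (4 * (dispersion x ^ (-(1 / 2) : ℝ) * dispersion y ^ (-(1 / 2) : ℝ)))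
        * gapPower y := by
        have := gapPower_nonneg x
        have := gapPower_nonneg y
        gcongr
    _ = _ := by rw [← e hsx, ← e hsy, gapPower, gapPower]; ring

/-- A vanishing form means that the defect vanishes almost everywhere; the real and imaginary parts
are separately odd collision invariants. -/
theorem defect_null {F : ℝ → ℂ} (hFm : Measurable F) (hF : MemLp F 2 VMeasure)
    (hi : Integrable (fun z => (dispersion z ^ (-(1 / 2) : ℝ) : ℝ) * F z) cellMeasure)
    (hodd : ∀ᵐ x ∂cellMeasure, F (2 * π - x) = -F x)
    (h0 : ∫ p, Complex.normSq (defect F p) ∂resMeasure = 0) : ∀ᵐ x ∂cellMeasure, F x = 0 := by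
  have hd : MemLp (defect F) 2 resMeasure :=
    (((memLp_comp_pa hF).add (memLp_comp_pb hF)).sub (memLp_comp_pc hF)).sub (memLp_comp_pd hF)
  rw [integral_eq_zero_iff_of_nonneg (fun p => Complex.normSq_nonneg _) (integrable_normSq hd)] at h0
  have h1 : ∀ᵐ p ∂resMeasure, F (pa p) + F (pb p) = F (pc p) + F (pd p) := by
    filter_upwards [h0] with p hp
    have := Complex.normSq_eq_zero.1 hp
    rw [defect] at this
    linear_combination this
  have hre : ∀ᵐ x ∂cellMeasure, (F x).re = 0 := by
    refine ae_eq_zero_of_odd_of_defect (f := fun x => (F x).re) (by fun_prop) hF.re ?_ ?_ ?_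
    · refine hi.re.congr (Eventually.of_forall fun x => ?_)
      simp only [RCLike.re_to_complex, Complex.re_ofReal_mul]
    · filter_upwards [h1] with p hp using by simpa using congrArg Complex.re hp
    · filter_upwards [hodd] with x hx
      rw [hx, Complex.neg_re]
  have him : ∀ᵐ x ∂cellMeasure, (F x).im = 0 := by
    refine ae_eq_zero_of_odd_of_defect (f := fun x => (F x).im) (by fun_prop) hF.im ?_ ?_ ?_
    · refine hi.im.congr (Eventually.of_forall fun x => ?_)
      simp only [RCLike.im_to_complex, Complex.im_ofReal_mul]
    · filter_upwards [h1] with p hp using by simpa using congrArg Complex.im hp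
    · filter_upwards [hodd] with x hx
      rw [hx, Complex.neg_im]
  filter_upwards [hre, him] with x h2 h3 using Complex.ext h2 h3

lemma gapPower_reflect (x : ℝ) : gapPower (2 * π - x) = gapPower x := by
  rw [gapPower, dispersion_reflect, gapPower]

theorem exists_gap_gapPower {S M T1 T2 : L2 →L[ℂ] L2} (hS : IsCollision gapPower S M T1 T2) :
    ∃ c : ℝ, 0 < c ∧ ∀ f : L2, IsOdd f → c * ‖f‖ ^ 2 ≤ (inner ℂ f (S f)).re := by
  obtain ⟨C, hC⟩ := exists_admissible_gapPower
  obtain ⟨F1, hF1⟩ := exists_kernelOperator dominated_K1far hC fun _ => gapPower_ne_zero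
  obtain ⟨c, hc, hform⟩ := exists_form_ge
  have hnn := hS.isNonneg hC
  refine exists_gap hnn.symm hnn.nonneg hc (hform hS hF1)
    (fun u hu hw => tendsto_kernel_of_weak (a := fun x => 2 * dispersion x ^ (-(1 / 3) : ℝ))
      (k := fun x y => gapPower x * (K1far x y - 2 * K2 x y) * gapPower y) ?_
      ((memLp_rpow_dispersion (by norm_num)).const_mul 2) (fun x hx y hy => farKernel_le hx hy) ?_
      u hu hw) reflectL2_symm ?_
  · have := measurable_gapPower
    have := measurable_K1far
    have := measurable_K2
    fun_prop
  · intro f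
    change ((F1 f - (2 : ℂ) • T2 f : L2) : ℝ → ℂ) =ᵐ[cellMeasure] _
    filter_upwards [Lp.coeFn_sub (F1 f) ((2 : ℂ) • T2 f), Lp.coeFn_smul (2 : ℂ) (T2 f), hF1 f,
      hS.snd f, dominated_K1far.ae_integrable hC (fun _ => gapPower_ne_zero) f,
      dominated_K2.ae_integrable hC (fun _ => gapPower_ne_zero) f] with x h1 h2 h3 h4 h5 h6
    rw [h1, Pi.sub_apply, h2, Pi.smul_apply, h3, h4, kernelFun, kernelFun, smul_eq_mul,
      mul_left_comm, ← mul_sub, ← integral_const_mul, ← integral_sub h5 (h6.const_mul 2),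
      ← integral_const_mul]
    congr 1; ext y
    push_cast; ring
  · intro f hodd hf0
    have hodd : IsOdd f := hodd
    rw [hS.re_inner hC] at hf0
    have hpm := measurable_gapPower
    have hfm := L2_measurable f
    have hz := defect_null (F := fun x => (gapPower x : ℂ) * f x) (by fun_prop) (hC.memLp f) ?_ ?_
      (by linarith)
    · refine Lp.ext ?_
      filter_upwards [hz, cell_ae, Lp.coeFn_zero ℂ 2 cellMeasure] with x h1 hx h2
      rw [h2, Pi.zero_apply]
      exact (mul_eq_zero.1 h1).resolve_left (by exact_mod_cast gapPower_ne_zero hx)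
    · have h1 : MemLp (fun x => ((dispersion x ^ (-(1 / 3) : ℝ) : ℝ) : ℂ)) 2 cellMeasure :=
        (memLp_rpow_dispersion (by norm_num)).ofReal
      refine (h1.integrable_mul (Lp.memLp f)).congr ?_
      filter_upwards [cell_ae] with x hx
      have e : dispersion x ^ (-(1 / 3) : ℝ) = dispersion x ^ (-(1 / 2) : ℝ) * gapPower x := by
        rw [gapPower, ← rpow_add (dispersion_pos hx)]; norm_num
      rw [Pi.mul_apply, e]
      push_cast; ring
    · filter_upwards [isOdd_iff.1 hodd] with x hx
      rw [hx, gapPower_reflect]; ring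

/-- The spectral gap of the weighted collision operator on odd functions. -/
theorem exists_gap_dispersion : ∃ c : ℝ, 0 < c ∧ ∀ {T M T1 T2 : L2 →L[ℂ] L2},
    IsCollision dispersion T M T1 T2 → ∀ h : L2, IsOdd h →
    c * ∫ x, dispersion x ^ 2 * ‖h x‖ ^ 2 ∂cellMeasure ≤ (inner ℂ h (T h)).re := by
  obtain ⟨C, hC⟩ := exists_admissible_gapPower
  obtain ⟨C', hC'⟩ := exists_admissible_dispersion
  obtain ⟨S, M', S1, S2, hS⟩ := exists_isCollision hC fun _ => gapPower_ne_zero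
  obtain ⟨c, hc, hgap⟩ := exists_gap_gapPower hS
  refine ⟨c, hc, fun {T M T1 T2} hT h hodd => ?_⟩
  have hdm := measurable_dispersion
  have hhm := L2_measurable h
  -- Since 1/6 + 5/6 = 1, the functions ω^(1/6) Q h and ω h coincide. The gap for Qh gives the
  -- weight ω^(5/3), which is at least ω².
  obtain ⟨Q, hQ⟩ := exists_multiplication (m := fun x => dispersion x ^ (5 / 6 : ℝ)) (by fun_prop)
    zero_le_one fun x hx => by
      rw [abs_of_nonneg (rpow_nonneg (dispersion_nonneg x) _)]
      exact rpow_le_one (dispersion_nonneg x) (dispersion_le_one x) (by norm_num)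
  have hQh := hQ h
  have hQodd : IsOdd (Q h) := by
    rw [isOdd_iff] at hodd ⊢
    filter_upwards [hodd, hQh, measurePreserving_reflect_cell.quasiMeasurePreserving.ae hQh]
      with x h1 h2 h3
    rw [h3, h2, h1, dispersion_reflect, mul_neg]
  have hF : ∀ᵐ x ∂cellMeasure, (gapPower x : ℂ) * Q h x = (dispersion x : ℂ) * h x := by
    filter_upwards [hQh, cell_ae] with x h1 hx
    rw [h1, ← mul_assoc, ← Complex.ofReal_mul, gapPower, ← rpow_add (dispersion_pos hx)]
    norm_num
  -- Both forms are half the integral of the squared defect of the same function.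
  have hform : (inner ℂ (Q h) (S (Q h))).re = (inner ℂ h (T h)).re := by
    rw [hS.re_inner hC, hT.re_inner hC']
    congr 1
    refine integral_congr_ae ?_
    filter_upwards [ae_comp_of_ae_cell measurable_pa map_pa_le hF,
        ae_comp_of_ae_cell measurable_pb (map_pb.trans_le map_pa_le) hF,
        ae_comp_of_ae_cell measurable_pc map_pc_le hF,
        ae_comp_of_ae_cell measurable_pd (map_pd.trans_le map_pc_le) hF] with p e1 e2 e3 e4
    simp only [defect]
    rw [e1, e2, e3, e4]
  rw [← hform]
  refine le_trans ?_ (hgap (Q h) hQodd)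
  rw [norm_sq_eq_integral]
  have hh2 : Integrable (fun x => ‖h x‖ ^ 2) cellMeasure :=
    (Lp.memLp h).integrable_norm_pow (p := 2) two_ne_zero
  refine mul_le_mul_of_nonneg_left (integral_mono_of_nonneg
    (Eventually.of_forall fun x => by positivity)
    ((Lp.memLp (Q h)).integrable_norm_pow (p := 2) two_ne_zero) ?_) hc.le
  filter_upwards [hQh] with x hx
  rw [hx, norm_mul, mul_pow, Complex.norm_real, norm_eq_abs, sq_abs, ← rpow_natCast (_ ^ _),
    ← rpow_mul (dispersion_nonneg x)]
  gcongr
  rw [← rpow_natCast]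
  have hd0 := dispersion_nonneg x
  rcases hd0.eq_or_lt with h0 | h0
  · rw [← h0, zero_rpow (by norm_num), zero_rpow (by norm_num)]
  · exact rpow_le_rpow_of_exponent_ge h0 (dispersion_le_one x) (by norm_num)

end FPU
end

noncomputable section

namespace FPU

open Real Set
open scoped ENNReal NNReal ComplexConjugate

/-! ### Parity -/

lemma kernelFun_reflect {k : ℝ → ℝ → ℝ} (hk : ∀ x y, k (2 * π - x) (2 * π - y) = k x y) (f : L2)
    (x : ℝ) : kernelFun k dispersion (reflectL2 f) x = kernelFun k dispersion f (2 * π - x) := by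
  rw [kernelFun, kernelFun, dispersion_reflect]
  congr 1
  rw [← integral_reflect (fun y => (k (2 * π - x) y : ℂ) * ((dispersion y : ℂ) * f y))]
  refine integral_congr_ae ?_
  filter_upwards [reflectL2_coeFn f] with y hy
  rw [hy, hk, dispersion_reflect]

lemma reflectL2_kernelOperator {k : ℝ → ℝ → ℝ} (hk : ∀ x y, k (2 * π - x) (2 * π - y) = k x y)
    {T : L2 →L[ℂ] L2} (hT : ∀ f : L2, T f =ᵐ[cellMeasure] kernelFun k dispersion f) (f : L2) :
    reflectL2 (T f) = T (reflectL2 f) := by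
  refine Lp.ext ?_
  filter_upwards [reflectL2_coeFn (T f), hT (reflectL2 f),
    measurePreserving_reflect_cell.quasiMeasurePreserving.ae (hT f)] with x h1 h2 h3
  rw [h1, h2, h3, kernelFun_reflect hk]

lemma reflectL2_multiplication {m : ℝ → ℝ} (hm : ∀ x, m (2 * π - x) = m x)
    {T : L2 →L[ℂ] L2} (hT : IsMultiplication T m) (f : L2) :
    reflectL2 (T f) = T (reflectL2 f) := by
  refine Lp.ext ?_
  filter_upwards [reflectL2_coeFn (T f), hT (reflectL2 f), reflectL2_coeFn f,
    measurePreserving_reflect_cell.quasiMeasurePreserving.ae (hT f)] with x h1 h2 h3 h4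
  rw [h1, h2, h3, h4, hm]

lemma W_reflect (x : ℝ) : W (2 * π - x) = W x := by
  rw [W, V_reflect, dispersion_reflect, W]

lemma IsCollision.reflectL2 {T M T1 T2 : L2 →L[ℂ] L2} (h : IsCollision dispersion T M T1 T2)
    (f : L2) : FPU.reflectL2 (T f) = T (FPU.reflectL2 f) := by
  have h0 := reflectL2_multiplication W_reflect h.mult f
  have h1 := reflectL2_kernelOperator K1_reflect h.fst f
  have h2 := reflectL2_kernelOperator K2_reflect h.snd f
  rw [h.eq]
  change FPU.reflectL2 (M f + T1 f - (2 : ℂ) • T2 f) = _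
  rw [map_sub, map_add, map_smul, h0, h1, h2]
  rfl

lemma isOdd_shiftInv {T : L2 →L[ℂ] L2} (hT : IsNonneg T)
    (hR : ∀ f, reflectL2 (T f) = T (reflectL2 f)) {s : ℝ} (hs : 0 < s) {f : L2} (hf : IsOdd f) :
    IsOdd (shiftInv s T f) := by
  have h1 : shift s T (reflectL2 (shiftInv s T f)) = -f := by
    rw [shift_apply, ← hR, ← map_smul, ← map_add, ← shift_apply, hT.shift_shiftInv hs]
    exact hf
  rw [IsOdd, ← hT.shiftInv_shift hs (reflectL2 _), h1, map_neg]

lemma isOdd_velocityL2 : IsOdd velocityL2 := by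
  rw [isOdd_iff]
  filter_upwards [velocityL2_coeFn, cell_ae,
    measurePreserving_reflect_cell.quasiMeasurePreserving.ae velocityL2_coeFn] with x h1 hx h2
  rw [h1, h2, velocity_reflect hx, Complex.ofReal_neg]

/-! ### Estimates in the spectral parameter -/

/-- Interpolation between the spectral parameter and a power weight. -/
lemma one_div_add_le {c s d τ : ℝ} (q : ℝ) (hc : 0 < c) (hc1 : c ≤ 1) (hs : 0 < s) (hd : 0 < d)
    (hτ0 : 0 ≤ τ) (hτ1 : τ ≤ 1) :
    1 / (s + c * d ^ q) ≤ c⁻¹ * s ^ (-τ) * d ^ (-(q * (1 - τ))) := by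
  have hq : 0 < d ^ q := rpow_pos_of_pos hd q
  have h := geom_mean_le_arith_mean2_weighted hτ0 (sub_nonneg.2 hτ1) hs.le hq.le (by ring)
  rw [← rpow_mul hd.le] at h
  have h1 : s ^ τ * d ^ (q * (1 - τ)) ≤ s + d ^ q := by nlinarith
  have h2 : c * (s + d ^ q) ≤ s + c * d ^ q := by nlinarith
  have hp : 0 < s ^ τ * d ^ (q * (1 - τ)) := by positivity
  calc 1 / (s + c * d ^ q) ≤ 1 / (c * (s ^ τ * d ^ (q * (1 - τ)))) := by
        gcongr
        exact (mul_le_mul_of_nonneg_left h1 hc.le).trans h2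
    _ = _ := by rw [rpow_neg hs.le, rpow_neg hd.le, one_div, mul_inv, mul_inv, mul_assoc]

lemma norm_velocity_le {x : ℝ} (hx : x ∈ Ioo 0 (2 * π)) : |velocity x| ≤ 1 := by
  rw [velocity_eq hx, abs_le]
  constructor <;> linarith [cos_le_one (x / 2), neg_one_le_cos (x / 2)]

section Estimates

variable {T M T1 T2 : L2 →L[ℂ] L2}

lemma shiftInv_velocity (hM : IsMultiplication M W) {s : ℝ} (hs : 0 < s) :
    shiftInv s M velocityL2 =ᵐ[cellMeasure] fun x => ((velocity x / (s + W x) : ℝ) : ℂ) := by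
  filter_upwards [shiftInv_multiplication hM W_nonneg hs velocityL2, velocityL2_coeFn] with x h1 h2
  rw [h1, h2]; push_cast; ring

/-- Interpolation with τ = 1/10 + η leaves the power 1 - (5/3)(9/10 - η) = -1/2 + 5η/3 of ω. The
value 1/10 is critical for the weighted row bounds, and η moves the power above -1/2. -/
lemma exists_relaxation_le : ∃ c : ℝ, 0 < c ∧ ∀ {M : L2 →L[ℂ] L2}, IsMultiplication M W →
    ∀ {η s : ℝ}, 0 < η → η ≤ 1 / 10 → 0 < s →
    ∀ᵐ x ∂cellMeasure, dispersion x * ‖shiftInv s M velocityL2 x‖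
      ≤ c * s ^ (-(1 / 10 + η)) * dispersion x ^ (-(1 / 2) + 5 / 3 * η) := by
  obtain ⟨c, hc, hc1, hW⟩ := exists_le_W
  refine ⟨c⁻¹, by positivity, fun {M} hM {η s} hη hη1 hs => ?_⟩
  filter_upwards [shiftInv_velocity hM hs, cell_ae] with x h1 hx
  have hd := dispersion_pos hx
  have h2 := one_div_add_le (5 / 3) hc hc1 hs hd (τ := 1 / 10 + η) (by linarith) (by linarith)
  have hWx := hW x hx
  have hp : 0 < s + c * dispersion x ^ (5 / 3 : ℝ) := by positivity
  rw [h1, Complex.norm_real, norm_eq_abs, abs_div, abs_of_pos (by linarith : 0 < s + W x)]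
  calc dispersion x * (|velocity x| / (s + W x))
      ≤ dispersion x * (1 / (s + c * dispersion x ^ (5 / 3 : ℝ))) := by
        gcongr
        exact norm_velocity_le hx
    _ ≤ dispersion x * (c⁻¹ * s ^ (-(1 / 10 + η)) *
          dispersion x ^ (-(5 / 3 * (1 - (1 / 10 + η))))) := by gcongr
    _ = c⁻¹ * s ^ (-(1 / 10 + η)) *
          (dispersion x ^ (1 : ℝ) * dispersion x ^ (-(5 / 3 * (1 - (1 / 10 + η))))) := by
        rw [rpow_one]; ring
    _ = _ := by rw [← rpow_add hd]; congr 2; ring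

lemma norm_kernelFun_le {k : ℝ → ℝ → ℝ} (hk0 : ∀ x y, 0 ≤ k x y) {f : L2} {x B : ℝ} (hB : 0 ≤ B)
    {b : ℝ → ℝ} (hb : ∀ᵐ y ∂cellMeasure, dispersion y * ‖f y‖ ≤ b y)
    (hle : ∫⁻ y, ENNReal.ofReal (k x y * b y) ∂cellMeasure ≤ ENNReal.ofReal B) :
    ‖kernelFun k dispersion f x‖ ≤ dispersion x * B := by
  have h1 : ‖∫ y, (k x y : ℂ) * ((dispersion y : ℂ) * f y) ∂cellMeasure‖ ≤ B := by
    rw [← ENNReal.ofReal_le_ofReal_iff hB, ofReal_norm]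
    refine (enorm_integral_le_lintegral_enorm _).trans (le_trans (lintegral_mono_ae ?_) hle)
    filter_upwards [hb] with y hy
    rw [← ofReal_norm, norm_mul, norm_mul, Complex.norm_real, Complex.norm_real,
      norm_of_nonneg (hk0 x y), norm_of_nonneg (dispersion_nonneg y)]
    exact ENNReal.ofReal_le_ofReal (mul_le_mul_of_nonneg_left hy (hk0 x y))
  rw [kernelFun, norm_mul, Complex.norm_real, norm_of_nonneg (dispersion_nonneg x)]
  exact mul_le_mul_of_nonneg_left h1 (dispersion_nonneg x)

lemma dispersion_mul_rpow_neg_half {x : ℝ} (hx : x ∈ Ioo 0 (2 * π)) :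
    dispersion x * dispersion x ^ (-(1 / 2) : ℝ) = dispersion x ^ (1 / 2 : ℝ) := by
  have hd := dispersion_pos hx
  nth_rewrite 1 [← rpow_one (dispersion x)]
  rw [← rpow_add hd]; norm_num

/-- The product bound on `K2` costs the integral of ω^(-1/2+p), hence the strict inequality for p.
For `K1` the borderline value is allowed, by `lintegral_K1_weight_le`. -/
lemma norm_kernelFun_K2_le {f : L2} {x κ p : ℝ} (hκ : 0 ≤ κ) (hp : -(1 / 2) < p)
    (hx : x ∈ Ioo 0 (2 * π))
    (hb : ∀ᵐ y ∂cellMeasure, dispersion y * ‖f y‖ ≤ κ * dispersion y ^ p) :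
    ‖kernelFun K2 dispersion f x‖
      ≤ κ * (∫ y, dispersion y ^ (-(1 / 2) + p) ∂cellMeasure) * dispersion x ^ (1 / 2 : ℝ) := by
  have hd := dispersion_pos hx
  have hdx := rpow_pos_of_pos hd (-(1 / 2) : ℝ)
  have hI0 : 0 ≤ ∫ y, dispersion y ^ (-(1 / 2) + p) ∂cellMeasure :=
    integral_nonneg fun y => rpow_nonneg (dispersion_nonneg y) _
  have hint : Integrable (fun y => κ * dispersion x ^ (-(1 / 2) : ℝ) * dispersion y ^ (-(1 / 2) + p))
      cellMeasure := (integrable_rpow_dispersion (by linarith)).const_mul _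
  have hle : ∫⁻ y, ENNReal.ofReal (K2 x y * (κ * dispersion y ^ p)) ∂cellMeasure
      ≤ ENNReal.ofReal (κ * dispersion x ^ (-(1 / 2) : ℝ) *
        ∫ y, dispersion y ^ (-(1 / 2) + p) ∂cellMeasure) := by
    rw [← integral_const_mul, ofReal_integral_eq_lintegral_ofReal hint
      (Eventually.of_forall fun y =>
        mul_nonneg (mul_nonneg hκ hdx.le) (rpow_nonneg (dispersion_nonneg y) _))]
    refine lintegral_mono_ae ?_
    filter_upwards [cell_ae] with y hy
    apply ENNReal.ofReal_le_ofReal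
    have hdy := dispersion_pos hy
    calc K2 x y * (κ * dispersion y ^ p)
        ≤ (dispersion x ^ (-(1 / 2) : ℝ) * dispersion y ^ (-(1 / 2) : ℝ)) *
          (κ * dispersion y ^ p) := by
          gcongr; exact K2_le hx hy
      _ = κ * dispersion x ^ (-(1 / 2) : ℝ) *
          (dispersion y ^ (-(1 / 2) : ℝ) * dispersion y ^ p) := by ring
      _ = _ := by rw [← rpow_add hdy]
  refine (norm_kernelFun_le K2_nonneg
    (mul_nonneg (mul_nonneg hκ hdx.le) hI0) hb hle).trans_eq ?_
  rw [← dispersion_mul_rpow_neg_half hx]; ring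

lemma norm_kernelFun_K1_le {f : L2} {x κ p : ℝ} (hκ : 0 ≤ κ) (hp : -(1 / 2) ≤ p)
    (hx : x ∈ Ioo 0 (2 * π))
    (hb : ∀ᵐ y ∂cellMeasure, dispersion y * ‖f y‖ ≤ κ * dispersion y ^ p) :
    ‖kernelFun K1 dispersion f x‖ ≤ κ * (8 * π) * dispersion x ^ (1 / 2 : ℝ) := by
  have hd := dispersion_pos hx
  have hdx := rpow_pos_of_pos hd (-(1 / 2) : ℝ)
  have hpi := pi_pos
  have hle : ∫⁻ y, ENNReal.ofReal (K1 x y * (κ * dispersion y ^ p)) ∂cellMeasure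
      ≤ ENNReal.ofReal (κ * (8 * π * dispersion x ^ (-(1 / 2) : ℝ))) := by
    rw [ENNReal.ofReal_mul hκ]
    refine le_trans ?_ (mul_le_mul_right (lintegral_K1_weight_le hx) _)
    rw [← lintegral_const_mul' _ _ ENNReal.ofReal_ne_top]
    refine lintegral_mono_ae ?_
    filter_upwards [cell_ae] with y hy
    have hdy := dispersion_pos hy
    rw [← ENNReal.ofReal_mul hκ]
    apply ENNReal.ofReal_le_ofReal
    have h4 := K1_nonneg x y
    have h5 : dispersion y ^ p ≤ dispersion y ^ (-(1 / 2) : ℝ) :=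
      rpow_le_rpow_of_exponent_ge hdy (dispersion_le_one y) hp
    calc K1 x y * (κ * dispersion y ^ p)
        ≤ K1 x y * (κ * dispersion y ^ (-(1 / 2) : ℝ)) := by gcongr
      _ = _ := by ring
  have hB : 0 ≤ κ * (8 * π * dispersion x ^ (-(1 / 2) : ℝ)) := by positivity
  refine (norm_kernelFun_le K1_nonneg hB hb hle).trans_eq ?_
  rw [← dispersion_mul_rpow_neg_half hx]; ring

/-- The perturbation applied to the relaxation time approximation. -/
lemma exists_perturbation_le {η : ℝ} (hη : 0 < η) (hη1 : η ≤ 1 / 10) :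
    ∃ D : ℝ, 0 < D ∧ ∀ {T M T1 T2 : L2 →L[ℂ] L2}, IsCollision dispersion T M T1 T2 →
    ∀ {s : ℝ}, 0 < s → ∀ᵐ x ∂cellMeasure, ‖(M - T) (shiftInv s M velocityL2) x‖
      ≤ D * s ^ (-(1 / 10 + η)) * dispersion x ^ (1 / 2 : ℝ) := by
  obtain ⟨c, hc, hrel⟩ := exists_relaxation_le
  have hI0 : 0 ≤ ∫ y, dispersion y ^ (-(1 / 2) + (-(1 / 2) + 5 / 3 * η)) ∂cellMeasure :=
    integral_nonneg fun y => rpow_nonneg (dispersion_nonneg y) _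
  have hpi := pi_pos
  refine ⟨2 * (c * ∫ y, dispersion y ^ (-(1 / 2) + (-(1 / 2) + 5 / 3 * η)) ∂cellMeasure) +
    c * (8 * π), by positivity, fun {T M T1 T2} h {s} hs => ?_⟩
  have hb := hrel h.mult hη hη1 hs
  have hτ0 : 0 < s ^ (-(1 / 10 + η)) := rpow_pos_of_pos hs _
  generalize s ^ (-(1 / 10 + η)) = τ at hb hτ0 ⊢
  generalize shiftInv s M velocityL2 = g at hb ⊢
  have hA : (M - T) g = (2 : ℂ) • T2 g - T1 g := by
    rw [h.eq]
    change M g - (M g + T1 g - (2 : ℂ) • T2 g) = _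
    abel
  rw [hA]
  filter_upwards [Lp.coeFn_sub ((2 : ℂ) • T2 g) (T1 g), Lp.coeFn_smul (2 : ℂ) (T2 g), h.fst g,
    h.snd g, cell_ae] with x h1 h2 h3 h4 hx
  rw [h1, Pi.sub_apply, h2, Pi.smul_apply, h3, h4, smul_eq_mul]
  have b2 := norm_kernelFun_K2_le (by positivity) (by linarith) hx hb
  have b1 := norm_kernelFun_K1_le (by positivity) (by linarith) hx hb
  refine (norm_sub_le _ _).trans ?_
  rw [norm_mul, Complex.norm_ofNat]
  linarith

lemma norm_inner_L2_le {f g : L2} {b : ℝ → ℝ} (hb : Integrable b cellMeasure)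
    (h : ∀ᵐ x ∂cellMeasure, ‖f x‖ * ‖g x‖ ≤ b x) : ‖inner ℂ f g‖ ≤ ∫ x, b x ∂cellMeasure := by
  rw [inner_L2_eq]
  refine norm_integral_le_of_norm_le hb ?_
  filter_upwards [h] with x hx
  rwa [norm_mul, RCLike.norm_conj]

/-- The first order correction. -/
lemma exists_first_correction_le {η : ℝ} (hη : 0 < η) (hη1 : η ≤ 1 / 10) :
    ∃ D : ℝ, ∀ {T M T1 T2 : L2 →L[ℂ] L2}, IsCollision dispersion T M T1 T2 →
    ∀ {s : ℝ}, 0 < s → ‖inner ℂ velocityL2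
      (shiftInv s M ((M - T) (shiftInv s M velocityL2)))‖ ≤ D * s ^ (-(1 / 5 + 2 * η)) := by
  obtain ⟨c, hc, hrel⟩ := exists_relaxation_le
  obtain ⟨D, hD, hper⟩ := exists_perturbation_le hη hη1
  refine ⟨c * D * ∫ x, dispersion x ^ (-1 + 5 / 3 * η) ∂cellMeasure, fun {T M T1 T2} h {s} hs => ?_⟩
  have hM := isNonneg_multiplication h.mult W_nonneg
  rw [← hM.shiftInv_symm hs]
  -- The relaxation factor has order ω^(-3/2+5η/3) and the perturbed one ω^(1/2). Their product is
  -- just integrable, and the powers of s add up to -(1/5 + 2η).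
  refine (norm_inner_L2_le (b := fun x => c * D * s ^ (-(1 / 5 + 2 * η)) *
    dispersion x ^ (-1 + 5 / 3 * η))
    ((integrable_rpow_dispersion (by linarith)).const_mul _) ?_).trans_eq ?_
  · filter_upwards [hrel h.mult hη hη1 hs, hper h hs, cell_ae] with x h1 h2 hx
    have hd := dispersion_pos hx
    have hτ : 0 < s ^ (-(1 / 10 + η)) := rpow_pos_of_pos hs _
    have h3 : ‖shiftInv s M velocityL2 x‖
        ≤ c * s ^ (-(1 / 10 + η)) * dispersion x ^ (-(3 / 2) + 5 / 3 * η) := by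
      have e : dispersion x ^ (-(1 / 2) + 5 / 3 * η)
          = dispersion x * dispersion x ^ (-(3 / 2) + 5 / 3 * η) := by
        nth_rewrite 2 [← rpow_one (dispersion x)]
        rw [← rpow_add hd]; congr 1; ring
      rw [e] at h1
      refine le_of_mul_le_mul_left (h1.trans_eq ?_) hd
      ring
    calc _ ≤ (c * s ^ (-(1 / 10 + η)) * dispersion x ^ (-(3 / 2) + 5 / 3 * η)) *
          (D * s ^ (-(1 / 10 + η)) * dispersion x ^ (1 / 2 : ℝ)) := by gcongr
      _ = c * D * (s ^ (-(1 / 10 + η)) * s ^ (-(1 / 10 + η))) *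
          (dispersion x ^ (-(3 / 2) + 5 / 3 * η) * dispersion x ^ (1 / 2 : ℝ)) := by ring
      _ = _ := by
        rw [← rpow_add hs, ← rpow_add hd]; congr 2 <;> ring_nf
  · rw [integral_const_mul]; ring

/-- The resolvent form of the collision operator on odd functions. -/
lemma exists_resolvent_form_le : ∃ c : ℝ, 0 < c ∧ c ≤ 1 ∧ ∀ {T M T1 T2 : L2 →L[ℂ] L2},
    IsCollision dispersion T M T1 T2 → ∀ {s : ℝ}, 0 < s → ∀ y : L2, IsOdd y → ∀ {b : ℝ → ℝ},
    Integrable b cellMeasure →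
    (∀ᵐ x ∂cellMeasure, ‖y x‖ ^ 2 * (1 / (s + c * dispersion x ^ (2 : ℝ))) ≤ b x) →
    ‖inner ℂ y (shiftInv s T y)‖ ≤ ∫ x, b x ∂cellMeasure := by
  obtain ⟨c₀, hc₀, hgap₀⟩ := exists_gap_dispersion
  obtain ⟨C', hC'⟩ := exists_admissible_dispersion
  -- The gap constant is capped at 1 so that `one_div_add_le` applies.
  refine ⟨min c₀ 1, by positivity, min_le_right _ _,
    fun {T M T1 T2} h {s} hs y hy {b} hb hle => ?_⟩
  set c := min c₀ 1 with hcdef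
  have hc : 0 < c := by positivity
  have hnn := h.isNonneg hC'
  set z := shiftInv s T y with hz
  have hzodd : IsOdd z := isOdd_shiftInv hnn h.reflectL2 hs hy
  have hz2 : Integrable (fun x => ‖z x‖ ^ 2) cellMeasure :=
    (Lp.memLp z).integrable_norm_pow (p := 2) two_ne_zero
  have hdm := measurable_dispersion
  have hzm := L2_measurable z
  have hdz2 : Integrable (fun x => dispersion x ^ 2 * ‖z x‖ ^ 2) cellMeasure := by
    refine hz2.mono' (Measurable.aestronglyMeasurable (by fun_prop)) (Eventually.of_forall fun x => ?_)
    rw [norm_of_nonneg (by positivity)]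
    refine mul_le_of_le_one_left (sq_nonneg _) ?_
    exact pow_le_one₀ (dispersion_nonneg x) (dispersion_le_one x)
  have hI0 : 0 ≤ ∫ x, dispersion x ^ 2 * ‖z x‖ ^ 2 ∂cellMeasure :=
    integral_nonneg fun x => by positivity
  set q := (inner ℂ y z).re with hq
  have hq1 : ‖inner ℂ y z‖ = q := by
    have him := hnn.shiftInv_im hs y
    have h0 : 0 ≤ q := by
      rw [hq, hz, hnn.re_inner_shiftInv hs]
      have := hnn.nonneg (shiftInv s T y)
      positivity
    rw [← Complex.re_add_im (inner ℂ y z), him, Complex.ofReal_zero, zero_mul, add_zero,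
      Complex.norm_real, norm_of_nonneg h0]
  -- The gap applies because z is odd, as y is odd and the reflection commutes with T.
  have hlow : ∫ x, (s * ‖z x‖ ^ 2 + c * (dispersion x ^ 2 * ‖z x‖ ^ 2)) ∂cellMeasure ≤ q := by
    rw [hq, hz, hnn.re_inner_shiftInv hs, ← hz, integral_add (hz2.const_mul s) (hdz2.const_mul c),
      integral_const_mul, integral_const_mul, ← norm_sq_eq_integral]
    have h1 := hgap₀ h z hzodd
    have h2 : c ≤ c₀ := min_le_left _ _
    nlinarith
  -- Young's inequality with the weight s + cω² bounds q by half the integral of b plus half of the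
  -- quantity in `hlow`, which is absorbed into q.
  have hup : q ≤ ∫ x, (1 / 2 * b x + 1 / 2 * (s * ‖z x‖ ^ 2 + c * (dispersion x ^ 2 * ‖z x‖ ^ 2)))
      ∂cellMeasure := by
    rw [← hq1]
    refine norm_inner_L2_le ((hb.const_mul _).add
      (((hz2.const_mul s).add (hdz2.const_mul c)).const_mul _)) ?_
    filter_upwards [hle] with x hx
    have hw : 0 < s + c * dispersion x ^ (2 : ℝ) := by
      have := rpow_nonneg (dispersion_nonneg x) 2
      positivity
    rw [rpow_two] at hx hw
    set w := s + c * dispersion x ^ 2 with hwdef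
    have h1 : ‖y x‖ * ‖z x‖ ≤ 1 / 2 * (‖y x‖ ^ 2 * (1 / w)) + 1 / 2 * (w * ‖z x‖ ^ 2) := by
      have h2 : 0 ≤ (‖y x‖ - w * ‖z x‖) ^ 2 * (1 / w) := by positivity
      have h3 : (‖y x‖ - w * ‖z x‖) ^ 2 * (1 / w)
          = ‖y x‖ ^ 2 * (1 / w) - 2 * (‖y x‖ * ‖z x‖) + w * ‖z x‖ ^ 2 := by
        field_simp; ring
      linarith
    calc _ ≤ _ := h1
      _ ≤ 1 / 2 * b x + 1 / 2 * (w * ‖z x‖ ^ 2) := by linarith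
      _ = _ := by rw [hwdef]; ring
  have hsum := integral_add (hb.const_mul (1 / 2))
    ((((hz2.const_mul s).add (hdz2.const_mul c)).const_mul (1 / 2)))
  simp only [Pi.add_apply] at hsum
  rw [hsum, integral_const_mul, integral_const_mul] at hup
  rw [hq1]
  linarith

/-- The second order correction. -/
lemma exists_second_correction_le {η : ℝ} (hη : 0 < η) (hη1 : η ≤ 1 / 10) :
    ∃ D : ℝ, ∀ {T M T1 T2 : L2 →L[ℂ] L2}, IsCollision dispersion T M T1 T2 →
    ∀ {s : ℝ}, 0 < s → ‖inner ℂ velocityL2 (shiftInv s M ((M - T) (shiftInv s T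
      ((M - T) (shiftInv s M velocityL2)))))‖ ≤ D * s ^ (-(1 / 5 + 3 * η)) := by
  obtain ⟨D, hD, hper⟩ := exists_perturbation_le hη hη1
  obtain ⟨c, hc, hc1, hform⟩ := exists_resolvent_form_le
  obtain ⟨C', hC'⟩ := exists_admissible_dispersion
  refine ⟨D ^ 2 * c⁻¹ * ∫ x, dispersion x ^ (-1 + 2 * η) ∂cellMeasure,
    fun {T M T1 T2} h {s} hs => ?_⟩
  have hM := isNonneg_multiplication h.mult W_nonneg
  have hT := h.isNonneg hC'
  have hAs : ∀ f g : L2, inner ℂ ((M - T) f) g = inner ℂ f ((M - T) g) := fun f g => by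
    rw [sub_apply, sub_apply, inner_sub_left, inner_sub_right, hM.symm, hT.symm]
  rw [← hM.shiftInv_symm hs, ← hAs]
  set y := (M - T) (shiftInv s M velocityL2) with hy
  have hyodd : IsOdd y := by
    have hg : IsOdd (shiftInv s M velocityL2) :=
      isOdd_shiftInv hM (reflectL2_multiplication W_reflect h.mult) hs isOdd_velocityL2
    rw [hy, sub_apply, IsOdd, map_sub, reflectL2_multiplication W_reflect h.mult, h.reflectL2,
      show reflectL2 (shiftInv s M velocityL2) = -shiftInv s M velocityL2 from hg, map_neg, map_neg]
    abel
  -- Here |y|² has order ω, and interpolation with τ = η in 1/(s + cω²) leaves ω^(-1+2η), which is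
  -- integrable, at the cost of s^(-η).
  refine (hform h hs y hyodd (b := fun x => D ^ 2 * c⁻¹ * s ^ (-(1 / 5 + 3 * η)) *
    dispersion x ^ (-1 + 2 * η)) ((integrable_rpow_dispersion (by linarith)).const_mul _) ?_).trans_eq ?_
  · filter_upwards [hper h hs, cell_ae] with x h2 hx
    have hd := dispersion_pos hx
    have h3 := one_div_add_le 2 hc hc1 hs hd (τ := η) hη.le (by linarith)
    have hτ : 0 < s ^ (-(1 / 10 + η)) := rpow_pos_of_pos hs _
    have hw : 0 < s + c * dispersion x ^ (2 : ℝ) := by positivity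
    calc _ ≤ (D * s ^ (-(1 / 10 + η)) * dispersion x ^ (1 / 2 : ℝ)) ^ 2 *
          (c⁻¹ * s ^ (-η) * dispersion x ^ (-(2 * (1 - η)))) := by gcongr
      _ = D ^ 2 * c⁻¹ * (s ^ (-(1 / 10 + η)) * s ^ (-(1 / 10 + η)) * s ^ (-η)) *
          (dispersion x ^ (1 / 2 : ℝ) * dispersion x ^ (1 / 2 : ℝ) *
            dispersion x ^ (-(2 * (1 - η)))) := by ring
      _ = _ := by
        rw [← rpow_add hs, ← rpow_add hs, ← rpow_add hd, ← rpow_add hd]; congr 2 <;> ring_nf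
  · rw [integral_const_mul]; ring

end Estimates

end FPU
end

noncomputable section

namespace FPU

open Real Set
open scoped ENNReal NNReal ComplexConjugate

/-! ### The relaxation time approximation -/

lemma measurable_W : Measurable W := (measurable_dispersion.pow_const 2).mul measurable_V

lemma inner_shiftInv_multiplication_velocity {M : L2 →L[ℂ] L2} (hM : IsMultiplication M W) {s : ℝ}
    (hs : 0 < s) : inner ℂ velocityL2 (shiftInv s M velocityL2)
      = ((∫ x, velocity x ^ 2 / (s + W x) ∂cellMeasure : ℝ) : ℂ) := by
  rw [inner_self_multiplication (shiftInv_multiplication hM W_nonneg hs)]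
  congr 1
  refine integral_congr_ae ?_
  filter_upwards [velocityL2_coeFn] with x hx
  rw [hx, Complex.norm_real, norm_eq_abs, sq_abs]; ring

lemma integral_cell_eq_of_reflect {G : ℝ → ℝ} (hG : Integrable G cellMeasure)
    (hr : ∀ x ∈ Ioo 0 (2 * π), G (2 * π - x) = G x) :
    ∫ x, G x ∂cellMeasure = 2 * ∫ x in Ioi 0, (Iio π).indicator G x := by
  have hpi := pi_pos
  rw [cellMeasure_eq_Ioo] at hG ⊢
  have hI : IntervalIntegrable G volume 0 (2 * π) := by
    rw [intervalIntegrable_iff_integrableOn_Ioo_of_le (by linarith)]; exact hG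
  have h1 : IntervalIntegrable G volume 0 π := hI.mono_set (by
    rw [uIcc_of_le hpi.le, uIcc_of_le (by linarith)]; exact Icc_subset_Icc_right (by linarith))
  have h2 : IntervalIntegrable G volume π (2 * π) := hI.mono_set (by
    rw [uIcc_of_le (by linarith), uIcc_of_le (by linarith)]; exact Icc_subset_Icc_left hpi.le)
  have h3 : ∫ x in π..(2 * π), G x = ∫ x in (0 : ℝ)..π, G x := by
    have := intervalIntegral.integral_comp_sub_left (a := 0) (b := π) G (2 * π)
    rw [sub_zero, show 2 * π - π = π by ring] at this
    rw [← this, intervalIntegral.integral_of_le hpi.le, intervalIntegral.integral_of_le hpi.le,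
      integral_Ioc_eq_integral_Ioo, integral_Ioc_eq_integral_Ioo]
    exact setIntegral_congr_fun measurableSet_Ioo fun x hx => hr x ⟨hx.1, by linarith [hx.2]⟩
  have h4 : ∫ x in Ioi 0, (Iio π).indicator G x = ∫ x in (0 : ℝ)..π, G x := by
    rw [setIntegral_indicator measurableSet_Iio, Ioi_inter_Iio,
      intervalIntegral.integral_of_le hpi.le, integral_Ioc_eq_integral_Ioo]
  rw [← integral_Ioc_eq_integral_Ioo, ← intervalIntegral.integral_of_le (by linarith),
    ← intervalIntegral.integral_add_adjacent_intervals h1 h2, h3, h4]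
  ring

lemma integrable_relaxation {s : ℝ} (hs : 0 < s) :
    Integrable (fun x => velocity x ^ 2 / (s + W x)) cellMeasure := by
  have hv : Measurable velocity := measurable_deriv _
  have hW := measurable_W
  refine Integrable.of_bound (Measurable.aestronglyMeasurable (by fun_prop)) (1 / s) ?_
  filter_upwards [cell_ae] with x hx
  have h := abs_le.1 (norm_velocity_le hx)
  have hW0 := W_nonneg x
  rw [norm_of_nonneg (by positivity)]
  gcongr
  · nlinarith
  · linarith

/-- The integrand of the relaxation time approximation in the scaling variable. -/
lemma sq_mul_integral_relaxation {α : ℝ} (hα : 0 < α) :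
    α ^ 2 * ∫ x, velocity x ^ 2 / (α ^ 5 + W x) ∂cellMeasure
      = ∫ t in Ioi 0, (Iio π).indicator
        (fun x => α ^ 5 * cos (x / 2) ^ 2 / (α ^ 5 + W x)) (2 * α ^ 3 * t) := by
  have hb : 0 < 2 * α ^ 3 := by positivity
  rw [integral_cell_eq_of_reflect (integrable_relaxation (by positivity)) fun x hx => by
      rw [velocity_reflect hx, W_reflect, neg_sq],
    integral_comp_mul_left_Ioi _ _ hb, mul_zero, smul_eq_mul, ← mul_assoc,
    ← integral_const_mul, ← integral_const_mul]
  refine setIntegral_congr_fun measurableSet_Ioi fun x hx => ?_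
  by_cases h : x ∈ Iio π
  · have hx2 : x ∈ Ioo 0 (2 * π) := ⟨hx, by have : x < π := h; linarith [pi_pos]⟩
    simp only [indicator_of_mem h]
    rw [velocity_eq hx2]
    field_simp
  · simp only [indicator_of_notMem h, mul_zero]

/-- With r = t^(1/3) the argument is 2(rα)³, at the scale β = rα of `tendsto_V_end`. Thus `W` ≈
(rα)⁶ w₀/(rα) = w₀ α⁵ t^(5/3), which balances s = α⁵. -/
lemma tendsto_relaxation_integrand {t : ℝ} (ht : 0 < t) :
    Tendsto (fun α : ℝ => (Iio π).indicator
        (fun x => α ^ 5 * cos (x / 2) ^ 2 / (α ^ 5 + W x)) (2 * α ^ 3 * t)) (𝓝[>] 0)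
      (𝓝 (1 / (1 + w0 * t ^ (5 / 3 : ℝ)))) := by
  have hα0 : Tendsto (fun α : ℝ => α) (𝓝[>] 0) (𝓝 0) := tendsto_id.mono_left nhdsWithin_le_nhds
  obtain ⟨r, hr, hr3, hr5⟩ : ∃ r : ℝ, 0 < r ∧ r ^ 3 = t ∧ r ^ 5 = t ^ (5 / 3 : ℝ) := by
    refine ⟨t ^ (1 / 3 : ℝ), rpow_pos_of_pos ht _, ?_, ?_⟩
    · rw [← rpow_natCast, ← rpow_mul ht.le]; norm_num
    · rw [← rpow_natCast, ← rpow_mul ht.le]; norm_num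
  have hβ : Tendsto (fun α : ℝ => r * α) (𝓝[>] 0) (𝓝[>] 0) := by
    refine tendsto_nhdsWithin_iff.2 ⟨by simpa using hα0.const_mul r, ?_⟩
    filter_upwards [self_mem_nhdsWithin] with α hα
    exact mul_pos hr hα
  have hβ3 : Tendsto (fun β : ℝ => β ^ 3) (𝓝[>] 0) (𝓝[>] 0) := by
    refine tendsto_nhdsWithin_iff.2 ⟨by simpa using hα0.pow 3, ?_⟩
    filter_upwards [self_mem_nhdsWithin] with α hα
    exact pow_pos (show (0 : ℝ) < α from hα) 3
  have h1 := (tendsto_sin_div 1).comp (hβ3.comp hβ)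
  have h2 := tendsto_V_end.comp hβ
  have hc : Tendsto (fun α : ℝ => cos ((r * α) ^ 3) ^ 2) (𝓝[>] 0) (𝓝 1) := by
    have : Continuous fun α : ℝ => cos ((r * α) ^ 3) ^ 2 := by fun_prop
    simpa using (this.tendsto 0).mono_left nhdsWithin_le_nhds
  have hmain := hc.div ((((h1.pow 2).mul h2).mul_const (r ^ 5)).const_add 1) (by
    have := w0_pos
    positivity)
  have hlt : ∀ᶠ α : ℝ in 𝓝[>] 0, 2 * α ^ 3 * t < π := by
    have : Continuous fun α : ℝ => 2 * α ^ 3 * t := by fun_prop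
    have h := (this.tendsto 0).mono_left (nhdsWithin_le_nhds (s := Ioi 0))
    refine h.eventually_lt_const ?_
    simpa using pi_pos
  rw [hr5, one_pow, one_mul] at hmain
  refine hmain.congr' ?_
  filter_upwards [hlt, self_mem_nhdsWithin] with α h3 hα
  have hα : 0 < α := hα
  rw [indicator_of_mem (show _ ∈ Iio π from h3),
    show 2 * α ^ 3 * t = 2 * (r * α) ^ 3 by rw [← hr3]; ring]
  simp only [Function.comp_apply, Pi.div_apply, one_mul]
  rw [W, dispersion, sq_abs, ← hr5, show 2 * (r * α) ^ 3 / 2 = (r * α) ^ 3 by ring]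
  have hV0 : 0 ≤ V (2 * (r * α) ^ 3) := V_nonneg _
  have hd1 : 0 < 1 + (sin ((r * α) ^ 3) / (r * α) ^ 3) ^ 2 * (r * α * V (2 * (r * α) ^ 3)) * r ^ 5 := by
    positivity
  have hd2 : 0 < α ^ 5 + sin ((r * α) ^ 3) ^ 2 * V (2 * (r * α) ^ 3) := by positivity
  rw [div_eq_div_iff hd1.ne' hd2.ne']
  field_simp

/-- The lower bound of order ω^(5/3) for `W`, combined with Jordan's inequality, scales in the same
way as the limit; this gives an integrable majorant independent of α. -/
lemma exists_relaxation_integrand_le : ∃ c : ℝ, 0 < c ∧ ∀ {α t : ℝ}, 0 < α → 0 < t →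
    ‖(Iio π).indicator (fun x => α ^ 5 * cos (x / 2) ^ 2 / (α ^ 5 + W x)) (2 * α ^ 3 * t)‖
      ≤ 1 / (1 + c * t ^ (5 / 3 : ℝ)) := by
  obtain ⟨c, hc, hc1, hW⟩ := exists_le_W
  refine ⟨c * (1 / 2) ^ (5 / 3 : ℝ), by positivity, fun {α t} hα ht => ?_⟩
  have ht5 : 0 < t ^ (5 / 3 : ℝ) := rpow_pos_of_pos ht _
  by_cases h : 2 * α ^ 3 * t ∈ Iio π
  · have h' : 2 * α ^ 3 * t < π := h
    have hx : 2 * α ^ 3 * t ∈ Ioo 0 (2 * π) := ⟨by positivity, by linarith [pi_pos]⟩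
    have h1 : 1 / 2 * (α ^ 3 * t) ≤ dispersion (2 * α ^ 3 * t) := by
      rw [dispersion_eq hx]
      have h2 := mul_le_sin (x := 2 * α ^ 3 * t / 2) (by linarith [hx.1]) (by linarith)
      refine le_trans ?_ h2
      rw [show 2 * α ^ 3 * t / 2 = α ^ 3 * t by ring]
      have h3 : 1 / 2 ≤ 2 / π := by
        rw [div_le_div_iff₀ two_pos pi_pos]
        linarith [pi_lt_four]
      gcongr
    have h3 : (1 / 2) ^ (5 / 3 : ℝ) * (α ^ 5 * t ^ (5 / 3 : ℝ))
        ≤ dispersion (2 * α ^ 3 * t) ^ (5 / 3 : ℝ) := by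
      refine le_trans (le_of_eq ?_) (rpow_le_rpow (by positivity) h1 (by norm_num))
      rw [mul_rpow (by norm_num) (by positivity), mul_rpow (by positivity) ht.le,
        ← rpow_natCast α 3, ← rpow_mul hα.le]
      norm_num
    have h4 := hW _ hx
    have h5 := mul_le_mul_of_nonneg_left h3 hc.le
    rw [indicator_of_mem h, norm_of_nonneg (by have := W_nonneg (2 * α ^ 3 * t); positivity)]
    calc _ ≤ α ^ 5 * 1 / (α ^ 5 + c * ((1 / 2) ^ (5 / 3 : ℝ) * (α ^ 5 * t ^ (5 / 3 : ℝ)))) := by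
          gcongr
          · exact cos_sq_le_one _
          · exact h5.trans h4
      _ = _ := by
        rw [show α ^ 5 + c * ((1 / 2) ^ (5 / 3 : ℝ) * (α ^ 5 * t ^ (5 / 3 : ℝ)))
          = α ^ 5 * (1 + c * (1 / 2) ^ (5 / 3 : ℝ) * t ^ (5 / 3 : ℝ)) by ring,
          mul_div_mul_left _ _ (by positivity)]
  · rw [indicator_of_notMem h, norm_zero]; positivity

theorem tendsto_relaxation :
    Tendsto (fun s : ℝ => s ^ (2 / 5 : ℝ) * ∫ x, velocity x ^ 2 / (s + W x) ∂cellMeasure) (𝓝[>] 0)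
      (𝓝 c0) := by
  obtain ⟨c, hc, hle⟩ := exists_relaxation_integrand_le
  have hm := measurable_W
  have h : Tendsto (fun α : ℝ => ∫ t in Ioi 0, (Iio π).indicator
        (fun x => α ^ 5 * cos (x / 2) ^ 2 / (α ^ 5 + W x)) (2 * α ^ 3 * t)) (𝓝[>] 0) (𝓝 c0) := by
    refine tendsto_integral_filter_of_dominated_convergence
      (fun t => 1 / (1 + c * t ^ (5 / 3 : ℝ))) ?_ ?_ (integrableOn_c0 hc) ?_
    · refine Eventually.of_forall fun α => Measurable.aestronglyMeasurable ?_
      exact (Measurable.indicator (by fun_prop) measurableSet_Iio).comp (by fun_prop)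
    · filter_upwards [self_mem_nhdsWithin] with α hα
      filter_upwards [ae_restrict_mem measurableSet_Ioi] with t ht using hle hα ht
    · filter_upwards [ae_restrict_mem measurableSet_Ioi] with t ht
        using tendsto_relaxation_integrand ht
  have hs : Tendsto (fun s : ℝ => s ^ (1 / 5 : ℝ)) (𝓝[>] 0) (𝓝[>] 0) := by
    refine tendsto_nhdsWithin_iff.2 ⟨?_, ?_⟩
    · have := (continuousAt_rpow_const (0 : ℝ) (1 / 5) (Or.inr (by norm_num))).tendsto
      rw [zero_rpow (by norm_num)] at this
      exact this.mono_left nhdsWithin_le_nhds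
    · filter_upwards [self_mem_nhdsWithin] with s hs using rpow_pos_of_pos hs _
  refine (h.comp hs).congr' ?_
  filter_upwards [self_mem_nhdsWithin] with s hs
  have hs : 0 < s := hs
  rw [Function.comp_apply, ← sq_mul_integral_relaxation (rpow_pos_of_pos hs _), ← rpow_natCast,
    ← rpow_natCast, ← rpow_mul hs.le, ← rpow_mul hs.le]
  norm_num

end FPU
end

noncomputable section

namespace FPU

open Real Set
open scoped ENNReal NNReal ComplexConjugate

/-! ### Small spectral parameters -/

lemma isBigO_of_forall_norm_le {f : ℝ → ℂ} {a ε D : ℝ} (ha : a ≤ 1 / 5 + ε)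
    (h : ∀ s, 0 < s → ‖f s‖ ≤ D * s ^ (-a)) :
    f =O[𝓝[>] 0] (fun s : ℝ => s ^ (-(1 / 5) - ε : ℝ)) := by
  refine IsBigO.of_bound |D| ?_
  filter_upwards [Ioo_mem_nhdsGT one_pos] with s hs
  have h1 : s ^ (-a) ≤ s ^ (-(1 / 5) - ε : ℝ) :=
    rpow_le_rpow_of_exponent_ge hs.1 hs.2.le (by linarith)
  have h0 : 0 < s ^ (-a) := rpow_pos_of_pos hs.1 _
  rw [norm_of_nonneg (h0.le.trans h1)]
  exact (h s hs.1).trans (mul_le_mul (le_abs_self D) h1 h0.le (abs_nonneg D))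

variable {T M : L2 →L[ℂ] L2}

lemma isBigO_first_correction (hT : IsWeightedCollision T) (hM : IsMultiplication M W) {ε : ℝ}
    (hε : 0 < ε) :
    (fun s : ℝ => inner ℂ velocityL2 (shiftInv s M ((M - T) (shiftInv s M velocityL2))))
      =O[𝓝[>] 0] (fun s : ℝ => s ^ (-(1 / 5) - ε : ℝ)) := by
  obtain ⟨T1, T2, h⟩ := hT.exists_isCollision hM
  have hη : 0 < min (ε / 3) (1 / 10) := by positivity
  obtain ⟨D, hD⟩ := exists_first_correction_le hη (min_le_right _ _)
  exact isBigO_of_forall_norm_le (by linarith [min_le_left (ε / 3) (1 / 10)]) fun s hs => hD h hs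

lemma isBigO_second_correction (hT : IsWeightedCollision T) (hM : IsMultiplication M W) {ε : ℝ}
    (hε : 0 < ε) :
    (fun s : ℝ => inner ℂ velocityL2
        (shiftInv s M ((M - T) (shiftInv s T ((M - T) (shiftInv s M velocityL2))))))
      =O[𝓝[>] 0] (fun s : ℝ => s ^ (-(1 / 5) - ε : ℝ)) := by
  obtain ⟨T1, T2, h⟩ := hT.exists_isCollision hM
  have hη : 0 < min (ε / 3) (1 / 10) := by positivity
  obtain ⟨D, hD⟩ := exists_second_correction_le hη (min_le_right _ _)
  exact isBigO_of_forall_norm_le (by linarith [min_le_left (ε / 3) (1 / 10)]) fun s hs => hD h hs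

/-- The resolvent identity is used once with the exact resolvent on the left and once with it on the
right. In the second term the exact resolvent then stands between two factors A, where the form
bound applies. -/
lemma inner_shiftInv_sub (hT : IsNonneg T) (hM : IsNonneg M) {s : ℝ} (hs : 0 < s) (f : L2) :
    inner ℂ f (shiftInv s T f) - inner ℂ f (shiftInv s M f)
      = inner ℂ f (shiftInv s M ((M - T) (shiftInv s M f)))
        + inner ℂ f (shiftInv s M ((M - T) (shiftInv s T ((M - T) (shiftInv s M f))))) := by
  conv_lhs => rw [shiftInv_sub_shiftInv' hT hM hs f, shiftInv_sub_shiftInv hT hM hs]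
  rw [inner_add_right, inner_add_right]
  ring

lemma isBigO_relaxation_error (hT : IsWeightedCollision T) (hM : IsMultiplication M W) {ε : ℝ}
    (hε : 0 < ε) :
    (fun s : ℝ => inner ℂ velocityL2 (shiftInv s T velocityL2)
        - inner ℂ velocityL2 (shiftInv s M velocityL2))
      =O[𝓝[>] 0] (fun s : ℝ => s ^ (-(1 / 5) - ε : ℝ)) := by
  obtain ⟨T1, T2, h⟩ := hT.exists_isCollision hM
  obtain ⟨C, hC⟩ := exists_admissible_dispersion
  refine ((isBigO_first_correction hT hM hε).add (isBigO_second_correction hT hM hε)).congr' ?_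
    EventuallyEq.rfl
  filter_upwards [self_mem_nhdsWithin] with s hs
  exact (inner_shiftInv_sub (h.isNonneg hC) (isNonneg_multiplication hM W_nonneg) hs _).symm

lemma tendsto_rpow_mul_re_inner (hT : IsWeightedCollision T) (hM : IsMultiplication M W) :
    Tendsto (fun s : ℝ => s ^ (2 / 5 : ℝ) * (inner ℂ velocityL2 (shiftInv s T velocityL2)).re)
      (𝓝[>] 0) (𝓝 c0) := by
  -- Any ε < 1/5 would do; here 2/5 - 1/5 - 1/10 = 1/10 is a positive power.
  have herr := (isBigO_relaxation_error hT hM (ε := 1 / 10) (by norm_num))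
  have h0 : (fun s : ℝ => ((s ^ (2 / 5 : ℝ) : ℝ) : ℂ)) =O[𝓝[>] 0] fun s : ℝ => s ^ (2 / 5 : ℝ) :=
    IsBigO.of_bound 1 (Eventually.of_forall fun s => by rw [Complex.norm_real, one_mul])
  have h2 : Tendsto (fun s : ℝ => s ^ (1 / 10 : ℝ)) (𝓝[>] 0) (𝓝 0) := by
    have := (continuousAt_rpow_const (0 : ℝ) (1 / 10) (Or.inr (by norm_num))).tendsto
    rw [zero_rpow (by norm_num)] at this
    exact this.mono_left nhdsWithin_le_nhds
  have h3 : (fun s : ℝ => ((s ^ (2 / 5 : ℝ) : ℝ) : ℂ) * (inner ℂ velocityL2 (shiftInv s T velocityL2)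
      - inner ℂ velocityL2 (shiftInv s M velocityL2))) =O[𝓝[>] 0] fun s : ℝ => s ^ (1 / 10 : ℝ) := by
    refine (h0.mul herr).congr' EventuallyEq.rfl ?_
    filter_upwards [self_mem_nhdsWithin] with s hs
    rw [← rpow_add hs]
    norm_num
  have h4 := (Complex.continuous_re.tendsto 0).comp (h3.trans_tendsto h2)
  have h5 := h4.add tendsto_relaxation
  rw [Complex.zero_re, zero_add] at h5
  refine h5.congr' ?_
  filter_upwards [self_mem_nhdsWithin] with s hs
  rw [Function.comp_apply, Complex.re_ofReal_mul, inner_shiftInv_multiplication_velocity hM hs,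
    Complex.sub_re, Complex.ofReal_re]
  ring

end FPU
end

/-! ### Assembly of the theorem. -/

theorem theorem2p3 :
    -- the operators `L̃ = ω L ω` and `W` are well defined on `L²(I)`
    (∃! T : FPU.L2 →L[ℂ] FPU.L2, FPU.IsWeightedCollision T) ∧
    (∃! M : FPU.L2 →L[ℂ] FPU.L2, FPU.IsMultiplication M FPU.W) ∧
    -- the constants are finite and positive (an integral with positive value converges)
    0 < FPU.w0 ∧ 0 < FPU.c0 ∧
    ∀ T M : FPU.L2 →L[ℂ] FPU.L2,
      FPU.IsWeightedCollision T → FPU.IsMultiplication M FPU.W →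
      (∀ s : ℝ, 0 < s → IsUnit (FPU.shift s T) ∧ IsUnit (FPU.shift s M)) ∧
      ∃ R : ℝ → ℝ,
        (∀ s : ℝ, 0 < s → 0 < R s ∧
          (R s : ℂ) = inner ℂ FPU.velocityL2 (FPU.shiftInv s T FPU.velocityL2)) ∧
        Tendsto (fun s : ℝ => s ^ (2 / 5 : ℝ) * R s) (𝓝[>] 0) (𝓝 FPU.c0) ∧
        -- the relaxation time approximation, and the two correction terms with `A = W - L̃`
        ∀ ε : ℝ, 0 < ε →
          (fun s : ℝ => (R s : ℂ) -
              inner ℂ FPU.velocityL2 (FPU.shiftInv s M FPU.velocityL2))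
            =O[𝓝[>] 0] (fun s : ℝ => s ^ (-(1 / 5) - ε : ℝ)) ∧
          (fun s : ℝ => inner ℂ FPU.velocityL2
              (FPU.shiftInv s M ((M - T) (FPU.shiftInv s M FPU.velocityL2))))
            =O[𝓝[>] 0] (fun s : ℝ => s ^ (-(1 / 5) - ε : ℝ)) ∧
          (fun s : ℝ => inner ℂ FPU.velocityL2
              (FPU.shiftInv s M ((M - T) (FPU.shiftInv s T
                ((M - T) (FPU.shiftInv s M FPU.velocityL2))))))
            =O[𝓝[>] 0] (fun s : ℝ => s ^ (-(1 / 5) - ε : ℝ)) := by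
  refine ⟨FPU.existsUnique_isWeightedCollision, FPU.existsUnique_isMultiplication_W, FPU.w0_pos,
    FPU.c0_pos, fun T M hT hM => ?_⟩
  obtain ⟨T1, T2, h⟩ := hT.exists_isCollision hM
  obtain ⟨C, hC⟩ := FPU.exists_admissible_dispersion
  have hTn := h.isNonneg hC
  have hMn := FPU.isNonneg_multiplication hM FPU.W_nonneg
  have hR : ∀ s : ℝ, 0 < s →
      (((inner ℂ FPU.velocityL2 (FPU.shiftInv s T FPU.velocityL2)).re : ℝ) : ℂ)
        = inner ℂ FPU.velocityL2 (FPU.shiftInv s T FPU.velocityL2) := fun s hs =>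
    Complex.ext (Complex.ofReal_re _) (by rw [Complex.ofReal_im, hTn.shiftInv_im hs])
  refine ⟨fun s hs => ⟨hTn.isUnit_shift hs, hMn.isUnit_shift hs⟩,
    fun s => (inner ℂ FPU.velocityL2 (FPU.shiftInv s T FPU.velocityL2)).re,
    fun s hs => ⟨hTn.re_inner_shiftInv_pos hs FPU.velocityL2_ne_zero, hR s hs⟩,
    FPU.tendsto_rpow_mul_re_inner hT hM, fun ε hε =>
    ⟨(FPU.isBigO_relaxation_error hT hM hε).congr' ?_ EventuallyEq.rfl,
      FPU.isBigO_first_correction hT hM hε, FPU.isBigO_second_correction hT hM hε⟩⟩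
  filter_upwards [self_mem_nhdsWithin] with s hs
  rw [hR s hs]
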